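/- \textbf{Models.} A \emph{CLNL model} is a symmetric monoidal adjunction $F\dashv G$, $F:\mathbf V\to\mathbf C$, with unit $\eta$ and counit $\epsilon$, where $\mathbf V$ is cartesian closed, $\mathbf C$ is symmetric monoidal closed, and both have finite coproducts; put $!=F\circ G$. An \emph{ECLNL model} consists of: (i) a CLNL model; (ii) a $\mathbf V$-symmetric monoidal closed category $\mathscr C$ with underlying symmetric monoidal closed category $\mathbf C$, with $\mathbf V$-copowers $\odot$ and finite $\mathbf V$-coproducts, such that $F\dashv G$ is the underlying adjunction of a $\mathbf V$-adjunction $-\odot I\dashv\mathscr C(I,-)$; (iii) a symmetric monoidal category $\mathbf M$ and a strong symmetric monoidal functor $E:\mathbf M\to\mathbf C$. An endofunctor $T$ is \emph{algebraically compact} if it has an initial algebra $\omega:T\Omega\cong\Omega$ such that $\omega^{-1}$ is a final coalgebra. A \emph{model with recursion} is a model such that $A\otimes{!}(-)$ is algebraically compact for every $A\in\mathbf C$. \textbf{Calculi.} The ECLNL calculus with recursion has types $$A,B::=0\mid A+B\mid I\mid A\otimes B\mid A\multimap B\mid{!A}\mid\alpha\mid\mathrm{Diag}(T,U),$$ where $\alpha$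 ranges over a set of wire types, each interpreted as an object of $\mathbf M$, and $T,U::=\alpha\mid I\mid T\otimes U$ are the $\mathbf M$-types. The intuitionistic types are $P,R::=0\mid P+R\mid I\mid P\otimes R\mid{!A}\mid\mathrm{Diag}(T,U)$. Label contexts $Q$ are functions from finite sets of labels to wire types; a labelled string diagram $S:Q\to Q'$ is a morphism of $\mathbf M$ between the interpretations of $Q$ and $Q'$. Terms (up to renaming of bound variables) are $$x,\ c,\ \mathrm{let}\ x=m\ \mathrm{in}\ n,\ \square_A m,\ \mathrm{left}_{A,B}m,\ \mathrm{right}_{A,B}m,\ \mathrm{case}\ m\ \mathrm{of}\ \{\mathrm{left}\ x\to n\mid\mathrm{right}\ y\to p\},\ *,\ m;n,\ \langle m,n\rangle,$$ $$\mathrm{let}\ \langle x,y\rangle=m\ \mathrm{in}\ n,\ \lambda x^A.m,\ mn,\ \mathrm{lift}\ m,\ \mathrm{force}\ m,\ \ell,\ \mathrm{box}_Tm,\ \mathrm{apply}(m,n),\ (\vec\ell,S,\vec\ell'),\ \mathrm{rec}\ x^{!A}.m,$$ with labels $\ell$, label tuples $\vec\ell$ and constants $c$, each constant having a type $A_c$.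 The judgement $\Gamma;Q\vdash m:A$ is given by the usual mixed-context rules: the contexts in the conclusion of a rule with several premises are shared out among the premises, except that intuitionistic variables may be duplicated (and the branches of a case use the same contexts), and only intuitionistic variables may be discarded; $\mathrm{lift}\ m$ and $\mathrm{rec}\ x^{!A}.m$ require an intuitionistic context $\Phi$ and no labels, the rule for $\mathrm{rec}$ being: from $\Phi,x:{!A};\emptyset\vdash m:A$ infer $\Phi;\emptyset\vdash\mathrm{rec}\ x^{!A}.m:A$. A configuration $(S,m)$ is well typed, $Q\vdash(S,m):A;Q'$, if $S:Q\to Q''\cup Q'$ with $Q'',Q'$ disjoint and $\emptyset;Q''\vdash m:A$. The relations $(S,m)\Downarrow(S',v)$ and $(S,m)\Downarrow\mathrm{Error}$ are the call-by-value big-step evaluation and run-time error relations (an error occurs when an elimination form meets a value of the wrong shape, when appending a diagram is undefined, or at a free variable), extended by $$\frac{(S,m[\mathrm{lift}\ \mathrm{rec}\ x^{!A}.m/x])\Downarrow(S',v)}{(S,\mathrm{rec}\ x^{!A}.m)\Downarrow(S',v)}$$ and by the same rule for Error. Constants are values that no further evaluation or error rule inspects. The CLNL calculus with recursion is the diagram-free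 fragment: no $\alpha$, $\mathrm{Diag}$, labels, box, apply, $(\vec\ell,S,\vec\ell')$, and no label contexts or diagram components; its relations are $\Gamma\vdash m:A$, $m\Downarrow v$ and $m\Downarrow\mathrm{Error}$. \textbf{Interpretation.} Types and contexts are interpreted in $\mathbf C$ by the evident structure, with $[\![{!A}]\!]={!}[\![A]\!]$, $[\![\alpha]\!]=E([\![\alpha]\!]_{\mathbf M})$ and $[\![\mathrm{Diag}(T,U)]\!]=F(\mathscr C([\![T]\!],[\![U]\!]))$, and a derivation of $\Gamma;Q\vdash m:A$ is interpreted as a morphism $[\![\Gamma]\!]\otimes[\![Q]\!]\to[\![A]\!]$ by induction, using on intuitionistic contexts $[\![\Phi]\!]\cong F(X)$ the discard, copy ($\Delta$) and $\mathbf{lift}$ maps induced by $X\to1$, $X\to X\times X$ and $\eta_X$. Constants are interpreted as morphisms $I\to[\![A_c]\!]$ which, if $A_c$ is intuitionistic, are of the form $F(f)$ up to the canonical isomorphisms $I\cong F(1)$ and $[\![A_c]\!]\cong F(X)$. For $\Phi;\emptyset\vdash\mathrm{rec}\ x^{!A}.m:A$ the interpretation is $\sigma_{[\![m]\!]}\circ\gamma_{[\![\Phi]\!]}$,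 where $\omega:[\![\Phi]\!]\otimes{!}\Omega\to\Omega$ is the initial algebra, $\gamma_{[\![\Phi]\!]}:[\![\Phi]\!]\to\Omega$ is the unique morphism to the final coalgebra $\omega^{-1}$ from the coalgebra $(\mathrm{id}\otimes\mathbf{lift})\circ\Delta:[\![\Phi]\!]\to[\![\Phi]\!]\otimes{!}[\![\Phi]\!]$, and $\sigma_{[\![m]\!]}:\Omega\to[\![A]\!]$ is the unique morphism from the initial algebra to the algebra $[\![m]\!]:[\![\Phi]\!]\otimes{!}[\![A]\!]\to[\![A]\!]$. A labelled string diagram is interpreted through $E$, and a configuration as $[\![(S,m)]\!]=([\![m]\!]\otimes\mathrm{id})\circ[\![S]\!]:[\![Q]\!]\to[\![A]\!]\otimes[\![Q']\!]$. \textbf{Theorem.} For every ECLNL model with recursion and every interpretation of wire types and constants in it: \begin{enumerate} \item (Coherence) If $D_1,D_2$ are derivations of the same judgement $\Gamma;Q\vdash m:A$, then $[\![D_1]\!]=[\![D_2]\!]$. \item (Error freeness) If $Q\vdash(S,m):A;Q'$, then $(S,m)\not\Downarrow\mathrm{Error}$. \item (Subject reduction) If $Q\vdash(S,m):A;Q'$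 and $(S,m)\Downarrow(S',v)$, then $Q\vdash(S',v):A;Q'$. \item (Soundness) If $Q\vdash(S,m):A;Q'$ and $(S,m)\Downarrow(S',v)$, then $[\![(S,m)]\!]=[\![(S',v)]\!]$. \end{enumerate} For every CLNL model with recursion and every interpretation of constants in it, the same holds for the CLNL calculus with recursion: derivations of the same judgement $\Gamma\vdash m:A$ have equal interpretations; if $\emptyset\vdash m:A$, then $m\not\Downarrow\mathrm{Error}$, and if moreover $m\Downarrow v$, then $\emptyset\vdash v:A$ and $[\![m]\!]=[\![v]\!]$. Error freeness and subject reduction, which do not mention the interpretation in $\mathbf C$, hold for every symmetric monoidal category $\mathbf M$ and every interpretation of the wire types in it, whether or not $\mathbf M$ is part of such a model. -/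

import Mathlib

open CategoryTheory MonoidalCategory Limits

universe v₁ v₂ v₃ u₁ u₂ u₃ w k

namespace LNL

/-! ## Categorical models -/

section Models

variable (V : Type u₁) [Category.{v₁} V] [CartesianMonoidalCategory V] [BraidedCategory V]
  [MonoidalClosed V] [HasFiniteCoproducts V]
  (C : Type u₂) [Category.{v₂} C] [MonoidalCategory C] [SymmetricCategory C]
  [MonoidalClosed C] [HasFiniteCoproducts C]

/-- A model of the CLNL calculus: a symmetric monoidal adjunction `F ⊣ G` between a cartesian
closed category `V` and a symmetric monoidal closed category `C`, both with finite coproducts.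
(In a symmetric monoidal adjunction the left adjoint is always strong.) -/
structure CLNLModel where
  F : V ⥤ C
  G : C ⥤ V
  adj : F ⊣ G
  [braidedF : F.Braided]
  [laxBraidedG : G.LaxBraided]
  [monoidalAdj : adj.IsMonoidal]

attribute [instance] CLNLModel.braidedF CLNLModel.laxBraidedG CLNLModel.monoidalAdj

variable {V C} in
/-- The comonad endofunctor `! = F ∘ G` on `C`. -/
def CLNLModel.bang (X : CLNLModel V C) : C ⥤ C := X.G ⋙ X.F

section Enriched

variable [EnrichedOrdinaryCategory V C]

/-- The structure of a `V`-symmetric monoidal category on the `V`-category `C`, whose underlying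
symmetric monoidal category is the given one: the tensor product is a `V`-bifunctor and the
structural isomorphisms are `V`-natural. -/
structure EnrichedTensor where
  /-- the action of the tensor product on hom objects -/
  hom (A B A' B' : C) :
    (A ⟶[V] A') ⊗ (B ⟶[V] B') ⟶ ((A ⊗ B : C) ⟶[V] (A' ⊗ B' : C))
  hom_underlying {A B A' B' : C} (f : A ⟶ A') (g : B ⟶ B') :
    (λ_ (𝟙_ V)).inv ≫ (eHomEquiv V f ⊗ₘ eHomEquiv V g) ≫ hom A B A' B' =
      eHomEquiv V (f ⊗ₘ g)
  hom_comp (A B A' B' A'' B'' : C) :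
    (hom A B A' B' ⊗ₘ hom A' B' A'' B'') ≫ eComp V (A ⊗ B : C) (A' ⊗ B' : C) (A'' ⊗ B'' : C) =
      tensorμ (A ⟶[V] A') (B ⟶[V] B') (A' ⟶[V] A'') (B' ⟶[V] B'') ≫
        (eComp V A A' A'' ⊗ₘ eComp V B B' B'') ≫ hom A B A'' B''
  associator_natural (A B D A' B' D' : C) :
    hom A B A' B' ▷ (D ⟶[V] D') ≫ hom (A ⊗ B) D (A' ⊗ B') D' ≫
        eHomWhiskerLeft V _ (α_ A' B' D').hom =
      (α_ _ _ _).hom ≫ (A ⟶[V] A') ◁ hom B D B' D' ≫ hom A (B ⊗ D) A' (B' ⊗ D') ≫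
        eHomWhiskerRight V (α_ A B D).hom _
  leftUnitor_natural (A A' : C) :
    (λ_ _).inv ≫ eId V (𝟙_ C) ▷ (A ⟶[V] A') ≫ hom (𝟙_ C) A (𝟙_ C) A' ≫
        eHomWhiskerLeft V _ (λ_ A').hom =
      eHomWhiskerRight V (λ_ A).hom A'
  rightUnitor_natural (A A' : C) :
    (ρ_ _).inv ≫ (A ⟶[V] A') ◁ eId V (𝟙_ C) ≫ hom A (𝟙_ C) A' (𝟙_ C) ≫
        eHomWhiskerLeft V _ (ρ_ A').hom =
      eHomWhiskerRight V (ρ_ A).hom A'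
  braiding_natural (A B A' B' : C) :
    hom A B A' B' ≫ eHomWhiskerLeft V _ (β_ A' B').hom =
      (β_ _ _).hom ≫ hom B A B' A' ≫ eHomWhiskerRight V (β_ A B).hom _

variable {V C}

/-- The `V`-morphism `C(B, A ⊸ D) ⟶ C(A ⊗ B, D)` induced by the evaluation `A ⊗ (A ⊸ D) ⟶ D`. -/
def EnrichedTensor.uncurryHom (T : EnrichedTensor V C) (A B D : C) :
    (B ⟶[V] ((ihom A).obj D)) ⟶ ((A ⊗ B : C) ⟶[V] D) :=
  (λ_ _).inv ≫ eId V A ▷ _ ≫ T.hom A B A ((ihom A).obj D) ≫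
    eHomWhiskerLeft V _ ((ihom.ev A).app D)

/-- The `V`-morphism `C(P, B) ⟶ [Y, C(A, B)]` induced by `u : Y ⟶ C(A, P)`. -/
def copowerHom {Y : V} {A P : C} (u : Y ⟶ (A ⟶[V] P)) (B : C) :
    (P ⟶[V] B) ⟶ (ihom Y).obj (A ⟶[V] B) :=
  MonoidalClosed.curry (u ▷ _ ≫ eComp V A P B)

/-- `u` exhibits `P` as the `V`-copower of `A` by `Y`: the induced morphism
`C(P, B) ⟶ [Y, C(A, B)]` is invertible for all `B` (every morphism induced by some `u` is `V`-natural, and by the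
enriched Yoneda lemma every `V`-natural morphism is of this form). -/
def IsCopower {Y : V} {A P : C} (u : Y ⟶ (A ⟶[V] P)) : Prop :=
  ∀ B : C, IsIso (copowerHom u B)

variable (V C)

/-- An enriched CLNL model on a `V`-category with underlying category `C`.
The self-enrichment of `V` has finite `V`-coproducts because `V` is cartesian closed with
finite coproducts. -/
structure EnrichedCLNLModel extends CLNLModel V C where
  /-- `C` is `V`-symmetric monoidal -/
  tensor : EnrichedTensor V C
  /-- `C` is `V`-symmetric monoidal closed: the evaluations exhibit the internal hom as a right
  `V`-adjoint of the tensor product -/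
  closed (A B D : C) : IsIso (tensor.uncurryHom A B D)
  /-- `C` has `V`-copowers -/
  copowers (Y : V) (A : C) : ∃ (P : C) (u : Y ⟶ (A ⟶[V] P)), IsCopower u
  /-- the initial object is a `V`-initial object -/
  initial (A : C) : IsIso (CartesianMonoidalCategory.toUnit ((⊥_ C) ⟶[V] A))
  /-- binary coproducts are `V`-coproducts -/
  coproducts (A B D : C) : IsIso (CartesianMonoidalCategory.lift
    (eHomWhiskerRight V (coprod.inl : A ⟶ A ⨿ B) D)
    (eHomWhiskerRight V (coprod.inr : B ⟶ A ⨿ B) D))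
  /-- the right adjoint is the underlying functor of `C(I, -)` -/
  isoHomUnit : G ≅ (eHomFunctor V C).obj (Opposite.op (𝟙_ C))
  /-- the adjunction is the underlying adjunction of the `V`-adjunction `- ⊙ I ⊣ C(I, -)`:
  its unit exhibits `F Y` as the `V`-copower of `I` by `Y` -/
  copowerUnit (Y : V) : IsCopower (adj.unit.app Y ≫ isoHomUnit.hom.app (F.obj Y))

/-- An ECLNL model: an enriched CLNL model with a symmetric monoidal category `M` (of string
diagrams) and a strong symmetric monoidal functor `E : M ⥤ C`. -/
structure ECLNLModel (M : Type u₃) [Category.{v₃} M] [MonoidalCategory M] [SymmetricCategory M]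
    extends EnrichedCLNLModel V C where
  E : M ⥤ C
  [braidedE : E.Braided]

attribute [instance] ECLNLModel.braidedE

end Enriched

end Models

section AlgebraicCompactness

variable {D : Type u₁} [Category.{v₁} D]

/-- An initial algebra `T Ω ≅ Ω` whose inverse is a final coalgebra. -/
structure BifreeAlgebra (T : D ⥤ D) where
  carrier : D
  str : T.obj carrier ≅ carrier
  initial : IsInitial (⟨carrier, str.hom⟩ : Endofunctor.Algebra T)
  final : IsTerminal (⟨carrier, str.inv⟩ : Endofunctor.Coalgebra T)

/-- `T` is algebraically compact. (An initial algebra is always an isomorphism.) -/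
def AlgebraicallyCompact (T : D ⥤ D) : Prop := Nonempty (BifreeAlgebra T)

/-- `A ⊗ T(-)` is algebraically compact for every object `A`. -/
def ParametricallyAlgebraicallyCompact [MonoidalCategory D] (T : D ⥤ D) : Prop :=
  ∀ A : D, AlgebraicallyCompact (T ⋙ tensorLeft A)

end AlgebraicCompactness

/-! ## Types and contexts

Two calculi are defined simultaneously: `δ : Prop` says whether the language has string diagrams.
For `δ = True` this is ECLNL; for `δ = False` (and no wire types) all constructors with an
argument `δ` are unavailable and this is its diagram-free fragment CLNL. -/

/-- `M`-types over a set `W` of wire types. -/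
inductive MTy (W : Type w) : Type w
  | wire (α : W) : MTy W
  | one : MTy W
  | tensor (T U : MTy W) : MTy W

inductive Ty (δ : Prop) (W : Type w) : Type w
  | zero : Ty δ W
  | sum (A B : Ty δ W) : Ty δ W
  | one : Ty δ W
  | tensor (A B : Ty δ W) : Ty δ W
  | lolli (A B : Ty δ W) : Ty δ W
  | bang (A : Ty δ W) : Ty δ W
  | wire (h : δ) (α : W) : Ty δ W
  | diag (h : δ) (T U : MTy W) : Ty δ W

/-- `M`-types are types. -/
def MTy.toTy {δ : Prop} {W : Type w} (h : δ) : MTy W → Ty δ W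
  | .wire α => .wire h α
  | .one => .one
  | .tensor T U => .tensor (T.toTy h) (U.toTy h)

/-- The intuitionistic types `P ::= 0 | P + R | I | P ⊗ R | !A | Diag(T, U)`. -/
def Ty.Intuit {δ : Prop} {W : Type w} : Ty δ W → Prop
  | .zero => True
  | .sum A B => A.Intuit ∧ B.Intuit
  | .one => True
  | .tensor A B => A.Intuit ∧ B.Intuit
  | .lolli _ _ => False
  | .bang _ => True
  | .wire _ _ => False
  | .diag _ _ _ => True

/-- Variable contexts: finite partial functions from variables to types. Variables are de Bruijn
indices; the `i`-th entry is the type of variable `i`, or `none` if `i` is not in the domain. -/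
abbrev Ctx (δ : Prop) (W : Type w) := List (Option (Ty δ W))

def SlotIntuit {δ : Prop} {W : Type w} : Option (Ty δ W) → Prop
  | none => True
  | some A => A.Intuit

/-- Intuitionistic variable contexts. -/
def Ctx.Intuit {δ : Prop} {W : Type w} : Ctx δ W → Prop
  | [] => True
  | o :: Γ => SlotIntuit o ∧ Ctx.Intuit Γ

/-- `CSplit Γ Γ₁ Γ₂`: the context `Γ` is of the form `Φ, Δ₁, Δ₂` with `Φ` intuitionistic, and
`Γ₁ = Φ, Δ₁` and `Γ₂ = Φ, Δ₂`. -/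
inductive CSplit {δ : Prop} {W : Type w} : Ctx δ W → Ctx δ W → Ctx δ W → Type w
  | nil : CSplit [] [] []
  | none {Γ Γ₁ Γ₂ : Ctx δ W} (s : CSplit Γ Γ₁ Γ₂) :
      CSplit (none :: Γ) (none :: Γ₁) (none :: Γ₂)
  | both {Γ Γ₁ Γ₂ : Ctx δ W} {P : Ty δ W} (h : P.Intuit) (s : CSplit Γ Γ₁ Γ₂) :
      CSplit (some P :: Γ) (some P :: Γ₁) (some P :: Γ₂)
  | left {Γ Γ₁ Γ₂ : Ctx δ W} {A : Ty δ W} (s : CSplit Γ Γ₁ Γ₂) :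
      CSplit (some A :: Γ) (some A :: Γ₁) (none :: Γ₂)
  | right {Γ Γ₁ Γ₂ : Ctx δ W} {A : Ty δ W} (s : CSplit Γ Γ₁ Γ₂) :
      CSplit (some A :: Γ) (none :: Γ₁) (some A :: Γ₂)

/-- `Lookup Γ i A`: the context `Γ` is of the form `Φ, x : A` where `Φ` is intuitionistic and
`x` is the variable `i`. -/
inductive Lookup {δ : Prop} {W : Type w} : Ctx δ W → ℕ → Ty δ W → Type w
  | zero {Γ : Ctx δ W} {A : Ty δ W} (h : Ctx.Intuit Γ) : Lookup (some A :: Γ) 0 A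
  | succ {Γ : Ctx δ W} {A : Ty δ W} {i : ℕ} {o : Option (Ty δ W)} (h : SlotIntuit o)
      (l : Lookup Γ i A) : Lookup (o :: Γ) (i + 1) A

/-- Label contexts: functions from a finite set of labels (natural numbers) to wire types,
given as the list of their entries in increasing order of the labels. -/
structure LCtx (W : Type w) : Type w where
  entries : List (ℕ × W)
  sorted : entries.Pairwise fun a b => a.1 < b.1

def LCtx.empty (W : Type w) : LCtx W := ⟨[], List.Pairwise.nil⟩

/-- The label context `ℓ : α`. -/
def LCtx.single {W : Type w} (l : ℕ) (α : W) : LCtx W := ⟨[(l, α)], List.pairwise_singleton _ _⟩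

/-- The set of labels of a label context. -/
def LCtx.labels {W : Type w} (Q : LCtx W) : List ℕ := Q.entries.map Prod.fst

/-- `Interleave l l₁ l₂`: the list `l` is an interleaving of `l₁` and `l₂`. -/
inductive Interleave {α : Type w} : List α → List α → List α → Type w
  | nil : Interleave [] [] []
  | left {a : α} {l l₁ l₂ : List α} (s : Interleave l l₁ l₂) :
      Interleave (a :: l) (a :: l₁) l₂
  | right {a : α} {l l₁ l₂ : List α} (s : Interleave l l₁ l₂) :
      Interleave (a :: l) l₁ (a :: l₂)

/-- `LSplit Q Q₁ Q₂`: the label contexts `Q₁` and `Q₂` are disjoint and `Q` is their union. -/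
abbrev LSplit {W : Type w} (Q Q₁ Q₂ : LCtx W) : Type w :=
  Interleave Q.entries Q₁.entries Q₂.entries

/-- Label tuples. -/
inductive LTuple : Type
  | label (l : ℕ) : LTuple
  | unit : LTuple
  | pair (a b : LTuple) : LTuple

/-- The typing judgement `∅; Q ⊢ a : T` of label tuples, that is, the rules (label), (*) and
(pair) with empty variable context. -/
inductive LTyping {W : Type w} : LCtx W → LTuple → MTy W → Type w
  | label (l : ℕ) (α : W) : LTyping (LCtx.single l α) (.label l) (.wire α)
  | unit : LTyping (LCtx.empty W) .unit .one
  | pair {Q Q₁ Q₂ : LCtx W} {a b : LTuple} {T U : MTy W} (s : LSplit Q Q₁ Q₂)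
      (d : LTyping Q₁ a T) (e : LTyping Q₂ b U) : LTyping Q (.pair a b) (.tensor T U)

section Wires

/-! Interpretation of label contexts, `M`-types and label tuples in a symmetric monoidal category,
given the interpretation of the wire types. -/

variable {W : Type w} {D : Type u₁} [Category.{v₁} D] [MonoidalCategory D]

def MTy.obj (i : W → D) : MTy W → D
  | .wire α => i α
  | .one => 𝟙_ D
  | .tensor T U => T.obj i ⊗ U.obj i

def entriesObj (i : W → D) : List (ℕ × W) → D
  | [] => 𝟙_ D
  | a :: l => i a.2 ⊗ entriesObj i l

def LCtx.obj (i : W → D) (Q : LCtx W) : D := entriesObj i Q.entries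

def Interleave.iso [SymmetricCategory D] (i : W → D) : {l l₁ l₂ : List (ℕ × W)} →
    Interleave l l₁ l₂ → (entriesObj i l ≅ entriesObj i l₁ ⊗ entriesObj i l₂)
  | _, _, _, .nil => (λ_ (𝟙_ D)).symm
  | _, _, _, .left s => whiskerLeftIso _ (s.iso i) ≪≫ (α_ _ _ _).symm
  | _, _, _, .right s =>
      whiskerLeftIso _ (s.iso i) ≪≫ (α_ _ _ _).symm ≪≫ whiskerRightIso (β_ _ _) _ ≪≫ α_ _ _ _

/-- The interpretation of a label tuple is an isomorphism. -/
def LTyping.iso [SymmetricCategory D] (i : W → D) : {Q : LCtx W} → {a : LTuple} → {T : MTy W} →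
    LTyping Q a T → (Q.obj i ≅ T.obj i)
  | _, _, _, .label _ α => ρ_ (i α)
  | _, _, _, .unit => Iso.refl _
  | _, _, _, .pair s d e => s.iso i ≪≫ (d.iso i ⊗ᵢ e.iso i)

end Wires

/-! ## Terms -/

section Terms

/-- Terms, up to renaming of bound variables (de Bruijn indices). `K` is the set of constants and
`i` is the interpretation of the wire types in the category `M` of string diagrams. The bound
variables are: variable `0` in the body of `letIn`, `case`, `lam` and `fix`; in `letPair m n`,
i.e. `let ⟨x, y⟩ = m in n`, `x` is variable `1` of `n` and `y` is variable `0`. The term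
`fix A m` is `rec x^{!A}. m`, and `boxed a S b` is the boxed diagram `(a, S, b)`, where
`S : Q → Q'` is a labelled string diagram. -/
inductive Term (δ : Prop) (K : Type k) {W : Type w} {M : Type u₃} [Category.{v₃} M]
    [MonoidalCategory M] (i : W → M) : Type (max k w v₃)
  | var (n : ℕ) : Term δ K i
  | const (c : K) : Term δ K i
  | letIn (m n : Term δ K i) : Term δ K i
  | abort (A : Ty δ W) (m : Term δ K i) : Term δ K i
  | inl (A B : Ty δ W) (m : Term δ K i) : Term δ K i
  | inr (A B : Ty δ W) (m : Term δ K i) : Term δ K i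
  | case (m n p : Term δ K i) : Term δ K i
  | star : Term δ K i
  | seq (m n : Term δ K i) : Term δ K i
  | pair (m n : Term δ K i) : Term δ K i
  | letPair (m n : Term δ K i) : Term δ K i
  | lam (A : Ty δ W) (m : Term δ K i) : Term δ K i
  | app (m n : Term δ K i) : Term δ K i
  | lift (m : Term δ K i) : Term δ K i
  | force (m : Term δ K i) : Term δ K i
  | fix (A : Ty δ W) (m : Term δ K i) : Term δ K i
  | label (h : δ) (l : ℕ) : Term δ K i
  | box (h : δ) (T : MTy W) (m : Term δ K i) : Term δ K i
  | apply (h : δ) (m n : Term δ K i) : Term δ K i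
  | boxed (h : δ) (a : LTuple) {Q Q' : LCtx W} (S : Q.obj i ⟶ Q'.obj i) (b : LTuple) : Term δ K i

variable {δ : Prop} {K : Type k} {W : Type w} {M : Type u₃} [Category.{v₃} M]
  [MonoidalCategory M] {i : W → M}

/-- Label tuples are terms. -/
def LTuple.toTerm (h : δ) : LTuple → Term δ K i
  | .label l => .label h l
  | .unit => .star
  | .pair a b => .pair (a.toTerm h) (b.toTerm h)

/-- Extension of a renaming under a binder. -/
def upRen (r : ℕ → ℕ) : ℕ → ℕ
  | 0 => 0
  | n + 1 => r n + 1

def Term.rename (r : ℕ → ℕ) : Term δ K i → Term δ K i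
  | .var n => .var (r n)
  | .const c => .const c
  | .letIn m n => .letIn (m.rename r) (n.rename (upRen r))
  | .abort A m => .abort A (m.rename r)
  | .inl A B m => .inl A B (m.rename r)
  | .inr A B m => .inr A B (m.rename r)
  | .case m n p => .case (m.rename r) (n.rename (upRen r)) (p.rename (upRen r))
  | .star => .star
  | .seq m n => .seq (m.rename r) (n.rename r)
  | .pair m n => .pair (m.rename r) (n.rename r)
  | .letPair m n => .letPair (m.rename r) (n.rename (upRen (upRen r)))
  | .lam A m => .lam A (m.rename (upRen r))
  | .app m n => .app (m.rename r) (n.rename r)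
  | .lift m => .lift (m.rename r)
  | .force m => .force (m.rename r)
  | .fix A m => .fix A (m.rename (upRen r))
  | .label h l => .label h l
  | .box h T m => .box h T (m.rename r)
  | .apply h m n => .apply h (m.rename r) (n.rename r)
  | .boxed h a S b => .boxed h a S b

/-- Extension of a substitution under a binder. -/
def upSubst (s : ℕ → Term δ K i) : ℕ → Term δ K i
  | 0 => .var 0
  | n + 1 => (s n).rename Nat.succ

/-- Simultaneous capture-avoiding substitution. -/
def Term.subst (s : ℕ → Term δ K i) : Term δ K i → Term δ K i
  | .var n => s n
  | .const c => .const c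
  | .letIn m n => .letIn (m.subst s) (n.subst (upSubst s))
  | .abort A m => .abort A (m.subst s)
  | .inl A B m => .inl A B (m.subst s)
  | .inr A B m => .inr A B (m.subst s)
  | .case m n p => .case (m.subst s) (n.subst (upSubst s)) (p.subst (upSubst s))
  | .star => .star
  | .seq m n => .seq (m.subst s) (n.subst s)
  | .pair m n => .pair (m.subst s) (n.subst s)
  | .letPair m n => .letPair (m.subst s) (n.subst (upSubst (upSubst s)))
  | .lam A m => .lam A (m.subst (upSubst s))
  | .app m n => .app (m.subst s) (n.subst s)
  | .lift m => .lift (m.subst s)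
  | .force m => .force (m.subst s)
  | .fix A m => .fix A (m.subst (upSubst s))
  | .label h l => .label h l
  | .box h T m => .box h T (m.subst s)
  | .apply h m n => .apply h (m.subst s) (n.subst s)
  | .boxed h a S b => .boxed h a S b

/-- `n[v / x]`, where `x` is variable `0`. -/
def Term.inst (n v : Term δ K i) : Term δ K i :=
  n.subst fun
    | 0 => v
    | j + 1 => .var j

/-- `n[v / x, v' / y]`, where `x` is variable `1` and `y` is variable `0`. -/
def Term.inst₂ (n v v' : Term δ K i) : Term δ K i :=
  n.subst fun
    | 0 => v'
    | 1 => v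
    | j + 2 => .var j

def LTuple.Occurs (l : ℕ) : LTuple → Prop
  | .label l' => l = l'
  | .unit => False
  | .pair a b => a.Occurs l ∨ b.Occurs l

/-- The label `l` occurs in a term. -/
def Term.Occurs (l : ℕ) : Term δ K i → Prop
  | .var _ => False
  | .const _ => False
  | .letIn m n => m.Occurs l ∨ n.Occurs l
  | .abort _ m => m.Occurs l
  | .inl _ _ m => m.Occurs l
  | .inr _ _ m => m.Occurs l
  | .case m n p => m.Occurs l ∨ n.Occurs l ∨ p.Occurs l
  | .star => False
  | .seq m n => m.Occurs l ∨ n.Occurs l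
  | .pair m n => m.Occurs l ∨ n.Occurs l
  | .letPair m n => m.Occurs l ∨ n.Occurs l
  | .lam _ m => m.Occurs l
  | .app m n => m.Occurs l ∨ n.Occurs l
  | .lift m => m.Occurs l
  | .force m => m.Occurs l
  | .fix _ m => m.Occurs l
  | .label _ l' => l = l'
  | .box _ _ m => m.Occurs l
  | .apply _ m n => m.Occurs l ∨ n.Occurs l
  | .boxed (Q := Q) (Q' := Q') _ a _ b =>
      a.Occurs l ∨ b.Occurs l ∨ l ∈ Q.labels ∨ l ∈ Q'.labels

/-! ## Typing -/

/-- Derivations of the typing judgement `Γ; Q ⊢ m : A`, where `cty c` is the type of the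
constant `c`. -/
inductive Deriv (cty : K → Ty δ W) :
    Ctx δ W → LCtx W → Term δ K i → Ty δ W → Type (max k w v₃)
  | var {Γ : Ctx δ W} {n : ℕ} {A : Ty δ W} (l : Lookup Γ n A) :
      Deriv cty Γ (LCtx.empty W) (.var n) A
  | const {Γ : Ctx δ W} (hΓ : Ctx.Intuit Γ) (c : K) :
      Deriv cty Γ (LCtx.empty W) (.const c) (cty c)
  | letIn {Γ Γ₁ Γ₂ : Ctx δ W} {Q Q₁ Q₂ : LCtx W} {m n : Term δ K i} {A B : Ty δ W}
      (cs : CSplit Γ Γ₁ Γ₂) (ls : LSplit Q Q₁ Q₂)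
      (dm : Deriv cty Γ₁ Q₁ m A) (dn : Deriv cty (some A :: Γ₂) Q₂ n B) :
      Deriv cty Γ Q (.letIn m n) B
  | abort {Γ : Ctx δ W} {Q : LCtx W} {m : Term δ K i} {A : Ty δ W}
      (dm : Deriv cty Γ Q m .zero) : Deriv cty Γ Q (.abort A m) A
  | inl {Γ : Ctx δ W} {Q : LCtx W} {m : Term δ K i} {A B : Ty δ W}
      (dm : Deriv cty Γ Q m A) : Deriv cty Γ Q (.inl A B m) (.sum A B)
  | inr {Γ : Ctx δ W} {Q : LCtx W} {m : Term δ K i} {A B : Ty δ W}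
      (dm : Deriv cty Γ Q m B) : Deriv cty Γ Q (.inr A B m) (.sum A B)
  | case {Γ Γ₁ Γ₂ : Ctx δ W} {Q Q₁ Q₂ : LCtx W} {m n p : Term δ K i} {A B D : Ty δ W}
      (cs : CSplit Γ Γ₁ Γ₂) (ls : LSplit Q Q₁ Q₂)
      (dm : Deriv cty Γ₁ Q₁ m (.sum A B)) (dn : Deriv cty (some A :: Γ₂) Q₂ n D)
      (dp : Deriv cty (some B :: Γ₂) Q₂ p D) : Deriv cty Γ Q (.case m n p) D
  | star {Γ : Ctx δ W} (hΓ : Ctx.Intuit Γ) : Deriv cty Γ (LCtx.empty W) .star .one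
  | seq {Γ Γ₁ Γ₂ : Ctx δ W} {Q Q₁ Q₂ : LCtx W} {m n : Term δ K i} {D : Ty δ W}
      (cs : CSplit Γ Γ₁ Γ₂) (ls : LSplit Q Q₁ Q₂)
      (dm : Deriv cty Γ₁ Q₁ m .one) (dn : Deriv cty Γ₂ Q₂ n D) : Deriv cty Γ Q (.seq m n) D
  | pair {Γ Γ₁ Γ₂ : Ctx δ W} {Q Q₁ Q₂ : LCtx W} {m n : Term δ K i} {A B : Ty δ W}
      (cs : CSplit Γ Γ₁ Γ₂) (ls : LSplit Q Q₁ Q₂)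
      (dm : Deriv cty Γ₁ Q₁ m A) (dn : Deriv cty Γ₂ Q₂ n B) :
      Deriv cty Γ Q (.pair m n) (.tensor A B)
  | letPair {Γ Γ₁ Γ₂ : Ctx δ W} {Q Q₁ Q₂ : LCtx W} {m n : Term δ K i} {A B D : Ty δ W}
      (cs : CSplit Γ Γ₁ Γ₂) (ls : LSplit Q Q₁ Q₂)
      (dm : Deriv cty Γ₁ Q₁ m (.tensor A B))
      (dn : Deriv cty (some B :: some A :: Γ₂) Q₂ n D) : Deriv cty Γ Q (.letPair m n) D
  | lam {Γ : Ctx δ W} {Q : LCtx W} {m : Term δ K i} {A B : Ty δ W}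
      (dm : Deriv cty (some A :: Γ) Q m B) : Deriv cty Γ Q (.lam A m) (.lolli A B)
  | app {Γ Γ₁ Γ₂ : Ctx δ W} {Q Q₁ Q₂ : LCtx W} {m n : Term δ K i} {A B : Ty δ W}
      (cs : CSplit Γ Γ₁ Γ₂) (ls : LSplit Q Q₁ Q₂)
      (dm : Deriv cty Γ₁ Q₁ m (.lolli A B)) (dn : Deriv cty Γ₂ Q₂ n A) :
      Deriv cty Γ Q (.app m n) B
  | lift {Γ : Ctx δ W} {m : Term δ K i} {A : Ty δ W} (hΓ : Ctx.Intuit Γ)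
      (dm : Deriv cty Γ (LCtx.empty W) m A) :
      Deriv cty Γ (LCtx.empty W) (.lift m) (.bang A)
  | force {Γ : Ctx δ W} {Q : LCtx W} {m : Term δ K i} {A : Ty δ W}
      (dm : Deriv cty Γ Q m (.bang A)) : Deriv cty Γ Q (.force m) A
  | fix {Γ : Ctx δ W} {m : Term δ K i} {A : Ty δ W} (hΓ : Ctx.Intuit Γ)
      (dm : Deriv cty (some (.bang A) :: Γ) (LCtx.empty W) m A) :
      Deriv cty Γ (LCtx.empty W) (.fix A m) A
  | label (h : δ) {Γ : Ctx δ W} (hΓ : Ctx.Intuit Γ) (l : ℕ) (α : W) :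
      Deriv cty Γ (LCtx.single l α) (.label h l) (.wire h α)
  | box (h : δ) {Γ : Ctx δ W} {Q : LCtx W} {m : Term δ K i} {T U : MTy W}
      (dm : Deriv cty Γ Q m (.bang (.lolli (T.toTy h) (U.toTy h)))) :
      Deriv cty Γ Q (.box h T m) (.diag h T U)
  | apply (h : δ) {Γ Γ₁ Γ₂ : Ctx δ W} {Q Q₁ Q₂ : LCtx W} {m n : Term δ K i} {T U : MTy W}
      (cs : CSplit Γ Γ₁ Γ₂) (ls : LSplit Q Q₁ Q₂)
      (dm : Deriv cty Γ₁ Q₁ m (.diag h T U)) (dn : Deriv cty Γ₂ Q₂ n (T.toTy h)) :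
      Deriv cty Γ Q (.apply h m n) (U.toTy h)
  | boxed (h : δ) {Γ : Ctx δ W} (hΓ : Ctx.Intuit Γ) {Q Q' : LCtx W} {a b : LTuple}
      {T U : MTy W} (da : LTyping Q a T) (S : Q.obj i ⟶ Q'.obj i) (db : LTyping Q' b U) :
      Deriv cty Γ (LCtx.empty W) (.boxed h a S b) (.diag h T U)

/-! ## Configurations and their evaluation -/

variable (i) in
/-- Labelled string diagrams: morphisms `dom → cod` of the category of label contexts, which are
the morphisms of `M` between the interpretations of the label contexts. -/
structure LDiagram where
  dom : LCtx W
  cod : LCtx W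
  hom : dom.obj i ⟶ cod.obj i

variable (i) in
def LDiagram.id (Q : LCtx W) : LDiagram i := ⟨Q, Q, 𝟙 _⟩

/-- Derivations of the configuration judgement `Q ⊢ (S, m) : A; Q'`. -/
inductive ConfigDeriv (cty : K → Ty δ W) :
    LCtx W → LDiagram i → Term δ K i → Ty δ W → LCtx W → Type (max k w v₃)
  | mk {Q R Q'' Q' : LCtx W} {f : Q.obj i ⟶ R.obj i} {m : Term δ K i} {A : Ty δ W}
      (s : LSplit R Q'' Q') (d : Deriv cty [] Q'' m A) : ConfigDeriv cty Q ⟨Q, R, f⟩ m A Q'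

/-- `Append S c a D b S' c'`: the function `append` is defined at `(S, c, a, D, b)` and
`(S', c')` is a possible result, depending on the choice of fresh labels in `c'`. The label tuples
`a` and `b` consist of the inputs and outputs of `D`; the outputs of `S` are the labels `Qc` of
`c` and further labels `R₀`; and `S'` is `S` followed, on the outputs `Qc`, by the relabelling
`Qc → Qc'` of `D`. -/
inductive Append [SymmetricCategory M] : LDiagram i → LTuple → LTuple → LDiagram i → LTuple →
    LDiagram i → LTuple → Prop
  | mk {Q R R' R₀ Qa Qb Qc Qc' : LCtx W} {f : Q.obj i ⟶ R.obj i} {g : Qa.obj i ⟶ Qb.obj i}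
      {a b c c' : LTuple} {T U : MTy W}
      (da : LTyping Qa a T) (dc : LTyping Qc c T) (db : LTyping Qb b U) (dc' : LTyping Qc' c' U)
      (s : LSplit R Qc R₀) (s' : LSplit R' Qc' R₀)
      (fresh : ∀ l ∈ Qc'.labels, l ∉ Q.labels ∧ l ∉ R.labels) :
      Append ⟨Q, R, f⟩ c a ⟨Qa, Qb, g⟩ b
        ⟨Q, R', f ≫ (s.iso i).hom ≫
          (((dc.iso i).hom ≫ (da.iso i).inv ≫ g ≫ (db.iso i).hom ≫ (dc'.iso i).inv) ▷ _) ≫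
          (s'.iso i).inv⟩ c'

/-- `(Q, a)` is a possible result of `freshlabels(T)`, for the evaluation of `box_T m` where `m`
evaluates to `lift n` with diagram `S`. -/
structure FreshLabels (S : LDiagram i) (n : Term δ K i) (T : MTy W) (Q : LCtx W) (a : LTuple) :
    Prop where
  typing : Nonempty (LTyping Q a T)
  fresh : ∀ l ∈ Q.labels, l ∉ S.dom.labels ∧ l ∉ S.cod.labels ∧ ¬ n.Occurs l

/-- The evaluation relation `(S, m) ⇓ (S', v)` of ECLNL with recursion. -/
inductive Eval [SymmetricCategory M] :
    LDiagram i → Term δ K i → LDiagram i → Term δ K i → Prop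
  | const {S : LDiagram i} {c : K} : Eval S (.const c) S (.const c)
  | letIn {S S' S'' : LDiagram i} {m n v u : Term δ K i} :
      Eval S m S' v → Eval S' (n.inst v) S'' u → Eval S (.letIn m n) S'' u
  | inl {S S' : LDiagram i} {A B : Ty δ W} {m v : Term δ K i} :
      Eval S m S' v → Eval S (.inl A B m) S' (.inl A B v)
  | inr {S S' : LDiagram i} {A B : Ty δ W} {m v : Term δ K i} :
      Eval S m S' v → Eval S (.inr A B m) S' (.inr A B v)
  | caseInl {S S' S'' : LDiagram i} {A B : Ty δ W} {m n p v u : Term δ K i} :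
      Eval S m S' (.inl A B v) → Eval S' (n.inst v) S'' u → Eval S (.case m n p) S'' u
  | caseInr {S S' S'' : LDiagram i} {A B : Ty δ W} {m n p v u : Term δ K i} :
      Eval S m S' (.inr A B v) → Eval S' (p.inst v) S'' u → Eval S (.case m n p) S'' u
  | star {S : LDiagram i} : Eval S .star S .star
  | seq {S S' S'' : LDiagram i} {m n v : Term δ K i} :
      Eval S m S' .star → Eval S' n S'' v → Eval S (.seq m n) S'' v
  | pair {S S' S'' : LDiagram i} {m n v v' : Term δ K i} :
      Eval S m S' v → Eval S' n S'' v' → Eval S (.pair m n) S'' (.pair v v')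
  | letPair {S S' S'' : LDiagram i} {m n v v' u : Term δ K i} :
      Eval S m S' (.pair v v') → Eval S' (n.inst₂ v v') S'' u → Eval S (.letPair m n) S'' u
  | lam {S : LDiagram i} {A : Ty δ W} {m : Term δ K i} : Eval S (.lam A m) S (.lam A m)
  | app {S S' S'' S''' : LDiagram i} {A : Ty δ W} {m m' n v u : Term δ K i} :
      Eval S m S' (.lam A m') → Eval S' n S'' v → Eval S'' (m'.inst v) S''' u →
      Eval S (.app m n) S''' u
  | lift {S : LDiagram i} {m : Term δ K i} : Eval S (.lift m) S (.lift m)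
  | force {S S' S'' : LDiagram i} {m m' v : Term δ K i} :
      Eval S m S' (.lift m') → Eval S' m' S'' v → Eval S (.force m) S'' v
  | fix {S S' : LDiagram i} {A : Ty δ W} {m v : Term δ K i} :
      Eval S (m.inst (.lift (.fix A m))) S' v → Eval S (.fix A m) S' v
  | label {S : LDiagram i} {h : δ} {l : ℕ} : Eval S (.label h l) S (.label h l)
  | box {S S' D : LDiagram i} {h : δ} {T : MTy W} {m n : Term δ K i} {Q : LCtx W} {a b : LTuple} :
      Eval S m S' (.lift n) → FreshLabels S' n T Q a →
      Eval (LDiagram.id i Q) (.app n (a.toTerm h)) D (b.toTerm h) →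
      Eval S (.box h T m) S' (.boxed h a D.hom b)
  | apply {S S' S'' S''' : LDiagram i} {h : δ} {m n : Term δ K i} {a b c c' : LTuple}
      {Q Q' : LCtx W} {g : Q.obj i ⟶ Q'.obj i} :
      Eval S m S' (.boxed h a g b) → Eval S' n S'' (c.toTerm h) →
      Append S'' c a ⟨Q, Q', g⟩ b S''' c' → Eval S (.apply h m n) S''' (c'.toTerm h)
  | boxed {S : LDiagram i} {h : δ} {a b : LTuple} {Q Q' : LCtx W} {g : Q.obj i ⟶ Q'.obj i} :
      Eval S (.boxed h a g b) S (.boxed h a g b)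

/-! The shapes of values that raise a run-time error when they are met by an elimination form.
Constants are uninterpreted by the operational semantics: an elimination form whose principal
argument evaluates to a constant neither evaluates nor raises an error. -/

def Term.IsConst : Term δ K i → Prop
  | .const _ => True
  | _ => False

def Term.NotSum : Term δ K i → Prop
  | .inl _ _ _ => False
  | .inr _ _ _ => False
  | .const _ => False
  | _ => True

def Term.NotStar : Term δ K i → Prop
  | .star => False
  | .const _ => False
  | _ => True

def Term.NotPair : Term δ K i → Prop
  | .pair _ _ => False
  | .const _ => False
  | _ => True

def Term.NotLam : Term δ K i → Prop
  | .lam _ _ => False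
  | .const _ => False
  | _ => True

def Term.NotLift : Term δ K i → Prop
  | .lift _ => False
  | .const _ => False
  | _ => True

def Term.NotBoxed : Term δ K i → Prop
  | .boxed _ _ _ _ => False
  | .const _ => False
  | _ => True

def Term.NotTuple : Term δ K i → Prop
  | .label _ _ => False
  | .star => False
  | .pair m n => m.NotTuple ∨ n.NotTuple
  | .const _ => False
  | _ => True

/-- The error relation `(S, m) ⇓ Error` of ECLNL with recursion. -/
inductive Err [SymmetricCategory M] : LDiagram i → Term δ K i → Prop
  | var {S : LDiagram i} {n : ℕ} : Err S (.var n)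
  | letIn₁ {S : LDiagram i} {m n : Term δ K i} : Err S m → Err S (.letIn m n)
  | letIn₂ {S S' : LDiagram i} {m n v : Term δ K i} :
      Eval S m S' v → Err S' (n.inst v) → Err S (.letIn m n)
  | abort₁ {S : LDiagram i} {A : Ty δ W} {m : Term δ K i} : Err S m → Err S (.abort A m)
  | abort₂ {S S' : LDiagram i} {A : Ty δ W} {m v : Term δ K i} :
      Eval S m S' v → ¬ v.IsConst → Err S (.abort A m)
  | inl {S : LDiagram i} {A B : Ty δ W} {m : Term δ K i} : Err S m → Err S (.inl A B m)
  | inr {S : LDiagram i} {A B : Ty δ W} {m : Term δ K i} : Err S m → Err S (.inr A B m)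
  | case₁ {S : LDiagram i} {m n p : Term δ K i} : Err S m → Err S (.case m n p)
  | caseInl {S S' : LDiagram i} {A B : Ty δ W} {m n p v : Term δ K i} :
      Eval S m S' (.inl A B v) → Err S' (n.inst v) → Err S (.case m n p)
  | caseInr {S S' : LDiagram i} {A B : Ty δ W} {m n p v : Term δ K i} :
      Eval S m S' (.inr A B v) → Err S' (p.inst v) → Err S (.case m n p)
  | case₂ {S S' : LDiagram i} {m n p v : Term δ K i} :
      Eval S m S' v → v.NotSum → Err S (.case m n p)
  | seq₁ {S : LDiagram i} {m n : Term δ K i} : Err S m → Err S (.seq m n)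
  | seq₂ {S S' : LDiagram i} {m n : Term δ K i} :
      Eval S m S' .star → Err S' n → Err S (.seq m n)
  | seq₃ {S S' : LDiagram i} {m n v : Term δ K i} :
      Eval S m S' v → v.NotStar → Err S (.seq m n)
  | pair₁ {S : LDiagram i} {m n : Term δ K i} : Err S m → Err S (.pair m n)
  | pair₂ {S S' : LDiagram i} {m n v : Term δ K i} :
      Eval S m S' v → Err S' n → Err S (.pair m n)
  | letPair₁ {S : LDiagram i} {m n : Term δ K i} : Err S m → Err S (.letPair m n)
  | letPair₂ {S S' : LDiagram i} {m n v v' : Term δ K i} :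
      Eval S m S' (.pair v v') → Err S' (n.inst₂ v v') → Err S (.letPair m n)
  | letPair₃ {S S' : LDiagram i} {m n v : Term δ K i} :
      Eval S m S' v → v.NotPair → Err S (.letPair m n)
  | app₁ {S : LDiagram i} {m n : Term δ K i} : Err S m → Err S (.app m n)
  | app₂ {S S' : LDiagram i} {m n v : Term δ K i} :
      Eval S m S' v → v.NotLam → Err S (.app m n)
  | app₃ {S S' : LDiagram i} {A : Ty δ W} {m m' n : Term δ K i} :
      Eval S m S' (.lam A m') → Err S' n → Err S (.app m n)
  | app₄ {S S' S'' : LDiagram i} {A : Ty δ W} {m m' n v : Term δ K i} :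
      Eval S m S' (.lam A m') → Eval S' n S'' v → Err S'' (m'.inst v) → Err S (.app m n)
  | force₁ {S : LDiagram i} {m : Term δ K i} : Err S m → Err S (.force m)
  | force₂ {S S' : LDiagram i} {m v : Term δ K i} :
      Eval S m S' v → v.NotLift → Err S (.force m)
  | force₃ {S S' : LDiagram i} {m m' : Term δ K i} :
      Eval S m S' (.lift m') → Err S' m' → Err S (.force m)
  | fix {S : LDiagram i} {A : Ty δ W} {m : Term δ K i} :
      Err S (m.inst (.lift (.fix A m))) → Err S (.fix A m)
  | box₁ {S : LDiagram i} {h : δ} {T : MTy W} {m : Term δ K i} : Err S m → Err S (.box h T m)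
  | box₂ {S S' : LDiagram i} {h : δ} {T : MTy W} {m v : Term δ K i} :
      Eval S m S' v → v.NotLift → Err S (.box h T m)
  | box₃ {S S' : LDiagram i} {h : δ} {T : MTy W} {m n : Term δ K i} {Q : LCtx W} {a : LTuple} :
      Eval S m S' (.lift n) → FreshLabels S' n T Q a →
      Err (LDiagram.id i Q) (.app n (a.toTerm h)) → Err S (.box h T m)
  | box₄ {S S' D : LDiagram i} {h : δ} {T : MTy W} {m n v : Term δ K i} {Q : LCtx W}
      {a : LTuple} :
      Eval S m S' (.lift n) → FreshLabels S' n T Q a →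
      Eval (LDiagram.id i Q) (.app n (a.toTerm h)) D v → v.NotTuple → Err S (.box h T m)
  | apply₁ {S : LDiagram i} {h : δ} {m n : Term δ K i} : Err S m → Err S (.apply h m n)
  | apply₂ {S S' : LDiagram i} {h : δ} {m n v : Term δ K i} :
      Eval S m S' v → v.NotBoxed → Err S (.apply h m n)
  | apply₃ {S S' : LDiagram i} {h : δ} {m n : Term δ K i} {a b : LTuple}
      {Q Q' : LCtx W} {g : Q.obj i ⟶ Q'.obj i} :
      Eval S m S' (.boxed h a g b) → Err S' n → Err S (.apply h m n)
  | apply₄ {S S' S'' : LDiagram i} {h : δ} {m n v : Term δ K i} {a b : LTuple}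
      {Q Q' : LCtx W} {g : Q.obj i ⟶ Q'.obj i} :
      Eval S m S' (.boxed h a g b) → Eval S' n S'' v → v.NotTuple → Err S (.apply h m n)
  | apply₅ {S S' S'' : LDiagram i} {h : δ} {m n : Term δ K i} {a b c : LTuple}
      {Q Q' : LCtx W} {g : Q.obj i ⟶ Q'.obj i} :
      Eval S m S' (.boxed h a g b) → Eval S' n S'' (c.toTerm h) →
      (¬ ∃ S''' c', Append S'' c a ⟨Q, Q', g⟩ b S''' c') → Err S (.apply h m n)

end Terms

/-! ## Denotational semantics -/

section Semantics

variable (V : Type u₁) [Category.{v₁} V] [CartesianMonoidalCategory V] [BraidedCategory V]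
  [MonoidalClosed V] [HasFiniteCoproducts V]
  (C : Type u₂) [Category.{v₂} C] [MonoidalCategory C] [SymmetricCategory C]
  [MonoidalClosed C] [HasFiniteCoproducts C]
  (M : Type u₃) [Category.{v₃} M] [MonoidalCategory M] [SymmetricCategory M]

/-- The part of an (E)CLNL model with recursion that the interpretation refers to: a CLNL model
with parametrically algebraically compact `!`, and, for the interpretation of diagrams, the objects
`hom A B` of `V`, isomorphic to `G (A ⊸ B)`, and the functor `E`. See `ECLNLModel.toInterp` and
`CLNLModel.toInterp`. -/
structure Interp extends CLNLModel V C where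
  compact : ParametricallyAlgebraicallyCompact toCLNLModel.bang
  hom : C → C → V
  homIso (A B : C) : G.obj ((ihom A).obj B) ≅ hom A B
  E : M ⥤ C
  [braidedE : E.Braided]

attribute [instance] Interp.braidedE

variable {V C M}

section EnrichedInterp

variable [EnrichedOrdinaryCategory V C]

/-- The isomorphism `G (A ⊸ B) ≅ C(I, A ⊸ B) ≅ C(A ⊗ I, B) ≅ C(A, B)`. -/
noncomputable def EnrichedCLNLModel.homIso (X : EnrichedCLNLModel V C) (A B : C) :
    X.G.obj ((ihom A).obj B) ≅ (A ⟶[V] B) :=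
  X.isoHomUnit.app ((ihom A).obj B) ≪≫
    @asIso _ _ _ _ (X.tensor.uncurryHom A (𝟙_ C) B) (X.closed A (𝟙_ C) B) ≪≫
    { hom := eHomWhiskerRight V (ρ_ A).inv B
      inv := eHomWhiskerRight V (ρ_ A).hom B
      hom_inv_id := by rw [← eHomWhiskerRight_comp]; simp
      inv_hom_id := by rw [← eHomWhiskerRight_comp]; simp }

noncomputable def ECLNLModel.toInterp (X : ECLNLModel V C M)
    (hX : ParametricallyAlgebraicallyCompact X.bang) : Interp V C M where
  toCLNLModel := X.toCLNLModel
  compact := hX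
  hom A B := A ⟶[V] B
  homIso := X.homIso
  E := X.E

end EnrichedInterp

/-- The constant functor with value `I` on the one-object category, a strong symmetric monoidal
functor. -/
def unitFunctor (C : Type u₂) [Category.{v₂} C] [MonoidalCategory C] :
    Discrete PUnit.{1} ⥤ C :=
  (Functor.const _).obj (𝟙_ C)

instance : SymmetricCategory (Discrete PUnit.{1}) where
  symmetry _ _ := Subsingleton.elim _ _

instance : (unitFunctor C).Monoidal :=
  Functor.CoreMonoidal.toMonoidal
    { εIso := Iso.refl _
      μIso := fun _ _ => λ_ (𝟙_ C)
      μIso_hom_natural_left := by intros; simp [unitFunctor]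
      μIso_hom_natural_right := by intros; simp [unitFunctor]
      associativity := by intros; simp [unitFunctor, unitors_equal]
      left_unitality := by intros; simp [unitFunctor]
      right_unitality := by intros; simp [unitFunctor, unitors_equal] }

instance : (unitFunctor C).Braided where
  braided x y := by
    obtain rfl : x = y := Subsingleton.elim _ _
    simp [unitFunctor, ← unitors_equal]

/-- A CLNL model interprets the diagram-free fragment; as this has no wire types and no types
`Diag(T, U)`, the choice of `hom` and `E` is immaterial. -/
def CLNLModel.toInterp (X : CLNLModel V C) (hX : ParametricallyAlgebraicallyCompact X.bang) :
    Interp V C (Discrete PUnit.{1}) where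
  toCLNLModel := X
  compact := hX
  hom A B := X.G.obj ((ihom A).obj B)
  homIso _ _ := Iso.refl _
  E := unitFunctor C

namespace Interp

open Functor.Monoidal

variable {δ : Prop} {K : Type k} {W : Type w} (X : Interp V C M) (i : W → M)

/-- The interpretation of the wire types in `C`. -/
def wire (α : W) : C := X.E.obj (i α)

/-- The interpretation of types. -/
noncomputable def ty : Ty δ W → C
  | .zero => ⊥_ C
  | .sum A B => ty A ⨿ ty B
  | .one => 𝟙_ C
  | .tensor A B => ty A ⊗ ty B
  | .lolli A B => (ihom (ty A)).obj (ty B)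
  | .bang A => X.bang.obj (ty A)
  | .wire _ α => X.wire i α
  | .diag _ T U => X.F.obj (X.hom (T.obj (X.wire i)) (U.obj (X.wire i)))

noncomputable def slot : Option (Ty δ W) → C
  | none => 𝟙_ C
  | some A => X.ty i A

/-- The interpretation of variable contexts. -/
noncomputable def ctx : Ctx δ W → C
  | [] => 𝟙_ C
  | o :: Γ => X.slot i o ⊗ ctx Γ

/-- `M`-types have the same interpretation as `M`-types and as types. -/
noncomputable def mtyIso (h : δ) : (T : MTy W) → (X.ty i (T.toTy h) ≅ T.obj (X.wire i))
  | .wire _ => Iso.refl _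
  | .one => Iso.refl _
  | .tensor T U => mtyIso h T ⊗ᵢ mtyIso h U

/-- The object `Y` of `V` with `⟦P⟧ ≅ F Y`, for an intuitionistic type `P`. -/
noncomputable def param : (P : Ty δ W) → P.Intuit → V
  | .zero, _ => ⊥_ V
  | .sum P R, h => param P h.1 ⨿ param R h.2
  | .one, _ => 𝟙_ V
  | .tensor P R, h => param P h.1 ⊗ param R h.2
  | .lolli _ _, h => h.elim
  | .bang A, _ => X.G.obj (X.ty i A)
  | .wire _ _, h => h.elim
  | .diag _ T U, _ => X.hom (T.obj (X.wire i)) (U.obj (X.wire i))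

/-- The canonical isomorphism `⟦P⟧ ≅ F Y`, for an intuitionistic type `P`. -/
noncomputable def paramIso : (P : Ty δ W) → (h : P.Intuit) → (X.ty i P ≅ X.F.obj (X.param i P h))
  | .zero, _ =>
    haveI := X.adj.leftAdjoint_preservesColimits
    (PreservesInitial.iso X.F).symm
  | .sum P R, h =>
    haveI := X.adj.leftAdjoint_preservesColimits
    coprod.mapIso (paramIso P h.1) (paramIso R h.2) ≪≫ PreservesColimitPair.iso X.F _ _
  | .one, _ => εIso X.F
  | .tensor P R, h => (paramIso P h.1 ⊗ᵢ paramIso R h.2) ≪≫ μIso X.F _ _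
  | .lolli _ _, h => h.elim
  | .bang _, _ => Iso.refl _
  | .wire _ _, h => h.elim
  | .diag _ _ _, _ => Iso.refl _

noncomputable def slotParam : (o : Option (Ty δ W)) → SlotIntuit o → V
  | none, _ => 𝟙_ V
  | some P, h => X.param i P h

noncomputable def slotIso : (o : Option (Ty δ W)) → (h : SlotIntuit o) →
    (X.slot i o ≅ X.F.obj (X.slotParam i o h))
  | none, _ => εIso X.F
  | some P, h => X.paramIso i P h

noncomputable def ctxParam : (Φ : Ctx δ W) → Ctx.Intuit Φ → V
  | [], _ => 𝟙_ V
  | o :: Φ, h => X.slotParam i o h.1 ⊗ ctxParam Φ h.2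

/-- The canonical isomorphism `⟦Φ⟧ ≅ F Y`, for an intuitionistic context `Φ`. -/
noncomputable def ctxIso : (Φ : Ctx δ W) → (h : Ctx.Intuit Φ) →
    (X.ctx i Φ ≅ X.F.obj (X.ctxParam i Φ h))
  | [], _ => εIso X.F
  | o :: Φ, h => (X.slotIso i o h.1 ⊗ᵢ ctxIso Φ h.2) ≪≫ μIso X.F _ _

section Maps

variable {P : C} {Y : V}

/-- Discard, for an object `P ≅ F Y`. -/
def discard (e : P ≅ X.F.obj Y) : P ⟶ 𝟙_ C :=
  e.hom ≫ X.F.map (CartesianMonoidalCategory.toUnit Y) ≫ (εIso X.F).inv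

/-- Copy, for an object `P ≅ F Y`. -/
def copy (e : P ≅ X.F.obj Y) : P ⟶ P ⊗ P :=
  e.hom ≫ X.F.map (CartesianMonoidalCategory.lift (𝟙 Y) (𝟙 Y)) ≫ (μIso X.F Y Y).inv ≫
    (e.inv ⊗ₘ e.inv)

/-- Lift, for an object `P ≅ F Y`. -/
def lift (e : P ≅ X.F.obj Y) : P ⟶ X.bang.obj P :=
  e.hom ≫ X.F.map (X.adj.unit.app Y) ≫ X.bang.map e.inv

/-- The chosen initial algebra and final coalgebra of `P ⊗ !(-)`. -/
noncomputable def bifree (P : C) : BifreeAlgebra (X.bang ⋙ tensorLeft P) :=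
  Classical.choice (X.compact P)

/-- The anamorphism `γ` of the coalgebra `P → P ⊗ P → P ⊗ !P`, for an object `P ≅ F Y`. -/
noncomputable def gamma (e : P ≅ X.F.obj Y) : P ⟶ (X.bifree P).carrier :=
  ((X.bifree P).final.from
    (⟨P, X.copy e ≫ P ◁ X.lift e⟩ : Endofunctor.Coalgebra (X.bang ⋙ tensorLeft P))).f

/-- The catamorphism `σ_m` of the algebra `m : P ⊗ !A → A`. -/
noncomputable def sigma {A : C} (m : P ⊗ X.bang.obj A ⟶ A) : (X.bifree P).carrier ⟶ A :=
  ((X.bifree P).initial.to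
    (⟨A, m⟩ : Endofunctor.Algebra (X.bang ⋙ tensorLeft P))).f

/-- The internal hom on morphisms. -/
def ihomMap {A A' B B' : C} (f : A' ⟶ A) (g : B ⟶ B') :
    (ihom A).obj B ⟶ (ihom A').obj B' :=
  MonoidalClosed.curry (f ▷ _ ≫ (ihom.ev A).app B ≫ g)

/-- The bijection `Ψ`:
`C(A, B) ≅ C(I, A ⊸ B) ≅ C(F 1, A ⊸ B) ≅ V(1, G (A ⊸ B)) ≅ V(1, hom A B)`. -/
def psi {A B : C} (f : A ⟶ B) : 𝟙_ V ⟶ X.hom A B :=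
  X.adj.homEquiv _ _ ((εIso X.F).inv ≫ MonoidalClosed.curry ((ρ_ A).hom ≫ f)) ≫
    (X.homIso A B).hom

/-- The map `(Y ⨿ Z) ⊗ A → B` given by its restrictions to `Y ⊗ A` and `Z ⊗ A`. -/
noncomputable def caseMap {A B Y Z : C} (f : Y ⊗ A ⟶ B) (g : Z ⊗ A ⟶ B) : (Y ⨿ Z) ⊗ A ⟶ B :=
  (β_ _ _).hom ≫ MonoidalClosed.uncurry (coprod.desc
    (MonoidalClosed.curry ((β_ A Y).hom ≫ f)) (MonoidalClosed.curry ((β_ A Z).hom ≫ g)))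

end Maps

/-- `⟦Γ⟧ → ⟦A⟧` for `Γ = Φ, x : A`: the variables in `Φ` are discarded. -/
noncomputable def lookup : {Γ : Ctx δ W} → {n : ℕ} → {A : Ty δ W} → Lookup Γ n A →
    (X.ctx i Γ ⟶ X.ty i A)
  | _, _, _, .zero (Γ := Γ) h => (_ ◁ X.discard (X.ctxIso i Γ h)) ≫ (ρ_ _).hom
  | _, _, _, .succ (o := o) h l => (X.discard (X.slotIso i o h) ▷ _) ≫ (λ_ _).hom ≫ lookup l

/-- `⟦Φ⟧ ⊗ ⟦Δ₁⟧ ⊗ ⟦Δ₂⟧ → (⟦Φ⟧ ⊗ ⟦Δ₁⟧) ⊗ (⟦Φ⟧ ⊗ ⟦Δ₂⟧)`: the variables in `Φ` are copied. -/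
noncomputable def csplit : {Γ Γ₁ Γ₂ : Ctx δ W} → CSplit Γ Γ₁ Γ₂ →
    (X.ctx i Γ ⟶ X.ctx i Γ₁ ⊗ X.ctx i Γ₂)
  | _, _, _, .nil => (λ_ (𝟙_ C)).inv
  | _, _, _, .none s => ((λ_ (𝟙_ C)).inv ⊗ₘ csplit s) ≫ tensorμ _ _ _ _
  | _, _, _, .both (P := P) h s =>
      (X.copy (X.paramIso i P h) ⊗ₘ csplit s) ≫ tensorμ (X.ty i P) (X.ty i P) _ _
  | _, _, _, .left (A := A) s => ((ρ_ (X.ty i A)).inv ⊗ₘ csplit s) ≫ tensorμ _ _ _ _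
  | _, _, _, .right (A := A) s => ((λ_ (X.ty i A)).inv ⊗ₘ csplit s) ≫ tensorμ _ _ _ _

/-- The interpretation of label contexts. -/
def lctx (Q : LCtx W) : C := Q.obj (X.wire i)

/-- Splitting of variable and label contexts. -/
noncomputable def split {Γ Γ₁ Γ₂ : Ctx δ W} {Q Q₁ Q₂ : LCtx W} (cs : CSplit Γ Γ₁ Γ₂)
    (ls : LSplit Q Q₁ Q₂) :
    X.ctx i Γ ⊗ X.lctx i Q ⟶ (X.ctx i Γ₁ ⊗ X.lctx i Q₁) ⊗ (X.ctx i Γ₂ ⊗ X.lctx i Q₂) :=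
  (X.csplit i cs ⊗ₘ (ls.iso (X.wire i)).hom) ≫ tensorμ _ _ _ _

/-- `⟦α₁⟧ ⊗ ⋯ ⊗ ⟦αₙ⟧ ≅ E (⟦α₁⟧ ⊠ ⋯ ⊠ ⟦αₙ⟧)`. -/
def entriesIso : (l : List (ℕ × W)) → (entriesObj (X.wire i) l ≅ X.E.obj (entriesObj i l))
  | [] => εIso X.E
  | a :: l => whiskerLeftIso _ (entriesIso l) ≪≫ μIso X.E (i a.2) (entriesObj i l)

/-- The interpretation of labelled string diagrams. -/
def diagram {Q Q' : LCtx W} (S : Q.obj i ⟶ Q'.obj i) : X.lctx i Q ⟶ X.lctx i Q' :=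
  (X.entriesIso i Q.entries).hom ≫ X.E.map S ≫ (X.entriesIso i Q'.entries).inv

/-- The interpretation of constants: morphisms `I → ⟦A_c⟧`, which are intuitionistic whenever the
type `A_c` is. -/
structure Constants (cty : K → Ty δ W) where
  val (c : K) : 𝟙_ C ⟶ X.ty i (cty c)
  intuit (c : K) (h : (cty c).Intuit) : ∃ f : 𝟙_ V ⟶ X.param i (cty c) h,
    val c = (εIso X.F).hom ≫ X.F.map f ≫ (X.paramIso i (cty c) h).inv

variable {cty : K → Ty δ W} (cst : X.Constants i cty)

/-- The interpretation of a derivation of `Γ; Q ⊢ m : A`. -/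
noncomputable def deriv : {Γ : Ctx δ W} → {Q : LCtx W} → {m : Term δ K i} → {A : Ty δ W} →
    Deriv cty Γ Q m A → (X.ctx i Γ ⊗ X.lctx i Q ⟶ X.ty i A)
  | _, _, _, _, .var l => (ρ_ _).hom ≫ X.lookup i l
  | _, _, _, _, .const hΓ c => (ρ_ _).hom ≫ X.discard (X.ctxIso i _ hΓ) ≫ cst.val c
  | _, _, _, _, .letIn cs ls dm dn =>
      X.split i cs ls ≫ (deriv dm ▷ _) ≫ (α_ _ _ _).inv ≫ deriv dn
  | _, _, _, _, .abort dm => deriv dm ≫ initial.to _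
  | _, _, _, _, .inl dm => deriv dm ≫ coprod.inl
  | _, _, _, _, .inr dm => deriv dm ≫ coprod.inr
  | _, _, _, _, .case cs ls dm dn dp =>
      X.split i cs ls ≫ (deriv dm ▷ _) ≫
        caseMap ((α_ _ _ _).inv ≫ deriv dn) ((α_ _ _ _).inv ≫ deriv dp)
  | _, _, _, _, .star hΓ => (ρ_ _).hom ≫ X.discard (X.ctxIso i _ hΓ)
  | _, _, _, _, .seq cs ls dm dn =>
      X.split i cs ls ≫ (deriv dm ▷ _) ≫ (λ_ _).hom ≫ deriv dn
  | _, _, _, _, .pair cs ls dm dn => X.split i cs ls ≫ (deriv dm ⊗ₘ deriv dn)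
  | _, _, _, _, .letPair (A := A) (B := B) cs ls dm dn =>
      X.split i cs ls ≫ (deriv dm ▷ _) ≫ ((β_ (X.ty i A) (X.ty i B)).hom ▷ _) ≫
        (α_ _ _ _).inv ≫ ((α_ _ _ _).hom ▷ _) ≫ deriv dn
  | _, _, _, _, .lam dm => MonoidalClosed.curry ((α_ _ _ _).inv ≫ deriv dm)
  | _, _, _, _, .app (A := A) (B := B) cs ls dm dn =>
      X.split i cs ls ≫ (deriv dm ⊗ₘ deriv dn) ≫ (β_ _ _).hom ≫
        (ihom.ev (X.ty i A)).app (X.ty i B)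
  | _, _, _, _, .lift hΓ dm =>
      (ρ_ _).hom ≫ X.lift (X.ctxIso i _ hΓ) ≫ X.bang.map ((ρ_ _).inv ≫ deriv dm)
  | _, _, _, _, .force dm => deriv dm ≫ X.adj.counit.app _
  | _, _, _, _, .fix hΓ dm =>
      (ρ_ _).hom ≫ X.gamma (X.ctxIso i _ hΓ) ≫
        X.sigma ((β_ _ _).hom ≫ (ρ_ _).inv ≫ deriv dm)
  | _, _, _, _, .label _ hΓ _ _ =>
      (X.discard (X.ctxIso i _ hΓ) ⊗ₘ (ρ_ _).hom) ≫ (λ_ _).hom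
  | _, _, _, _, .box h (T := T) (U := U) dm =>
      deriv dm ≫ X.bang.map (ihomMap (X.mtyIso i h T).inv (X.mtyIso i h U).hom) ≫
        X.F.map (X.homIso _ _).hom
  | _, _, _, _, .apply h (T := T) (U := U) cs ls dm dn =>
      X.split i cs ls ≫ (deriv dm ⊗ₘ (deriv dn ≫ (X.mtyIso i h T).hom)) ≫
        ((X.F.map (X.homIso _ _).inv ≫ X.adj.counit.app _) ▷ _) ≫ (β_ _ _).hom ≫
        (ihom.ev _).app _ ≫ (X.mtyIso i h U).inv
  | _, _, _, _, .boxed _ hΓ da S db =>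
      (ρ_ _).hom ≫ X.discard (X.ctxIso i _ hΓ) ≫ (εIso X.F).hom ≫
        X.F.map (X.psi ((da.iso (X.wire i)).inv ≫ X.diagram i S ≫ (db.iso (X.wire i)).hom))

/-- The interpretation `⟦Q⟧ → ⟦A⟧ ⊗ ⟦Q'⟧` of a configuration. -/
noncomputable def config : {Q : LCtx W} → {S : LDiagram i} → {m : Term δ K i} → {A : Ty δ W} →
    {Q' : LCtx W} → ConfigDeriv cty Q S m A Q' → (X.lctx i Q ⟶ X.ty i A ⊗ X.lctx i Q')
  | _, _, _, _, _, .mk (f := f) s d =>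
      X.diagram i f ≫ (s.iso (X.wire i)).hom ≫ (((λ_ _).inv ≫ X.deriv i cst d) ▷ _)

end Interp

end Semantics

/-! ## The CLNL calculus -/

namespace CLNL

/-- The types of CLNL. -/
abbrev Ty := LNL.Ty False PEmpty.{1}

abbrev Ctx := LNL.Ctx False PEmpty.{1}

/-- There are no wire types in CLNL. -/
def noWires : PEmpty.{1} → Discrete PUnit.{1} := fun α => α.elim

/-- The terms of CLNL. -/
abbrev Term (K : Type k) := LNL.Term False K noWires

/-- Derivations of the typing judgement `Γ ⊢ m : A`: the label contexts are empty. -/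
abbrev Deriv {K : Type k} (cty : K → Ty) (Γ : Ctx) (m : Term K) (A : Ty) :=
  LNL.Deriv cty Γ (LCtx.empty PEmpty.{1}) m A

variable {K : Type k}

/-- The evaluation relation `m ⇓ v` of CLNL with recursion. -/
inductive Eval : Term K → Term K → Prop
  | const {c : K} : Eval (.const c) (.const c)
  | letIn {m n v u : Term K} : Eval m v → Eval (n.inst v) u → Eval (.letIn m n) u
  | inl {A B : Ty} {m v : Term K} : Eval m v → Eval (.inl A B m) (.inl A B v)
  | inr {A B : Ty} {m v : Term K} : Eval m v → Eval (.inr A B m) (.inr A B v)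
  | caseInl {A B : Ty} {m n p v u : Term K} :
      Eval m (.inl A B v) → Eval (n.inst v) u → Eval (.case m n p) u
  | caseInr {A B : Ty} {m n p v u : Term K} :
      Eval m (.inr A B v) → Eval (p.inst v) u → Eval (.case m n p) u
  | star : Eval .star .star
  | seq {m n v : Term K} : Eval m .star → Eval n v → Eval (.seq m n) v
  | pair {m n v v' : Term K} : Eval m v → Eval n v' → Eval (.pair m n) (.pair v v')
  | letPair {m n v v' u : Term K} :
      Eval m (.pair v v') → Eval (n.inst₂ v v') u → Eval (.letPair m n) u
  | lam {A : Ty} {m : Term K} : Eval (.lam A m) (.lam A m)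
  | app {A : Ty} {m m' n v u : Term K} :
      Eval m (.lam A m') → Eval n v → Eval (m'.inst v) u → Eval (.app m n) u
  | lift {m : Term K} : Eval (.lift m) (.lift m)
  | force {m m' v : Term K} : Eval m (.lift m') → Eval m' v → Eval (.force m) v
  | fix {A : Ty} {m v : Term K} : Eval (m.inst (.lift (.fix A m))) v → Eval (.fix A m) v

/-- The error relation `m ⇓ Error` of CLNL with recursion. -/
inductive Err : Term K → Prop
  | var {n : ℕ} : Err (.var n)
  | letIn₁ {m n : Term K} : Err m → Err (.letIn m n)
  | letIn₂ {m n v : Term K} : Eval m v → Err (n.inst v) → Err (.letIn m n)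
  | abort₁ {A : Ty} {m : Term K} : Err m → Err (.abort A m)
  | abort₂ {A : Ty} {m v : Term K} : Eval m v → ¬ v.IsConst → Err (.abort A m)
  | inl {A B : Ty} {m : Term K} : Err m → Err (.inl A B m)
  | inr {A B : Ty} {m : Term K} : Err m → Err (.inr A B m)
  | case₁ {m n p : Term K} : Err m → Err (.case m n p)
  | caseInl {A B : Ty} {m n p v : Term K} :
      Eval m (.inl A B v) → Err (n.inst v) → Err (.case m n p)
  | caseInr {A B : Ty} {m n p v : Term K} :
      Eval m (.inr A B v) → Err (p.inst v) → Err (.case m n p)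
  | case₂ {m n p v : Term K} : Eval m v → v.NotSum → Err (.case m n p)
  | seq₁ {m n : Term K} : Err m → Err (.seq m n)
  | seq₂ {m n : Term K} : Eval m .star → Err n → Err (.seq m n)
  | seq₃ {m n v : Term K} : Eval m v → v.NotStar → Err (.seq m n)
  | pair₁ {m n : Term K} : Err m → Err (.pair m n)
  | pair₂ {m n v : Term K} : Eval m v → Err n → Err (.pair m n)
  | letPair₁ {m n : Term K} : Err m → Err (.letPair m n)
  | letPair₂ {m n v v' : Term K} :
      Eval m (.pair v v') → Err (n.inst₂ v v') → Err (.letPair m n)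
  | letPair₃ {m n v : Term K} : Eval m v → v.NotPair → Err (.letPair m n)
  | app₁ {m n : Term K} : Err m → Err (.app m n)
  | app₂ {m n v : Term K} : Eval m v → v.NotLam → Err (.app m n)
  | app₃ {A : Ty} {m m' n : Term K} : Eval m (.lam A m') → Err n → Err (.app m n)
  | app₄ {A : Ty} {m m' n v : Term K} :
      Eval m (.lam A m') → Eval n v → Err (m'.inst v) → Err (.app m n)
  | force₁ {m : Term K} : Err m → Err (.force m)
  | force₂ {m v : Term K} : Eval m v → v.NotLift → Err (.force m)
  | force₃ {m m' : Term K} : Eval m (.lift m') → Err m' → Err (.force m)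
  | fix {A : Ty} {m : Term K} : Err (m.inst (.lift (.fix A m))) → Err (.fix A m)

end CLNL

section CLNLSemantics

variable {V : Type u₁} [Category.{v₁} V] [CartesianMonoidalCategory V] [BraidedCategory V]
  [MonoidalClosed V] [HasFiniteCoproducts V]
  {C : Type u₂} [Category.{v₂} C] [MonoidalCategory C] [SymmetricCategory C]
  [MonoidalClosed C] [HasFiniteCoproducts C]
  {K : Type k} {cty : K → CLNL.Ty}

/-- The interpretation `⟦Γ⟧ → ⟦A⟧` of a derivation of `Γ ⊢ m : A` in CLNL. -/
noncomputable def CLNL.den (X : Interp V C (Discrete PUnit.{1}))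
    (cst : X.Constants CLNL.noWires cty) {Γ : CLNL.Ctx} {m : CLNL.Term K} {A : CLNL.Ty}
    (d : CLNL.Deriv cty Γ m A) : X.ctx CLNL.noWires Γ ⟶ X.ty CLNL.noWires A :=
  (ρ_ _).inv ≫ X.deriv CLNL.noWires cst d

end CLNLSemantics

end LNL

/-!
The proof rests on one observation about intuitionistic objects, the objects `P` with a chosen
isomorphism `P ≅ F Y`. A morphism between such objects is called intuitionistic if it comes from a
morphism of `V` (`Interp.IsIntuit`). Intuitionistic morphisms commute with discarding, copying and
lifting, because `V` is cartesian and the unit of the adjunction is natural. They also commute with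
the interpretation `γ ≫ σ` of recursion (`IsIntuit.comp_gamma_sigma`): since the structure map of a
bifree algebra is invertible, the comparison of initial algebras induced by an intuitionistic
morphism is also a comparison of final coalgebras. For the same reason `γ ≫ σ` satisfies the fixed
point equation expected of a recursive term (`gamma_sigma_fixed`).

The contexts of variables and labels are interpreted as a single tensor product (`Interp.full`),
and `Interp.den` is the interpretation of derivations relative to it. A variable binder then is a
tensor product with one more object on the left, and splitting contexts can be analysed entry by
entry.

*Coherence* (`deriv_unique`). The derivations of a term differ only in where intuitionistic
variables are sent when a context is split, and where they are discarded. Labels and linear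
variables go where they are used (`Deriv.mem_labels_iff`, `Deriv.linear_used`), and this depends
only on the term. Hence both derivations can be compared with the splitting in which all
intuitionistic variables are duplicated (`exists_part`, `exists_common`), and the induction goes
through for derivations in two contexts obtained from a common one by dropping intuitionistic
variables (`weaken_den_unique`).

*Substitution* (`Extend.exists_deriv`). A substitution is interpreted by a family of morphisms
between contexts that is compatible with splitting, discarding, lifting and variables
(`IsSubstRel`). Two families are used: projections from intuitionistic contexts, which give
weakening (`exists_weaken`), and closed terms (`exists_inst`, `exists_inst₂`). A closed term may be
substituted for an intuitionistic variable if it has no labels and is interpreted as an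
intuitionistic morphism. All closed values of intuitionistic types have this property
(`isVal_substitutable`), and call-by-value evaluation substitutes only values.

*Soundness* (`Interp.sound`) is by induction on evaluation, and yields a typing of the result
together with the equality of interpretations. When a part of a term is evaluated, the labels of
the other parts are set aside as outputs of the diagram (`Sound.left`, `Sound.right`,
`Sound.tensor`). The rules for diagrams use that the interpretation of diagrams through `E` is
functorial and compatible with splitting labels (`diagram_comp`, `diagram_split`). For given
derivations of the two configurations, coherence gives the statement (`config_unique`).

*Subject reduction and error freeness* do not mention a model. They follow by applying soundness to
the interpretation in the category with one morphism (`Point.interp`), which exists for every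
category of diagrams. An error would be caused by a well-typed value of the wrong shape, or by an
append that is undefined although the types match; `not_err` excludes both.

*The diagram-free calculus* has the derivations of the full calculus over the empty set of wires,
and its evaluation is the evaluation of configurations with the empty diagram (`CLNL.Eval.toLNL`,
`CLNL.toConfig`).
-/

set_option linter.unusedSectionVars false

namespace LNL

/-! ### Intuitionistic morphisms -/

namespace Interp

open Functor.Monoidal

variable {V : Type u₁} [Category.{v₁} V] [CartesianMonoidalCategory V] [BraidedCategory V]
  [MonoidalClosed V] [HasFiniteCoproducts V]
  {C : Type u₂} [Category.{v₂} C] [MonoidalCategory C] [SymmetricCategory C]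
  [MonoidalClosed C] [HasFiniteCoproducts C]
  {M : Type u₃} [Category.{v₃} M] [MonoidalCategory M] [SymmetricCategory M]
  (X : Interp V C M)

section Intuit

variable {P P' P'' R R' : C} {Y Y' Y'' Z Z' : V}

/-- The morphism between objects `P ≅ F Y` and `P' ≅ F Y'` induced by a morphism of `V`. -/
def ofV (e : P ≅ X.F.obj Y) (e' : P' ≅ X.F.obj Y') (f : Y ⟶ Y') : P ⟶ P' :=
  e.hom ≫ X.F.map f ≫ e'.inv

/-- A morphism between objects `P ≅ F Y` and `P' ≅ F Y'` is intuitionistic if it comes from a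
morphism of `V`. Such morphisms commute with discarding, copying and lifting. -/
def IsIntuit (e : P ≅ X.F.obj Y) (e' : P' ≅ X.F.obj Y') (φ : P ⟶ P') : Prop :=
  ∃ f : Y ⟶ Y', φ = X.ofV e e' f

/-- The isomorphism `P ⊗ R ≅ F (Y ⊗ Z)` for `P ≅ F Y` and `R ≅ F Z`. -/
def prodIso (e : P ≅ X.F.obj Y) (e' : R ≅ X.F.obj Z) : P ⊗ R ≅ X.F.obj (Y ⊗ Z) :=
  (e ⊗ᵢ e') ≪≫ μIso X.F _ _

variable {X} (e : P ≅ X.F.obj Y) (e' : P' ≅ X.F.obj Y') (e'' : P'' ≅ X.F.obj Y'')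
  (r : R ≅ X.F.obj Z) (r' : R' ≅ X.F.obj Z')

theorem ofV_id : X.ofV e e (𝟙 Y) = 𝟙 P := by simp [ofV]

theorem ofV_comp (f : Y ⟶ Y') (g : Y' ⟶ Y'') :
    X.ofV e e' f ≫ X.ofV e' e'' g = X.ofV e e'' (f ≫ g) := by simp [ofV]

theorem ofV_tensor (f : Y ⟶ Y') (g : Z ⟶ Z') :
    X.ofV e e' f ⊗ₘ X.ofV r r' g = X.ofV (X.prodIso e r) (X.prodIso e' r') (f ⊗ₘ g) := by
  simp only [ofV, prodIso, Iso.trans_hom, Iso.trans_inv, μIso_hom, μIso_inv, Category.assoc,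
    MonoidalCategory.tensorIso_hom, MonoidalCategory.tensorIso_inv, map_tensor]
  simp

theorem ofV_leftUnitor : X.ofV (X.prodIso (εIso X.F) e) e (λ_ Y).hom = (λ_ P).hom := by
  simp only [ofV, prodIso, Iso.trans_hom, μIso_hom, Category.assoc,
    MonoidalCategory.tensorIso_hom, εIso_hom, map_leftUnitor]
  simp [MonoidalCategory.tensorHom_def']

theorem ofV_rightUnitor : X.ofV (X.prodIso e (εIso X.F)) e (ρ_ Y).hom = (ρ_ P).hom := by
  simp only [ofV, prodIso, Iso.trans_hom, μIso_hom, Category.assoc,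
    MonoidalCategory.tensorIso_hom, εIso_hom, map_rightUnitor]
  simp [MonoidalCategory.tensorHom_def]

theorem discard_eq_ofV :
    X.discard e = X.ofV e (εIso X.F) (CartesianMonoidalCategory.toUnit Y) := rfl

theorem copy_eq_ofV : X.copy e = X.ofV e (X.prodIso e e)
    (CartesianMonoidalCategory.lift (𝟙 Y) (𝟙 Y)) := by
  simp [Interp.copy, ofV, prodIso]

theorem ofV_discard (f : Y ⟶ Y') : X.ofV e e' f ≫ X.discard e' = X.discard e := by
  rw [discard_eq_ofV, ofV_comp, discard_eq_ofV]
  congr 1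
  exact CartesianMonoidalCategory.toUnit_unique _ _

theorem discard_prodIso : X.discard (X.prodIso e r) =
    (X.discard e ⊗ₘ X.discard r) ≫ (λ_ _).hom := by
  have h := ofV_leftUnitor (X := X) (εIso X.F)
  rw [discard_eq_ofV, discard_eq_ofV, discard_eq_ofV, ofV_tensor, ← h, ofV_comp]
  congr 1
  exact CartesianMonoidalCategory.toUnit_unique _ _

theorem discard_εIso : X.discard (εIso X.F) = 𝟙 _ := by
  have h := ofV_id (X := X) (εIso X.F)
  rw [discard_eq_ofV, ← h]
  congr 1
  exact CartesianMonoidalCategory.toUnit_unique _ _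

theorem copy_discard_right : X.copy e ≫ (P ◁ X.discard e) ≫ (ρ_ P).hom = 𝟙 P := by
  rw [← MonoidalCategory.id_tensorHom, discard_eq_ofV, copy_eq_ofV, ← ofV_id e, ofV_tensor,
    ← ofV_rightUnitor e, ofV_comp, ofV_comp]
  congr 1
  simp

theorem copy_discard_left : X.copy e ≫ (X.discard e ▷ P) ≫ (λ_ P).hom = 𝟙 P := by
  rw [← MonoidalCategory.tensorHom_id, discard_eq_ofV, copy_eq_ofV, ← ofV_id e, ofV_tensor,
    ← ofV_leftUnitor e, ofV_comp, ofV_comp]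
  congr 1
  simp

variable {e e' e'' r r'}

theorem IsIntuit.id : X.IsIntuit e e (𝟙 P) := ⟨𝟙 _, (ofV_id e).symm⟩

theorem IsIntuit.comp {φ : P ⟶ P'} {ψ : P' ⟶ P''} (h : X.IsIntuit e e' φ)
    (h' : X.IsIntuit e' e'' ψ) : X.IsIntuit e e'' (φ ≫ ψ) := by
  obtain ⟨f, rfl⟩ := h
  obtain ⟨g, rfl⟩ := h'
  exact ⟨f ≫ g, ofV_comp ..⟩

theorem IsIntuit.tensor {φ : P ⟶ P'} {ψ : R ⟶ R'} (h : X.IsIntuit e e' φ)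
    (h' : X.IsIntuit r r' ψ) : X.IsIntuit (X.prodIso e r) (X.prodIso e' r') (φ ⊗ₘ ψ) := by
  obtain ⟨f, rfl⟩ := h
  obtain ⟨g, rfl⟩ := h'
  exact ⟨_, ofV_tensor ..⟩

theorem IsIntuit.discard : X.IsIntuit e (εIso X.F) (X.discard e) := ⟨_, rfl⟩

theorem IsIntuit.leftUnitor : X.IsIntuit (X.prodIso (εIso X.F) e) e (λ_ P).hom :=
  ⟨_, (ofV_leftUnitor e).symm⟩

theorem IsIntuit.comp_discard {φ : P ⟶ P'} (h : X.IsIntuit e e' φ) :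
    φ ≫ X.discard e' = X.discard e := by
  obtain ⟨f, rfl⟩ := h
  exact ofV_discard ..

theorem IsIntuit.comp_copy {φ : P ⟶ P'} (h : X.IsIntuit e e' φ) :
    φ ≫ X.copy e' = X.copy e ≫ (φ ⊗ₘ φ) := by
  obtain ⟨f, rfl⟩ := h
  rw [copy_eq_ofV, copy_eq_ofV, ofV_tensor, ofV_comp, ofV_comp]
  congr 1
  simp

theorem IsIntuit.comp_lift {φ : P ⟶ P'} (h : X.IsIntuit e e' φ) :
    φ ≫ X.lift e' = X.lift e ≫ X.bang.map φ := by
  obtain ⟨f, rfl⟩ := h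
  simp only [Interp.lift, CLNLModel.bang, ofV, Functor.comp_map, Category.assoc,
    Iso.inv_hom_id_assoc, ← Functor.map_comp]
  rw [← X.adj.unit_naturality_assoc]
  simp

variable (e) in
/-- `γ` is a morphism of coalgebras. -/
theorem gamma_str_inv : X.gamma e ≫ (X.bifree P).str.inv =
    X.copy e ≫ P ◁ (X.lift e ≫ X.bang.map (X.gamma e)) := by
  have h := ((X.bifree P).final.from
    (⟨P, X.copy e ≫ P ◁ X.lift e⟩ : Endofunctor.Coalgebra (X.bang ⋙ tensorLeft P))).h
  simp only [Functor.comp_map, curriedTensor_obj_map, Category.assoc] at h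
  rw [MonoidalCategory.whiskerLeft_comp]
  exact h.symm

/-- `σ` is a morphism of algebras. -/
theorem str_hom_sigma {A : C} (m : P ⊗ X.bang.obj A ⟶ A) :
    (X.bifree P).str.hom ≫ X.sigma m = P ◁ X.bang.map (X.sigma m) ≫ m :=
  ((X.bifree P).initial.to
    (⟨A, m⟩ : Endofunctor.Algebra (X.bang ⋙ tensorLeft P))).h.symm

/-- The universal property of the initial algebra, for `σ`. -/
theorem eq_sigma {A : C} {m : P ⊗ X.bang.obj A ⟶ A} {f : (X.bifree P).carrier ⟶ A}
    (h : (X.bifree P).str.hom ≫ f = P ◁ X.bang.map f ≫ m) : f = X.sigma m :=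
  congrArg Endofunctor.Algebra.Hom.f ((X.bifree P).initial.hom_ext
    (⟨f, h.symm⟩ : Endofunctor.Algebra.Hom
      (⟨_, (X.bifree P).str.hom⟩ : Endofunctor.Algebra (X.bang ⋙ tensorLeft P)) ⟨A, m⟩)
    ((X.bifree P).initial.to ⟨A, m⟩))

/-- The universal property of the final coalgebra, for `γ`. -/
theorem final_hom_ext {A : C} (m : A ⟶ P ⊗ X.bang.obj A) {f g : A ⟶ (X.bifree P).carrier}
    (hf : f ≫ (X.bifree P).str.inv = m ≫ P ◁ X.bang.map f)
    (hg : g ≫ (X.bifree P).str.inv = m ≫ P ◁ X.bang.map g) : f = g :=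
  congrArg Endofunctor.Coalgebra.Hom.f ((X.bifree P).final.hom_ext
    (⟨f, hf.symm⟩ : Endofunctor.Coalgebra.Hom
      (⟨A, m⟩ : Endofunctor.Coalgebra (X.bang ⋙ tensorLeft P)) ⟨_, (X.bifree P).str.inv⟩)
    ⟨g, hg.symm⟩)

/-- Naturality of `γ ≫ σ`, the interpretation of recursion, in the parameter. The morphism of
initial algebras induced by `φ` is also a morphism of final coalgebras, as the structure maps of
a bifree algebra are mutually inverse. -/
theorem IsIntuit.comp_gamma_sigma {φ : P ⟶ P'} (h : X.IsIntuit e e' φ) {A : C}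
    (m : P' ⊗ X.bang.obj A ⟶ A) :
    φ ≫ X.gamma e' ≫ X.sigma m = X.gamma e ≫ X.sigma (φ ▷ _ ≫ m) := by
  -- `t` is the morphism of initial algebras induced by `φ`.
  let t : (X.bifree P).carrier ⟶ (X.bifree P').carrier :=
    X.sigma (φ ▷ _ ≫ (X.bifree P').str.hom)
  have ht : (X.bifree P).str.hom ≫ t = P ◁ X.bang.map t ≫ φ ▷ _ ≫ (X.bifree P').str.hom :=
    str_hom_sigma _
  have h₁ : t ≫ X.sigma m = X.sigma (φ ▷ _ ≫ m) := by
    apply eq_sigma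
    rw [reassoc_of% ht, str_hom_sigma, ← whisker_exchange_assoc]
    simp
  -- Both sides are morphisms of coalgebras into `ω⁻¹` for `P'`: `φ` because it commutes with
  -- copying and lifting, `t` because its square with `ω` can be read backwards.
  have h₂ : φ ≫ X.gamma e' = X.gamma e ≫ t := by
    apply final_hom_ext (X.copy e ≫ P ◁ X.lift e ≫ φ ▷ _)
    · rw [Category.assoc, gamma_str_inv, reassoc_of% h.comp_copy, MonoidalCategory.tensorHom_def]
      simp only [Category.assoc, ← MonoidalCategory.whiskerLeft_comp]
      rw [reassoc_of% h.comp_lift, ← Functor.map_comp]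
      simp only [← whisker_exchange]
      simp
    · have ht' : t ≫ (X.bifree P').str.inv =
          (X.bifree P).str.inv ≫ P ◁ X.bang.map t ≫ φ ▷ _ := by
        rw [Iso.eq_inv_comp, reassoc_of% ht]
        simp
      rw [Category.assoc, ht', ← Category.assoc, gamma_str_inv]
      simp only [Category.assoc, ← whisker_exchange]
      simp
  rw [← Category.assoc, h₂, Category.assoc, h₁]

variable (e) in
/-- The fixed point equation for the interpretation of recursion. -/
theorem gamma_sigma_fixed {A : C} (m : P ⊗ X.bang.obj A ⟶ A) :
    X.gamma e ≫ X.sigma m =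
      X.copy e ≫ (P ◁ (X.lift e ≫ X.bang.map (X.gamma e ≫ X.sigma m))) ≫ m := by
  have h := gamma_str_inv e =≫ ((X.bifree P).str.hom ≫ X.sigma m)
  rw [Category.assoc, Iso.inv_hom_id_assoc, str_hom_sigma] at h
  conv_lhs => rw [h]
  simp only [Functor.map_comp, MonoidalCategory.whiskerLeft_comp, Category.assoc]

end Intuit

end Interp

end LNL

namespace LNL

/-! ### Interleavings and label tuples -/

namespace Interleave

section Lists

variable {α : Type w} {l l₁ l₂ l₁' l₂' : List α}

theorem mem_iff (s : Interleave l l₁ l₂) (a : α) : a ∈ l ↔ a ∈ l₁ ∨ a ∈ l₂ := by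
  induction s with
  | nil => simp
  | left s ih => simp [ih, or_assoc]
  | right s ih => simp [ih, or_left_comm]

theorem sublist_left (s : Interleave l l₁ l₂) : l₁.Sublist l := by
  induction s with
  | nil => exact .slnil
  | left s ih => exact ih.cons_cons _
  | right s ih => exact ih.cons _

theorem sublist_right (s : Interleave l l₁ l₂) : l₂.Sublist l := by
  induction s with
  | nil => exact .slnil
  | left s ih => exact ih.cons _
  | right s ih => exact ih.cons_cons _

theorem disjoint {β : Type*} {f : α → β} (s : Interleave l l₁ l₂) (h : (l.map f).Nodup) :
    ∀ a ∈ l₁, ∀ b ∈ l₂, f a ≠ f b := by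
  induction s with
  | nil => simp
  | left s ih =>
    rw [List.map_cons, List.nodup_cons] at h
    intro a ha b hb e
    rcases List.mem_cons.1 ha with rfl | ha
    · exact h.1 (e ▸ List.mem_map_of_mem (s.sublist_right.subset hb))
    · exact ih h.2 a ha b hb e
  | right s ih =>
    rw [List.map_cons, List.nodup_cons] at h
    intro a ha b hb e
    rcases List.mem_cons.1 hb with rfl | hb
    · exact h.1 (e ▸ List.mem_map_of_mem (s.sublist_left.subset ha))
    · exact ih h.2 a ha b hb e

/-- An interleaving is determined by the membership of the entries in the two parts. -/
theorem unique (s : Interleave l l₁ l₂) (s' : Interleave l l₁' l₂')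
    (h₁ : ∀ a ∈ l₁, a ∉ l₂') (h₂ : ∀ a ∈ l₂, a ∉ l₁') : l₁ = l₁' ∧ l₂ = l₂' ∧ s ≍ s' := by
  induction s generalizing l₁' l₂' with
  | nil => cases s'; simp
  | left s ih =>
    cases s' with
    | left s' =>
      obtain ⟨rfl, rfl, h⟩ := ih s' (fun a ha => h₁ a (List.mem_cons_of_mem _ ha))
        (fun a ha ha' => h₂ a ha (List.mem_cons_of_mem _ ha'))
      cases h
      simp
    | right s' => exact absurd (List.mem_cons_self ..) (h₁ _ (List.mem_cons_self ..))
  | right s ih =>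
    cases s' with
    | left s' => exact absurd (List.mem_cons_self ..) (h₂ _ (List.mem_cons_self ..))
    | right s' =>
      obtain ⟨rfl, rfl, h⟩ := ih s' (fun a ha ha' => h₁ a ha (List.mem_cons_of_mem _ ha'))
        (fun a ha => h₂ a (List.mem_cons_of_mem _ ha))
      cases h
      simp

theorem eq_of_nil_left (s : Interleave l [] l₂) : l = l₂ := by
  induction l generalizing l₂ with
  | nil => cases s; rfl
  | cons a l ih =>
    cases s with
    | right s => rw [ih s]

theorem eq_of_nil_right (s : Interleave l l₁ []) : l = l₁ := by
  induction l generalizing l₁ with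
  | nil => cases s; rfl
  | cons a l ih =>
    cases s with
    | left s => rw [ih s]

/-- The interleaving of the empty list and a list. -/
def nilLeft : (l : List α) → Interleave l [] l
  | [] => .nil
  | _ :: l => .right (nilLeft l)

/-- The interleaving of a list and the empty list. -/
def nilRight : (l : List α) → Interleave l l []
  | [] => .nil
  | _ :: l => .left (nilRight l)

/-- Concatenation as an interleaving. -/
def append : (l₁ l₂ : List α) → Interleave (l₁ ++ l₂) l₁ l₂
  | [], l₂ => nilLeft l₂
  | _ :: l₁, l₂ => .left (append l₁ l₂)

/-- An interleaving with the two parts exchanged. -/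
def symm : {l l₁ l₂ : List α} → Interleave l l₁ l₂ → Interleave l l₂ l₁
  | _, _, _, .nil => .nil
  | _, _, _, .left s => .right s.symm
  | _, _, _, .right s => .left s.symm

end Lists

section Iso

variable {W : Type w} {D : Type u₁} [Category.{v₁} D] [MonoidalCategory D]

theorem left_assoc_aux {X L A M B N C : D} {f : L ⟶ A ⊗ M} {g : M ⟶ B ⊗ C} {f' : L ⟶ N ⊗ C}
    {g' : N ⟶ A ⊗ B} (h : f ≫ A ◁ g = f' ≫ g' ▷ C ≫ (α_ _ _ _).hom) :
    (X ◁ f ≫ (α_ _ _ _).inv) ≫ (X ⊗ A) ◁ g =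
      (X ◁ f' ≫ (α_ _ _ _).inv) ≫ (X ◁ g' ≫ (α_ _ _ _).inv) ▷ C ≫ (α_ _ _ _).hom := by
  calc _ = X ◁ (f ≫ A ◁ g) ≫ (α_ _ _ _).inv := by monoidal
    _ = _ := by rw [h]; monoidal

variable [SymmetricCategory D]

theorem right_left_assoc_aux {X L A M B N C : D} {f : L ⟶ A ⊗ M} {g : M ⟶ B ⊗ C} {f' : L ⟶ N ⊗ C}
    {g' : N ⟶ A ⊗ B} (h : f ≫ A ◁ g = f' ≫ g' ▷ C ≫ (α_ _ _ _).hom) :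
    (X ◁ f ≫ (α_ _ _ _).inv ≫ (β_ _ _).hom ▷ _ ≫ (α_ _ _ _).hom) ≫
        A ◁ (X ◁ g ≫ (α_ _ _ _).inv) =
      (X ◁ f' ≫ (α_ _ _ _).inv) ≫
        (X ◁ g' ≫ (α_ _ _ _).inv ≫ (β_ _ _).hom ▷ _ ≫ (α_ _ _ _).hom) ▷ C ≫
          (α_ _ _ _).hom := by
  calc _ = X ◁ f ≫ ((α_ _ _ _).inv ≫ (β_ X A).hom ▷ M ≫ (A ⊗ X) ◁ g) ≫ (α_ _ _ _).hom ≫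
        A ◁ (α_ _ _ _).inv := by monoidal
    _ = X ◁ (f ≫ A ◁ g) ≫ (α_ _ _ _).inv ≫ (β_ X A).hom ▷ _ ≫ (α_ _ _ _).hom ≫
        A ◁ (α_ _ _ _).inv := by rw [← whisker_exchange]; monoidal
    _ = _ := by rw [h]; monoidal

theorem right_right_assoc_aux {X L A M B N C : D} {f : L ⟶ A ⊗ M} {g : M ⟶ B ⊗ C} {f' : L ⟶ N ⊗ C}
    {g' : N ⟶ A ⊗ B} (h : f ≫ A ◁ g = f' ≫ g' ▷ C ≫ (α_ _ _ _).hom) :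
    (X ◁ f ≫ (α_ _ _ _).inv ≫ (β_ _ _).hom ▷ _ ≫ (α_ _ _ _).hom) ≫
        A ◁ (X ◁ g ≫ (α_ _ _ _).inv ≫ (β_ _ _).hom ▷ _ ≫ (α_ _ _ _).hom) =
      (X ◁ f' ≫ (α_ _ _ _).inv ≫ (β_ _ _).hom ▷ _ ≫ (α_ _ _ _).hom) ≫ g' ▷ _ ≫
          (α_ _ _ _).hom := by
  calc _ = X ◁ f ≫ ((α_ _ _ _).inv ≫ (β_ X A).hom ▷ M ≫ (A ⊗ X) ◁ g) ≫ (α_ _ _ _).hom ≫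
        A ◁ ((α_ _ _ _).inv ≫ (β_ _ _).hom ▷ _ ≫ (α_ _ _ _).hom) := by monoidal
    _ = X ◁ (f ≫ A ◁ g) ≫ (α_ _ _ _).inv ≫ (β_ X A).hom ▷ _ ≫ (α_ _ _ _).hom ≫
        A ◁ ((α_ _ _ _).inv ≫ (β_ _ _).hom ▷ _ ≫ (α_ _ _ _).hom) := by
      rw [← whisker_exchange]; monoidal
    _ = X ◁ f' ≫ (α_ _ _ _).inv ≫ (X ◁ g' ≫ (β_ X (A ⊗ B)).hom) ▷ C ≫ (α_ _ _ _).hom ≫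
        (α_ _ _ _).hom := by
      rw [h, BraidedCategory.braiding_tensor_right_hom]; monoidal
    _ = _ := by rw [BraidedCategory.braiding_naturality_right]; monoidal

theorem left_symm_aux {X L A B : D} (f : L ⟶ A ⊗ B) :
    X ◁ (f ≫ (β_ _ _).hom) ≫ (α_ _ _ _).inv ≫ (β_ _ _).hom ▷ _ ≫ (α_ _ _ _).hom =
      (X ◁ f ≫ (α_ _ _ _).inv) ≫ (β_ _ _).hom := by
  rw [BraidedCategory.braiding_tensor_left_hom]
  simp

theorem right_symm_aux {X L A B : D} (f : L ⟶ A ⊗ B) :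
    X ◁ (f ≫ (β_ _ _).hom) ≫ (α_ _ _ _).inv =
      (X ◁ f ≫ (α_ _ _ _).inv ≫ (β_ _ _).hom ▷ _ ≫ (α_ _ _ _).hom) ≫ (β_ _ _).hom := by
  rw [BraidedCategory.braiding_tensor_right_hom]
  simp only [MonoidalCategory.whiskerLeft_comp, Category.assoc, Iso.hom_inv_id_assoc]
  rw [← comp_whiskerRight_assoc, SymmetricCategory.symmetry]
  simp

variable (i : W → D) {l l₁ l₂ : List (ℕ × W)}

theorem iso_nil_left (s : Interleave l [] l) : (s.iso i).hom = (λ_ (entriesObj i l)).inv := by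
  induction l with
  | nil => cases s; rfl
  | cons a l ih =>
    cases s with
    | right s =>
      refine Eq.trans (congrArg (fun k => i a.2 ◁ k ≫ (α_ _ _ _).inv ≫ (β_ _ _).hom ▷ _ ≫
        (α_ _ _ _).hom) (ih s)) ?_
      change _ = (λ_ (i a.2 ⊗ entriesObj i l)).inv
      simp [entriesObj]

theorem iso_nil_right (s : Interleave l l []) : (s.iso i).hom = (ρ_ (entriesObj i l)).inv := by
  induction l with
  | nil =>
    cases s
    exact unitors_inv_equal
  | cons a l ih =>
    cases s with
    | left s =>
      refine Eq.trans (congrArg (fun k => i a.2 ◁ k ≫ (α_ _ _ _).inv) (ih s)) ?_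
      change _ = (ρ_ (i a.2 ⊗ entriesObj i l)).inv
      simp [entriesObj]

theorem iso_symm_hom (s : Interleave l l₁ l₂) :
    (s.symm.iso i).hom = (s.iso i).hom ≫ (β_ _ _).hom := by
  induction s with
  | nil =>
    change (λ_ (𝟙_ D)).inv = (λ_ (𝟙_ D)).inv ≫ (β_ (𝟙_ D) (𝟙_ D)).hom
    rw [braiding_tensorUnit_right, ← unitors_equal]
    simp
  | @left a l l₁ l₂ s ih =>
    exact Eq.trans (congrArg (fun k => i a.2 ◁ k ≫ (α_ _ _ _).inv ≫ (β_ _ _).hom ▷ _ ≫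
        (α_ _ _ _).hom) ih) (left_symm_aux _)
  | @right a l l₁ l₂ s ih =>
    exact Eq.trans (congrArg (fun k => i a.2 ◁ k ≫ (α_ _ _ _).inv) ih) (right_symm_aux _)

/-- Splitting a part off and then splitting the rest can be done in the other order, with the same
decomposition into three parts up to the associator. -/
theorem exists_assoc {l a m b c : List (ℕ × W)} (s : Interleave l a m) (t : Interleave m b c) :
    ∃ (n : List (ℕ × W)) (s' : Interleave l n c) (t' : Interleave n a b),
      (s.iso i).hom ≫ _ ◁ (t.iso i).hom = (s'.iso i).hom ≫ (t'.iso i).hom ▷ _ ≫ (α_ _ _ _).hom := by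
  induction s generalizing b c with
  | nil =>
    cases t
    refine ⟨_, .nil, .nil, ?_⟩
    change (λ_ (𝟙_ D)).inv ≫ _ ◁ (λ_ (𝟙_ D)).inv =
      (λ_ (𝟙_ D)).inv ≫ (λ_ (𝟙_ D)).inv ▷ _ ≫ (α_ _ _ _).hom
    monoidal
  | left s ih =>
    obtain ⟨n, s', t', h⟩ := ih t
    exact ⟨_, .left s', .left t', left_assoc_aux h⟩
  | right s ih =>
    cases t with
    | left t =>
      obtain ⟨n, s', t', h⟩ := ih t
      exact ⟨_, .left s', .right t', right_left_assoc_aux h⟩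
    | right t =>
      obtain ⟨n, s', t', h⟩ := ih t
      exact ⟨_, .right s', t', right_right_assoc_aux h⟩

theorem exists_assoc_symm {l n a b c : List (ℕ × W)} (s' : Interleave l n c)
    (t' : Interleave n a b) :
    ∃ (m : List (ℕ × W)) (s : Interleave l a m) (t : Interleave m b c),
      (s.iso i).hom ≫ _ ◁ (t.iso i).hom = (s'.iso i).hom ≫ (t'.iso i).hom ▷ _ ≫ (α_ _ _ _).hom := by
  induction s' generalizing a b with
  | nil =>
    cases t'
    refine ⟨_, .nil, .nil, ?_⟩
    change (λ_ (𝟙_ D)).inv ≫ _ ◁ (λ_ (𝟙_ D)).inv =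
      (λ_ (𝟙_ D)).inv ≫ (λ_ (𝟙_ D)).inv ▷ _ ≫ (α_ _ _ _).hom
    monoidal
  | left s' ih =>
    cases t' with
    | left t' =>
      obtain ⟨n, s, t, h⟩ := ih t'
      exact ⟨_, .left s, t, left_assoc_aux h⟩
    | right t' =>
      obtain ⟨n, s, t, h⟩ := ih t'
      exact ⟨_, .right s, .left t, right_left_assoc_aux h⟩
  | right s' ih =>
    obtain ⟨n, s, t, h⟩ := ih t'
    exact ⟨_, .right s, .right t, right_right_assoc_aux h⟩

end Iso

end Interleave

theorem LCtx.ext {W : Type w} {Q Q' : LCtx W} (h : Q.entries = Q'.entries) : Q = Q' := by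
  cases Q; cases Q'; cases h; rfl

theorem LCtx.nodup {W : Type w} (Q : LCtx W) : (Q.entries.map Prod.fst).Nodup := by
  rw [List.nodup_iff_pairwise_ne, List.pairwise_map]
  exact Q.sorted.imp fun h => h.ne

section LSplit

variable {W : Type w} {Q Q₁ Q₂ Q₁' Q₂' : LCtx W}

theorem LSplit.mem_labels (s : LSplit Q Q₁ Q₂) (l : ℕ) :
    l ∈ Q.labels ↔ l ∈ Q₁.labels ∨ l ∈ Q₂.labels := by
  simp only [LCtx.labels, List.mem_map, s.mem_iff, or_and_right, exists_or]

theorem LSplit.disjoint (s : LSplit Q Q₁ Q₂) {l : ℕ} (h₁ : l ∈ Q₁.labels) (h₂ : l ∈ Q₂.labels) :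
    False := by
  obtain ⟨a, ha, rfl⟩ := List.mem_map.1 h₁
  obtain ⟨b, hb, e⟩ := List.mem_map.1 h₂
  exact Interleave.disjoint s Q.nodup a ha b hb e.symm

/-- The labels of the two parts determine a splitting. -/
theorem LSplit.unique (s : LSplit Q Q₁ Q₂) (s' : LSplit Q Q₁' Q₂')
    (h₁ : ∀ l ∈ Q₁.labels, l ∉ Q₂'.labels) (h₂ : ∀ l ∈ Q₂.labels, l ∉ Q₁'.labels) :
    Q₁ = Q₁' ∧ Q₂ = Q₂' ∧ s ≍ s' := by
  obtain ⟨e₁, e₂, e⟩ := Interleave.unique s s'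
    (fun a ha ha' => h₁ _ (List.mem_map_of_mem ha) (List.mem_map_of_mem ha'))
    (fun a ha ha' => h₂ _ (List.mem_map_of_mem ha) (List.mem_map_of_mem ha'))
  exact ⟨LCtx.ext e₁, LCtx.ext e₂, e⟩

theorem LSplit.unique_right (s : LSplit Q Q₁ Q₂) (s' : LSplit Q Q₁' Q₂) :
    Q₁ = Q₁' ∧ s ≍ s' := by
  obtain ⟨h, -, h'⟩ := LSplit.unique s s' (fun _ h h' => LSplit.disjoint s h h')
    (fun _ h h' => LSplit.disjoint s' h' h)
  exact ⟨h, h'⟩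

theorem LSplit.eq_of_empty_left (s : LSplit Q (LCtx.empty W) Q₂) : Q = Q₂ :=
  LCtx.ext (Interleave.eq_of_nil_left s)

theorem LSplit.eq_of_empty_right (s : LSplit Q Q₁ (LCtx.empty W)) : Q = Q₁ :=
  LCtx.ext (Interleave.eq_of_nil_right s)

variable {D : Type u₁} [Category.{v₁} D] [MonoidalCategory D] [SymmetricCategory D] (i : W → D)

/-- The decomposition of a label context into two parts. -/
def LSplit.map (s : LSplit Q Q₁ Q₂) : Q.obj i ≅ Q₁.obj i ⊗ Q₂.obj i := Interleave.iso i s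

theorem LSplit.map_empty_left (s : LSplit Q (LCtx.empty W) Q) :
    (LSplit.map i s).hom = (λ_ (Q.obj i)).inv :=
  Interleave.iso_nil_left i s

theorem LSplit.map_empty_right (s : LSplit Q Q (LCtx.empty W)) :
    (LSplit.map i s).hom = (ρ_ (Q.obj i)).inv :=
  Interleave.iso_nil_right i s

theorem LSplit.exists_symm (s : LSplit Q Q₁ Q₂) : ∃ s' : LSplit Q Q₂ Q₁,
    (LSplit.map i s').hom = (LSplit.map i s).hom ≫ (β_ _ _).hom :=
  ⟨Interleave.symm s, Interleave.iso_symm_hom i s⟩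

theorem LSplit.exists_assoc {Q A M B C : LCtx W} (s : LSplit Q A M) (t : LSplit M B C) :
    ∃ (N : LCtx W) (s' : LSplit Q N C) (t' : LSplit N A B),
      (LSplit.map i s).hom ≫ _ ◁ (LSplit.map i t).hom =
        (LSplit.map i s').hom ≫ (LSplit.map i t').hom ▷ _ ≫ (α_ _ _ _).hom := by
  obtain ⟨n, s', t', h⟩ := Interleave.exists_assoc i s t
  exact ⟨⟨n, Q.sorted.sublist s'.sublist_left⟩, s', t', h⟩

theorem LSplit.exists_assoc_symm {Q N A B C : LCtx W} (s' : LSplit Q N C) (t' : LSplit N A B) :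
    ∃ (M : LCtx W) (s : LSplit Q A M) (t : LSplit M B C),
      (LSplit.map i s).hom ≫ _ ◁ (LSplit.map i t).hom =
        (LSplit.map i s').hom ≫ (LSplit.map i t').hom ▷ _ ≫ (α_ _ _ _).hom := by
  obtain ⟨n, s, t, h⟩ := Interleave.exists_assoc_symm i s' t'
  exact ⟨⟨n, Q.sorted.sublist s.sublist_right⟩, s, t, h⟩

end LSplit

section LTyping

variable {W : Type w}

theorem LTyping.mem_labels {Q : LCtx W} {a : LTuple} {T : MTy W} (d : LTyping Q a T) (l : ℕ) :
    l ∈ Q.labels ↔ a.Occurs l := by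
  induction d with
  | label l' α => simp [LCtx.labels, LCtx.single, LTuple.Occurs]
  | unit => simp [LCtx.labels, LCtx.empty, LTuple.Occurs]
  | pair s d e ihd ihe => rw [LSplit.mem_labels s, ihd, ihe, LTuple.Occurs]

/-- A label tuple has at most one typing in a given context: its labels determine how the context is
split. -/
theorem LTyping.unique {Q Q' : LCtx W} {a : LTuple} {T T' : MTy W} (d : LTyping Q a T)
    (d' : LTyping Q' a T') (hQ : Q = Q') : T = T' ∧ d ≍ d' := by
  induction d generalizing Q' T' with
  | label l α =>
    cases d' with
    | label _ α' =>
      have : α = α' := by simpa [LCtx.single] using hQ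
      subst this
      simp
  | unit => cases d'; simp
  | @pair Q Q₁ Q₂ a b T U s d e ihd ihe =>
    cases d' with
    | @pair _ Q₁' Q₂' _ _ T' U' s' d' e' =>
      subst hQ
      obtain ⟨rfl, rfl, h⟩ := LSplit.unique s s'
        (fun l h h' => LSplit.disjoint s h ((e.mem_labels l).2 ((e'.mem_labels l).1 h')))
        (fun l h h' => LSplit.disjoint s ((d.mem_labels l).2 ((d'.mem_labels l).1 h')) h)
      obtain ⟨rfl, h₁⟩ := ihd d' rfl
      obtain ⟨rfl, h₂⟩ := ihe e' rfl
      cases h; cases h₁; cases h₂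
      simp

/-- Label tuples of any type exist, with labels above any given bound. -/
theorem LTyping.exists_fresh (T : MTy W) (N : ℕ) : ∃ (Q : LCtx W) (a : LTuple),
    Nonempty (LTyping Q a T) ∧ ∀ l ∈ Q.labels, N ≤ l := by
  induction T generalizing N with
  | wire α => exact ⟨_, _, ⟨.label N α⟩, by simp [LCtx.labels, LCtx.single]⟩
  | one => exact ⟨_, _, ⟨.unit⟩, by simp [LCtx.labels, LCtx.empty]⟩
  | tensor T U ihT ihU =>
    obtain ⟨Q₁, a, ⟨d⟩, h₁⟩ := ihT N
    -- The labels of the second component are chosen above those of the first, so that the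
    -- concatenation of the two contexts is sorted.
    obtain ⟨N', hN⟩ : ∃ N', ∀ l ∈ Q₁.labels, l < N' :=
      ⟨Q₁.labels.sum + 1, fun l hl => Nat.lt_succ_of_le (List.le_sum_of_mem hl)⟩
    obtain ⟨Q₂, b, ⟨e⟩, h₂⟩ := ihU (max N N')
    refine ⟨⟨Q₁.entries ++ Q₂.entries, List.pairwise_append.2 ⟨Q₁.sorted, Q₂.sorted, ?_⟩⟩, _,
      ⟨.pair (Interleave.append _ _) d e⟩, ?_⟩
    · intro x hx y hy
      have h := hN _ (List.mem_map_of_mem hx)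
      have h' := h₂ _ (List.mem_map_of_mem hy)
      omega
    · intro l hl
      simp only [LCtx.labels, List.map_append, List.mem_append] at hl
      rcases hl with hl | hl
      · exact h₁ l hl
      · exact (le_max_left ..).trans (h₂ l hl)

end LTyping

end LNL

namespace LNL

/-! ### Contexts of variables and labels as a single tensor product -/

section Auxiliary

variable {C : Type u₂} [Category.{v₂} C] [MonoidalCategory C] [SymmetricCategory C]

theorem split_nil_aux {L A B : C} (f : L ⟶ A ⊗ B) :
    (((λ_ (𝟙_ C)).inv ⊗ₘ f) ≫ tensorμ _ _ _ _) ≫ ((λ_ A).hom ⊗ₘ (λ_ B).hom) =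
      (λ_ L).hom ≫ f := by
  rw [MonoidalCategory.tensorHom_def', Category.assoc, Category.assoc,
    ← tensor_left_unitality, leftUnitor_naturality]

theorem split_cons_aux {S S₁ S₂ G G₁ G₂ L L₁ L₂ H H₁ H₂ : C} (σ : S ⟶ S₁ ⊗ S₂)
    {g : G ⟶ G₁ ⊗ G₂} {f : L ⟶ L₁ ⊗ L₂} {j : G ⊗ L ⟶ H} {j₁ : G₁ ⊗ L₁ ⟶ H₁}
    {j₂ : G₂ ⊗ L₂ ⟶ H₂} {k : H ⟶ H₁ ⊗ H₂}
    (h : ((g ⊗ₘ f) ≫ tensorμ _ _ _ _) ≫ (j₁ ⊗ₘ j₂) = j ≫ k) :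
    (((σ ⊗ₘ g) ≫ tensorμ _ _ _ _) ⊗ₘ f) ≫ tensorμ _ _ _ _ ≫
        (((α_ _ _ _).hom ≫ S₁ ◁ j₁) ⊗ₘ ((α_ _ _ _).hom ≫ S₂ ◁ j₂)) =
      ((α_ _ _ _).hom ≫ S ◁ j) ≫ (σ ⊗ₘ k) ≫ tensorμ _ _ _ _ := by
  have e : (((σ ⊗ₘ g) ≫ tensorμ S₁ S₂ G₁ G₂) ⊗ₘ f) =
      ((σ ⊗ₘ g) ⊗ₘ f) ≫ tensorμ S₁ S₂ G₁ G₂ ▷ _ := by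
    rw [← tensorHom_id, tensorHom_comp_tensorHom, Category.comp_id]
  have e' : (((α_ S₁ G₁ L₁).hom ≫ S₁ ◁ j₁) ⊗ₘ ((α_ S₂ G₂ L₂).hom ≫ S₂ ◁ j₂)) =
      ((α_ S₁ G₁ L₁).hom ⊗ₘ (α_ S₂ G₂ L₂).hom) ≫ (S₁ ◁ j₁ ⊗ₘ S₂ ◁ j₂) := by
    rw [tensorHom_comp_tensorHom]
  have e'' : σ ⊗ₘ (((g ⊗ₘ f) ≫ tensorμ G₁ G₂ L₁ L₂) ≫ (j₁ ⊗ₘ j₂)) = σ ⊗ₘ (j ≫ k) := by rw [h]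
  have e₃ : σ ⊗ₘ j ≫ k = (S ◁ j) ≫ (σ ⊗ₘ k) := by
    rw [← id_tensorHom, tensorHom_comp_tensorHom, Category.id_comp]
  rw [e, e', Category.assoc, reassoc_of% (tensor_associativity S₁ S₂ G₁ G₂ L₁ L₂),
    ← tensorμ_natural_right, associator_naturality_assoc, ← whiskerLeft_comp_assoc, Category.assoc,
    ← reassoc_of% e₃, ← e'', ← id_tensorHom, tensorHom_comp_tensorHom_assoc]
  simp

theorem den_let_aux {G G₁ G₂ L L₁ L₂ H H₁ H₂ A D : C} {s : G ⊗ L ⟶ (G₁ ⊗ L₁) ⊗ (G₂ ⊗ L₂)}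
    {j : G ⊗ L ≅ H} {j₁ : G₁ ⊗ L₁ ≅ H₁} {j₂ : G₂ ⊗ L₂ ≅ H₂} {k : H ⟶ H₁ ⊗ H₂}
    (h : s ≫ (j₁.hom ⊗ₘ j₂.hom) = j.hom ≫ k) (m : G₁ ⊗ L₁ ⟶ A) (n : A ⊗ (G₂ ⊗ L₂) ⟶ D) :
    j.inv ≫ s ≫ m ▷ _ ≫ n = k ≫ (j₁.inv ≫ m) ▷ _ ≫ A ◁ j₂.inv ≫ n := by
  have h' : j.inv ≫ s = k ≫ (j₁.inv ⊗ₘ j₂.inv) := by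
    rw [Iso.inv_comp_eq, ← reassoc_of% h]; simp
  rw [reassoc_of% h', MonoidalCategory.tensorHom_def, Category.assoc, whisker_exchange_assoc,
    comp_whiskerRight_assoc]

theorem den_letPair_aux {A B G L H D : C} (j : H ⟶ G ⊗ L) (n : (B ⊗ (A ⊗ G)) ⊗ L ⟶ D) :
    (A ⊗ B) ◁ j ≫ (β_ A B).hom ▷ _ ≫ (α_ _ _ _).inv ≫ (α_ _ _ _).hom ▷ _ ≫ n =
      (β_ A B).hom ▷ _ ≫ (α_ _ _ _).hom ≫ (B ◁ (A ◁ j ≫ (α_ _ _ _).inv) ≫ (α_ _ _ _).inv) ≫ n := by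
  rw [whisker_exchange_assoc]
  congr 1
  monoidal

theorem den_tensor_aux {G G₁ G₂ L L₁ L₂ H H₁ H₂ A B : C} {s : G ⊗ L ⟶ (G₁ ⊗ L₁) ⊗ (G₂ ⊗ L₂)}
    {j : G ⊗ L ≅ H} {j₁ : G₁ ⊗ L₁ ≅ H₁} {j₂ : G₂ ⊗ L₂ ≅ H₂} {k : H ⟶ H₁ ⊗ H₂}
    (h : s ≫ (j₁.hom ⊗ₘ j₂.hom) = j.hom ≫ k) (m : G₁ ⊗ L₁ ⟶ A) (n : G₂ ⊗ L₂ ⟶ B) :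
    j.inv ≫ s ≫ (m ⊗ₘ n) = k ≫ ((j₁.inv ≫ m) ⊗ₘ (j₂.inv ≫ n)) := by
  have h' : j.inv ≫ s = k ≫ (j₁.inv ⊗ₘ j₂.inv) := by
    rw [Iso.inv_comp_eq, ← reassoc_of% h]; simp
  rw [reassoc_of% h', tensorHom_comp_tensorHom]

theorem fullIso_proj_aux {S G L H : C} {j : G ⊗ L ⟶ H} {p : H ⟶ L} {d : G ⟶ 𝟙_ C}
    {s : S ⟶ 𝟙_ C} (h : j ≫ p = d ▷ L ≫ (λ_ L).hom) :
    ((α_ _ _ _).hom ≫ S ◁ j) ≫ (s ⊗ₘ p) ≫ (λ_ L).hom =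
      ((s ⊗ₘ d) ≫ (λ_ _).hom) ▷ L ≫ (λ_ L).hom := by
  rw [MonoidalCategory.tensorHom_def']
  simp only [Category.assoc, ← MonoidalCategory.whiskerLeft_comp_assoc, h]
  simp [MonoidalCategory.tensorHom_def']

theorem fullIso_fullParamIso_aux {S G H P Q R : C} {j : G ⊗ 𝟙_ C ⟶ H} {p : H ⟶ P}
    {s : S ⟶ Q} {g : G ⟶ P} {μ : Q ⊗ P ⟶ R} (h : j ≫ p = (ρ_ _).hom ≫ g) :
    ((α_ _ _ _).hom ≫ S ◁ j) ≫ (s ⊗ₘ p) ≫ μ = (ρ_ _).hom ≫ (s ⊗ₘ g) ≫ μ := by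
  rw [MonoidalCategory.tensorHom_def']
  simp only [Category.assoc, ← MonoidalCategory.whiskerLeft_comp_assoc, h]
  simp [MonoidalCategory.tensorHom_def']

theorem fullIso_inv_discard_aux {G : C} (d : G ⟶ 𝟙_ C) :
    d ▷ 𝟙_ C ≫ (λ_ _).hom = (ρ_ _).hom ≫ d := by
  simp [unitors_equal]

theorem comp_discard_aux {G G' H I A : C} {j : H ⟶ G} {r : G ⟶ G'} {d : G' ⟶ I} {p : H ⟶ I}
    (h : j ≫ r ≫ d = p) (v : I ⟶ A) : j ≫ r ≫ d ≫ v = p ≫ v := by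
  rw [← h, Category.assoc, Category.assoc]

theorem den_label_aux {G L H : C} {d : G ⟶ 𝟙_ C} {j : G ⊗ (L ⊗ 𝟙_ C) ⟶ H} {p : H ⟶ L ⊗ 𝟙_ C}
    (h : j ≫ p = d ▷ _ ≫ (λ_ _).hom) :
    (d ⊗ₘ (ρ_ L).hom) ≫ (λ_ L).hom = j ≫ p ≫ (ρ_ L).hom := by
  rw [reassoc_of% h, MonoidalCategory.tensorHom_def, Category.assoc, leftUnitor_naturality]

theorem fullIso'_aux {G H A : C} {j : G ⊗ 𝟙_ C ≅ H} {p : H ≅ A} {c : G ≅ A}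
    (h : j.hom ≫ p.hom = (ρ_ _).hom ≫ c.hom) : j.inv ≫ (ρ_ G).hom = p.hom ≫ 𝟙 _ ≫ c.inv := by
  rw [Category.id_comp, Iso.inv_comp_eq, reassoc_of% h, Iso.hom_inv_id, Category.comp_id]

theorem den_lift_aux {G H A : C} (B : C ⥤ C) {j : H ⟶ G ⊗ 𝟙_ C} {l : G ⟶ B.obj G}
    {l' : H ⟶ B.obj H} (h : (j ≫ (ρ_ _).hom) ≫ l = l' ≫ B.map (j ≫ (ρ_ _).hom))
    (d : G ⊗ 𝟙_ C ⟶ A) :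
    j ≫ (ρ_ _).hom ≫ l ≫ B.map ((ρ_ _).inv ≫ d) = l' ≫ B.map (j ≫ d) := by
  have h' := h =≫ B.map ((ρ_ _).inv ≫ d)
  rw [Category.assoc, Category.assoc, Category.assoc, ← Functor.map_comp, Category.assoc,
    Iso.hom_inv_id_assoc] at h'
  exact h'

theorem den_var_zero_aux {S G H : C} {j : G ⊗ 𝟙_ C ⟶ H} {p : H ⟶ 𝟙_ C} {d : G ⟶ 𝟙_ C}
    (h : j ≫ p = d ▷ _ ≫ (λ_ _).hom) :
    (ρ_ _).hom ≫ S ◁ d ≫ (ρ_ _).hom = ((α_ _ _ _).hom ≫ S ◁ j) ≫ S ◁ p ≫ (ρ_ _).hom := by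
  simp only [Category.assoc, ← MonoidalCategory.whiskerLeft_comp_assoc, h]
  simp [unitors_equal]

theorem den_var_succ_aux {S G H A : C} {j : G ⊗ 𝟙_ C ⟶ H} {p : H ⟶ A} {l : G ⟶ A}
    {s : S ⟶ 𝟙_ C} (h : (ρ_ _).hom ≫ l = j ≫ p) :
    (ρ_ _).hom ≫ s ▷ _ ≫ (λ_ _).hom ≫ l =
      ((α_ _ _ _).hom ≫ S ◁ j) ≫ (s ⊗ₘ p) ≫ (λ_ _).hom := by
  rw [MonoidalCategory.tensorHom_def']
  simp only [Category.assoc, ← MonoidalCategory.whiskerLeft_comp_assoc, ← h]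
  rw [MonoidalCategory.whiskerLeft_comp_assoc, whisker_exchange_assoc]
  simp

theorem den_fix_aux {G H A B : C} (j : H ⟶ G ⊗ 𝟙_ C) (n : (A ⊗ G) ⊗ 𝟙_ C ⟶ B) :
    A ◁ (j ≫ (ρ_ _).hom) ≫ (ρ_ _).inv ≫ n = (A ◁ j ≫ (α_ _ _ _).inv) ≫ n := by
  simp

end Auxiliary

namespace Interp

open Functor.Monoidal

variable {V : Type u₁} [Category.{v₁} V] [CartesianMonoidalCategory V] [BraidedCategory V]
  [MonoidalClosed V] [HasFiniteCoproducts V]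
  {C : Type u₂} [Category.{v₂} C] [MonoidalCategory C] [SymmetricCategory C]
  [MonoidalClosed C] [HasFiniteCoproducts C]
  {M : Type u₃} [Category.{v₃} M] [MonoidalCategory M] [SymmetricCategory M]
  (X : Interp V C M) {δ : Prop} {K : Type k} {W : Type w} (i : W → M)

section CaseMap

variable {A B B' Y Z : C}

/-- Tensoring with an object preserves the coproduct, as the category is monoidal closed. -/
theorem coprod_tensor_hom_ext {u v : (Y ⨿ Z) ⊗ A ⟶ B}
    (h₁ : coprod.inl ▷ A ≫ u = coprod.inl ▷ A ≫ v)
    (h₂ : coprod.inr ▷ A ≫ u = coprod.inr ▷ A ≫ v) : u = v := by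
  rw [← cancel_epi (β_ A (Y ⨿ Z)).hom]
  apply MonoidalClosed.curry_injective
  ext
  · rw [← MonoidalClosed.curry_natural_left, ← MonoidalClosed.curry_natural_left,
      BraidedCategory.braiding_naturality_right_assoc,
      BraidedCategory.braiding_naturality_right_assoc, h₁]
  · rw [← MonoidalClosed.curry_natural_left, ← MonoidalClosed.curry_natural_left,
      BraidedCategory.braiding_naturality_right_assoc,
      BraidedCategory.braiding_naturality_right_assoc, h₂]

theorem inl_caseMap (f : Y ⊗ A ⟶ B) (g : Z ⊗ A ⟶ B) :
    (coprod.inl : Y ⟶ Y ⨿ Z) ▷ A ≫ caseMap f g = f := by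
  rw [caseMap, BraidedCategory.braiding_naturality_left_assoc,
    ← MonoidalClosed.uncurry_natural_left, coprod.inl_desc, MonoidalClosed.uncurry_curry,
    SymmetricCategory.symmetry_assoc]

theorem inr_caseMap (f : Y ⊗ A ⟶ B) (g : Z ⊗ A ⟶ B) :
    (coprod.inr : Z ⟶ Y ⨿ Z) ▷ A ≫ caseMap f g = g := by
  rw [caseMap, BraidedCategory.braiding_naturality_left_assoc,
    ← MonoidalClosed.uncurry_natural_left, coprod.inr_desc, MonoidalClosed.uncurry_curry,
    SymmetricCategory.symmetry_assoc]

theorem whiskerLeft_caseMap {A' : C} (w : A' ⟶ A) (f : Y ⊗ A ⟶ B) (g : Z ⊗ A ⟶ B) :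
    (Y ⨿ Z) ◁ w ≫ caseMap f g = caseMap (Y ◁ w ≫ f) (Z ◁ w ≫ g) := by
  apply coprod_tensor_hom_ext
  · rw [inl_caseMap, ← whisker_exchange_assoc, inl_caseMap]
  · rw [inr_caseMap, ← whisker_exchange_assoc, inr_caseMap]

end CaseMap

/-- The tensor product of the entries of a variable context and a label context, bracketed to the
right, so that extending the variable context by a variable is tensoring on the left. -/
noncomputable def full : Ctx δ W → LCtx W → C
  | [], Q => X.lctx i Q
  | o :: Γ, Q => X.slot i o ⊗ full Γ Q

/-- The comparison with the tensor product of the interpretations of the two contexts. -/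
noncomputable def fullIso : (Γ : Ctx δ W) → (Q : LCtx W) →
    (X.ctx i Γ ⊗ X.lctx i Q ≅ X.full i Γ Q)
  | [], _ => λ_ _
  | _ :: Γ, Q => α_ _ _ _ ≪≫ whiskerLeftIso _ (fullIso Γ Q)

/-- Splitting of variable and label contexts, entry by entry. -/
noncomputable def fullSplit {Q Q₁ Q₂ : LCtx W} (ls : LSplit Q Q₁ Q₂) : {Γ Γ₁ Γ₂ : Ctx δ W} →
    CSplit Γ Γ₁ Γ₂ → (X.full i Γ Q ⟶ X.full i Γ₁ Q₁ ⊗ X.full i Γ₂ Q₂)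
  | _, _, _, .nil => (LSplit.map (X.wire i) ls).hom
  | _, _, _, .none s => ((λ_ (𝟙_ C)).inv ⊗ₘ fullSplit ls s) ≫ tensorμ _ _ _ _
  | _, _, _, .both (P := P) h s =>
      (X.copy (X.paramIso i P h) ⊗ₘ fullSplit ls s) ≫ tensorμ (X.ty i P) (X.ty i P) _ _
  | _, _, _, .left (A := A) s => ((ρ_ (X.ty i A)).inv ⊗ₘ fullSplit ls s) ≫ tensorμ _ _ _ _
  | _, _, _, .right (A := A) s => ((λ_ (X.ty i A)).inv ⊗ₘ fullSplit ls s) ≫ tensorμ _ _ _ _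

/-- `fullSplit` is the splitting of contexts transported along `fullIso`. -/
theorem split_fullIso {Γ Γ₁ Γ₂ : Ctx δ W} {Q Q₁ Q₂ : LCtx W} (cs : CSplit Γ Γ₁ Γ₂)
    (ls : LSplit Q Q₁ Q₂) :
    X.split i cs ls ≫ ((X.fullIso i Γ₁ Q₁).hom ⊗ₘ (X.fullIso i Γ₂ Q₂).hom) =
      (X.fullIso i Γ Q).hom ≫ X.fullSplit i ls cs := by
  induction cs with
  | nil => exact split_nil_aux _
  | none s ih => exact (Category.assoc _ _ _).trans (split_cons_aux _ ih)
  | both h s ih => exact (Category.assoc _ _ _).trans (split_cons_aux _ ih)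
  | left s ih => exact (Category.assoc _ _ _).trans (split_cons_aux _ ih)
  | right s ih => exact (Category.assoc _ _ _).trans (split_cons_aux _ ih)

/-- The morphism discarding an intuitionistic variable context. -/
noncomputable def proj : (Γ : Ctx δ W) → Γ.Intuit → (Q : LCtx W) → (X.full i Γ Q ⟶ X.lctx i Q)
  | [], _, _ => 𝟙 _
  | o :: Γ, h, Q => (X.discard (X.slotIso i o h.1) ⊗ₘ proj Γ h.2 Q) ≫ (λ_ _).hom

/-- The isomorphism `⟦Φ⟧ ≅ F Y` for an intuitionistic context `Φ` without labels. -/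
noncomputable def fullParamIso : (Φ : Ctx δ W) → (h : Φ.Intuit) →
    (X.full i Φ (LCtx.empty W) ≅ X.F.obj (X.ctxParam i Φ h))
  | [], _ => εIso X.F
  | o :: Φ, h => X.prodIso (X.slotIso i o h.1) (fullParamIso Φ h.2)

/-- The projection to a variable. -/
noncomputable def fullLookup : {Γ : Ctx δ W} → {n : ℕ} → {A : Ty δ W} → Lookup Γ n A →
    (X.full i Γ (LCtx.empty W) ⟶ X.ty i A)
  | _, _, _, .zero (Γ := Γ) (A := A) h => (X.ty i A ◁ X.proj i Γ h (LCtx.empty W)) ≫ (ρ_ _).hom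
  | _, _, _, .succ (o := o) h l => (X.discard (X.slotIso i o h) ⊗ₘ fullLookup l) ≫ (λ_ _).hom

theorem fullIso_proj (Γ : Ctx δ W) (h : Γ.Intuit) (Q : LCtx W) :
    (X.fullIso i Γ Q).hom ≫ X.proj i Γ h Q =
      (X.discard (X.ctxIso i Γ h) ▷ _) ≫ (λ_ _).hom := by
  induction Γ with
  | nil =>
    change (λ_ _).hom ≫ 𝟙 _ = (X.discard (εIso X.F) ▷ _) ≫ (λ_ _).hom
    rw [discard_εIso]
    simp
  | cons o Γ ih =>
    refine (fullIso_proj_aux (ih h.2)).trans ?_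
    exact congrArg (fun k => k ▷ X.lctx i Q ≫ (λ_ _).hom)
      (discard_prodIso (X.slotIso i o h.1) (X.ctxIso i Γ h.2)).symm

theorem fullIso_fullParamIso (Γ : Ctx δ W) (h : Γ.Intuit) :
    (X.fullIso i Γ (LCtx.empty W)).hom ≫ (X.fullParamIso i Γ h).hom =
      (ρ_ _).hom ≫ (X.ctxIso i Γ h).hom := by
  induction Γ with
  | nil => exact (congrArg (fun k => k ≫ (εIso X.F).hom) unitors_equal)
  | cons o Γ ih => exact fullIso_fullParamIso_aux (ih h.2)

variable {cty : K → Ty δ W} (cst : X.Constants i cty) {i}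

/-- The interpretation of a derivation, with the contexts as a single tensor product. -/
noncomputable def den {Γ : Ctx δ W} {Q : LCtx W} {m : Term δ K i} {A : Ty δ W}
    (d : Deriv cty Γ Q m A) : X.full i Γ Q ⟶ X.ty i A :=
  (X.fullIso i Γ Q).inv ≫ X.deriv i cst d

theorem deriv_eq {Γ : Ctx δ W} {Q : LCtx W} {m : Term δ K i} {A : Ty δ W}
    (d : Deriv cty Γ Q m A) : X.deriv i cst d = (X.fullIso i Γ Q).hom ≫ X.den cst d := by
  simp [den]

section Equations

variable {Γ Γ₁ Γ₂ : Ctx δ W} {Q Q₁ Q₂ : LCtx W} {m n p : Term δ K i} {A B D : Ty δ W}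
  (cs : CSplit Γ Γ₁ Γ₂) (ls : LSplit Q Q₁ Q₂)

theorem den_letIn (dm : Deriv cty Γ₁ Q₁ m A) (dn : Deriv cty (some A :: Γ₂) Q₂ n B) :
    X.den cst (.letIn cs ls dm dn) =
      X.fullSplit i ls cs ≫ X.den cst dm ▷ _ ≫ X.den cst dn := by
  refine (den_let_aux (X.split_fullIso i cs ls) (X.deriv i cst dm)
    ((α_ _ _ _).inv ≫ X.deriv i cst dn)).trans ?_
  exact congrArg (fun k => _ ≫ _ ≫ k) (Category.assoc _ _ _).symm

theorem den_abort (dm : Deriv cty Γ Q m .zero) :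
    X.den cst (.abort (A := A) dm) = X.den cst dm ≫ initial.to _ :=
  (Category.assoc _ _ _).symm

theorem den_inl (dm : Deriv cty Γ Q m A) :
    X.den cst (.inl (B := B) dm) = X.den cst dm ≫ coprod.inl :=
  (Category.assoc _ _ _).symm

theorem den_inr (dm : Deriv cty Γ Q m B) :
    X.den cst (.inr (A := A) dm) = X.den cst dm ≫ coprod.inr :=
  (Category.assoc _ _ _).symm

theorem den_case (dm : Deriv cty Γ₁ Q₁ m (.sum A B)) (dn : Deriv cty (some A :: Γ₂) Q₂ n D)
    (dp : Deriv cty (some B :: Γ₂) Q₂ p D) :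
    X.den cst (.case cs ls dm dn dp) =
      X.fullSplit i ls cs ≫ X.den cst dm ▷ _ ≫ caseMap (X.den cst dn) (X.den cst dp) := by
  refine (den_let_aux (X.split_fullIso i cs ls) (X.deriv i cst dm)
    (caseMap ((α_ _ _ _).inv ≫ X.deriv i cst dn) ((α_ _ _ _).inv ≫ X.deriv i cst dp))).trans ?_
  refine congrArg (fun k => _ ≫ _ ≫ k) ((whiskerLeft_caseMap _ _ _).trans ?_)
  exact congrArg₂ caseMap (Category.assoc _ _ _).symm (Category.assoc _ _ _).symm

theorem den_seq (dm : Deriv cty Γ₁ Q₁ m .one) (dn : Deriv cty Γ₂ Q₂ n D) :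
    X.den cst (.seq cs ls dm dn) =
      X.fullSplit i ls cs ≫ X.den cst dm ▷ _ ≫ (λ_ _).hom ≫ X.den cst dn := by
  refine (den_let_aux (X.split_fullIso i cs ls) (X.deriv i cst dm)
    ((λ_ _).hom ≫ X.deriv i cst dn)).trans ?_
  exact congrArg (fun k => _ ≫ _ ≫ k) (leftUnitor_naturality_assoc _ _)

theorem den_pair (dm : Deriv cty Γ₁ Q₁ m A) (dn : Deriv cty Γ₂ Q₂ n B) :
    X.den cst (.pair cs ls dm dn) =
      X.fullSplit i ls cs ≫ (X.den cst dm ⊗ₘ X.den cst dn) :=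
  den_tensor_aux (X.split_fullIso i cs ls) _ _

theorem den_letPair (dm : Deriv cty Γ₁ Q₁ m (.tensor A B))
    (dn : Deriv cty (some B :: some A :: Γ₂) Q₂ n D) :
    X.den cst (.letPair cs ls dm dn) =
      X.fullSplit i ls cs ≫ X.den cst dm ▷ _ ≫ (β_ (X.ty i A) (X.ty i B)).hom ▷ _ ≫
        (α_ _ _ _).hom ≫ X.den cst dn := by
  refine (den_let_aux (X.split_fullIso i cs ls) (X.deriv i cst dm)
    ((β_ (X.ty i A) (X.ty i B)).hom ▷ _ ≫ (α_ _ _ _).inv ≫ (α_ _ _ _).hom ▷ _ ≫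
      X.deriv i cst dn)).trans ?_
  exact congrArg (fun k => _ ≫ _ ≫ k) (den_letPair_aux _ _)

theorem den_lam (dm : Deriv cty (some A :: Γ) Q m B) :
    X.den cst (.lam dm) = MonoidalClosed.curry (X.den cst dm) := by
  refine (MonoidalClosed.curry_natural_left _ _).symm.trans ?_
  exact congrArg MonoidalClosed.curry (Category.assoc _ _ _).symm

theorem den_app (dm : Deriv cty Γ₁ Q₁ m (.lolli A B)) (dn : Deriv cty Γ₂ Q₂ n A) :
    X.den cst (.app cs ls dm dn) =
      X.fullSplit i ls cs ≫ (X.den cst dm ⊗ₘ X.den cst dn) ≫ (β_ _ _).hom ≫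
        (ihom.ev (X.ty i A)).app (X.ty i B) := by
  have := den_tensor_aux (X.split_fullIso i cs ls) (X.deriv i cst dm) (X.deriv i cst dn)
  have := this =≫ ((β_ _ _).hom ≫ (ihom.ev (X.ty i A)).app (X.ty i B))
  simp only [Category.assoc] at this
  exact this

theorem den_force (dm : Deriv cty Γ Q m (.bang A)) :
    X.den cst (.force dm) = X.den cst dm ≫ X.adj.counit.app _ :=
  (Category.assoc _ _ _).symm

theorem den_box (h : δ) {T U : MTy W}
    (dm : Deriv cty Γ Q m (.bang (.lolli (T.toTy h) (U.toTy h)))) :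
    X.den cst (.box h dm) =
      X.den cst dm ≫ X.bang.map (ihomMap (X.mtyIso i h T).inv (X.mtyIso i h U).hom) ≫
        X.F.map (X.homIso _ _).hom :=
  (Category.assoc _ _ _).symm

theorem den_apply (h : δ) {T U : MTy W} (dm : Deriv cty Γ₁ Q₁ m (.diag h T U))
    (dn : Deriv cty Γ₂ Q₂ n (T.toTy h)) :
    X.den cst (.apply h cs ls dm dn) =
      X.fullSplit i ls cs ≫ (X.den cst dm ⊗ₘ (X.den cst dn ≫ (X.mtyIso i h T).hom)) ≫
        ((X.F.map (X.homIso _ _).inv ≫ X.adj.counit.app _) ▷ _) ≫ (β_ _ _).hom ≫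
        (ihom.ev _).app _ ≫ (X.mtyIso i h U).inv := by
  have := den_tensor_aux (X.split_fullIso i cs ls) (X.deriv i cst dm)
    (X.deriv i cst dn ≫ (X.mtyIso i h T).hom)
  have := this =≫ (((X.F.map (X.homIso _ _).inv ≫ X.adj.counit.app _) ▷ _) ≫ (β_ _ _).hom ≫
        (ihom.ev _).app _ ≫ (X.mtyIso i h U).inv)
  simp only [Category.assoc] at this
  simp only [den, Category.assoc]
  exact this

theorem fullIso_inv_discard (hΓ : Γ.Intuit) :
    (X.fullIso i Γ (LCtx.empty W)).inv ≫ (ρ_ _).hom ≫ X.discard (X.ctxIso i Γ hΓ) =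
      X.proj i Γ hΓ (LCtx.empty W) := by
  exact (Iso.inv_comp_eq _).2 ((fullIso_inv_discard_aux _).symm.trans
    (X.fullIso_proj i Γ hΓ (LCtx.empty W)).symm)

theorem den_star (hΓ : Γ.Intuit) :
    X.den cst (.star hΓ) = X.proj i Γ hΓ (LCtx.empty W) :=
  X.fullIso_inv_discard hΓ

theorem den_const (hΓ : Γ.Intuit) (c : K) :
    X.den cst (.const hΓ c) = X.proj i Γ hΓ (LCtx.empty W) ≫ cst.val c := by
  exact comp_discard_aux (X.fullIso_inv_discard hΓ) _

theorem den_boxed (h : δ) (hΓ : Γ.Intuit) {Q Q' : LCtx W} {a b : LTuple}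
    {T U : MTy W} (da : LTyping Q a T) (S : Q.obj i ⟶ Q'.obj i) (db : LTyping Q' b U) :
    X.den cst (.boxed h hΓ da S db) = X.proj i Γ hΓ (LCtx.empty W) ≫ (εIso X.F).hom ≫
      X.F.map (X.psi ((da.iso (X.wire i)).inv ≫ X.diagram i S ≫ (db.iso (X.wire i)).hom)) := by
  exact comp_discard_aux (X.fullIso_inv_discard hΓ) _

theorem den_label (h : δ) (hΓ : Γ.Intuit) (l : ℕ) (α : W) :
    X.den cst (.label h hΓ l α) = X.proj i Γ hΓ (LCtx.single l α) ≫ (ρ_ (X.wire i α)).hom := by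
  exact (Iso.inv_comp_eq _).2 (den_label_aux (X.fullIso_proj i Γ hΓ (LCtx.single l α)))

theorem den_var {n : ℕ} (l : Lookup Γ n A) : X.den cst (.var l) = X.fullLookup i l := by
  rw [den, Iso.inv_comp_eq]
  change (ρ_ _).hom ≫ X.lookup i l = _
  induction l with
  | zero h => exact den_var_zero_aux (X.fullIso_proj i _ h _)
  | succ h l ih => exact den_var_succ_aux ih

/-- The comparison isomorphism, restricted to contexts without labels. -/
noncomputable def fullIso' (Γ : Ctx δ W) : X.full i Γ (LCtx.empty W) ≅ X.ctx i Γ :=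
  (X.fullIso i Γ (LCtx.empty W)).symm ≪≫ ρ_ _

/-- The comparison isomorphism is intuitionistic, and so it commutes with lifting and with the
interpretation of recursion. -/
theorem fullIso'_isIntuit (hΓ : Γ.Intuit) :
    X.IsIntuit (X.fullParamIso i Γ hΓ) (X.ctxIso i Γ hΓ) (X.fullIso' (i := i) Γ).hom := by
  refine ⟨𝟙 _, ?_⟩
  rw [ofV, CategoryTheory.Functor.map_id]
  exact fullIso'_aux (X.fullIso_fullParamIso i Γ hΓ)

theorem den_lift (hΓ : Γ.Intuit) (dm : Deriv cty Γ (LCtx.empty W) m A) :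
    X.den cst (.lift hΓ dm) = X.lift (X.fullParamIso i Γ hΓ) ≫ X.bang.map (X.den cst dm) := by
  exact den_lift_aux X.bang (X.fullIso'_isIntuit hΓ).comp_lift _

theorem den_fix (hΓ : Γ.Intuit) (dm : Deriv cty (some (.bang A) :: Γ) (LCtx.empty W) m A) :
    X.den cst (.fix hΓ dm) = X.gamma (X.fullParamIso i Γ hΓ) ≫
      X.sigma ((β_ _ _).hom ≫ X.den cst dm) := by
  have h := (X.fullIso'_isIntuit hΓ).comp_gamma_sigma
    ((β_ _ _).hom ≫ (ρ_ _).inv ≫ X.deriv i cst dm)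
  have h' : (X.fullIso' (i := i) Γ).hom ▷ _ ≫ (β_ _ _).hom ≫ (ρ_ _).inv ≫ X.deriv i cst dm =
      (β_ _ _).hom ≫ X.den cst dm := by
    rw [BraidedCategory.braiding_naturality_left_assoc]
    exact congrArg (fun k => (β_ _ _).hom ≫ k) (den_fix_aux _ _)
  exact ((Category.assoc _ _ _).symm.trans h).trans
    (congrArg (fun k => X.gamma (X.fullParamIso i Γ hΓ) ≫ X.sigma k) h')

end Equations

end Interp

end LNL

namespace LNL

/-! ### Substitution -/

section Syntactic

variable {δ : Prop} {K : Type k} {W : Type w} {M : Type u₃} [Category.{v₃} M]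
  [MonoidalCategory M] {i : W → M} {cty : K → Ty δ W}

theorem CSplit.length_left {Γ Γ₁ Γ₂ : Ctx δ W} (s : CSplit Γ Γ₁ Γ₂) : Γ₁.length = Γ.length := by
  induction s <;> simp_all

theorem CSplit.length_right {Γ Γ₁ Γ₂ : Ctx δ W} (s : CSplit Γ Γ₁ Γ₂) : Γ₂.length = Γ.length := by
  induction s <;> simp_all

theorem Lookup.lt {Γ : Ctx δ W} {n : ℕ} {A : Ty δ W} (l : Lookup Γ n A) : n < Γ.length := by
  induction l with
  | zero h => simp
  | succ h l ih => simpa using ih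

theorem upRen_eq {r : ℕ → ℕ} {N : ℕ} (h : ∀ n < N, r n = n) : ∀ n < N + 1, upRen r n = n := by
  intro n hn
  cases n with
  | zero => rfl
  | succ n => simp [upRen, h n (by omega)]

/-- A term typed in a context of length `n` is unchanged by a renaming that fixes the variables
below `n`. In particular closed terms are unchanged by all renamings. -/
theorem Deriv.rename_eq {Γ : Ctx δ W} {Q : LCtx W} {m : Term δ K i} {A : Ty δ W}
    (d : Deriv cty Γ Q m A) : ∀ {r : ℕ → ℕ}, (∀ n < Γ.length, r n = n) → m.rename r = m := by
  induction d with
  | var l => intro r h; simp [Term.rename, h _ l.lt]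
  | case cs ls dm dn dp ihm ihn ihp =>
    intro r h
    have h₁ := h
    have h₂ := h
    rw [← cs.length_left] at h₁
    rw [← cs.length_right] at h₂
    rw [Term.rename, ihm h₁, ihn (upRen_eq h₂), ihp (upRen_eq h₂)]
  | letIn cs ls dm dn ihm ihn | letPair cs ls dm dn ihm ihn =>
    intro r h
    have h₁ := h
    have h₂ := h
    rw [← cs.length_left] at h₁
    rw [← cs.length_right] at h₂
    first
    | rw [Term.rename, ihm h₁, ihn (upRen_eq h₂)]
    | rw [Term.rename, ihm h₁, ihn (upRen_eq (upRen_eq h₂))]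
  | seq cs ls dm dn ihm ihn | pair cs ls dm dn ihm ihn | app cs ls dm dn ihm ihn
  | apply h cs ls dm dn ihm ihn =>
    intro r h
    have h₁ := h
    have h₂ := h
    rw [← cs.length_left] at h₁
    rw [← cs.length_right] at h₂
    simp [Term.rename, ihm h₁, ihn h₂]
  | lam dm ihm | fix hΓ dm ihm =>
    intro r h
    simp [Term.rename, ihm (upRen_eq h)]
  | abort dm ihm | inl dm ihm | inr dm ihm | lift hΓ dm ihm | force dm ihm | box h' dm ihm =>
    intro r h
    simp [Term.rename, ihm h]
  | const hΓ c | star hΓ | label h hΓ l α | boxed h hΓ da S db => intros; rfl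

theorem upSubst_var : upSubst (Term.var : ℕ → Term δ K i) = Term.var := by
  funext n
  cases n <;> rfl

theorem Term.subst_var (m : Term δ K i) : m.subst Term.var = m := by
  induction m <;> simp_all [Term.subst, upSubst_var]

end Syntactic

section Auxiliary

variable {C : Type u₂} [Category.{v₂} C] [MonoidalCategory C] [SymmetricCategory C]

theorem subst_let_aux {H H₁ H₂ H' H₁' H₂' A D : C} {φ : H' ⟶ H} {k : H ⟶ H₁ ⊗ H₂}
    {k' : H' ⟶ H₁' ⊗ H₂'} {φ₁ : H₁' ⟶ H₁} {φ₂ : H₂' ⟶ H₂} (h : φ ≫ k = k' ≫ (φ₁ ⊗ₘ φ₂))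
    (m : H₁ ⟶ A) (n : A ⊗ H₂ ⟶ D) :
    k' ≫ (φ₁ ≫ m) ▷ _ ≫ A ◁ φ₂ ≫ n = φ ≫ k ≫ m ▷ _ ≫ n := by
  rw [reassoc_of% h, MonoidalCategory.tensorHom_def, Category.assoc, whisker_exchange_assoc,
    comp_whiskerRight_assoc]

theorem subst_tensor_aux {H H₁ H₂ H' H₁' H₂' A B : C} {φ : H' ⟶ H} {k : H ⟶ H₁ ⊗ H₂}
    {k' : H' ⟶ H₁' ⊗ H₂'} {φ₁ : H₁' ⟶ H₁} {φ₂ : H₂' ⟶ H₂} (h : φ ≫ k = k' ≫ (φ₁ ⊗ₘ φ₂))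
    (m : H₁ ⟶ A) (n : H₂ ⟶ B) :
    k' ≫ ((φ₁ ≫ m) ⊗ₘ (φ₂ ≫ n)) = φ ≫ k ≫ (m ⊗ₘ n) := by
  rw [reassoc_of% h, tensorHom_comp_tensorHom]

theorem subst_tensor_assoc_aux {H H₁ H₂ H' H₁' H₂' A B D : C} {φ : H' ⟶ H} {k : H ⟶ H₁ ⊗ H₂}
    {k' : H' ⟶ H₁' ⊗ H₂'} {φ₁ : H₁' ⟶ H₁} {φ₂ : H₂' ⟶ H₂} (h : φ ≫ k = k' ≫ (φ₁ ⊗ₘ φ₂))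
    (m : H₁ ⟶ A) (n : H₂ ⟶ B) (t : A ⊗ B ⟶ D) :
    k' ≫ ((φ₁ ≫ m) ⊗ₘ (φ₂ ≫ n)) ≫ t = φ ≫ k ≫ (m ⊗ₘ n) ≫ t := by
  rw [reassoc_of% h, tensorHom_comp_tensorHom_assoc]

theorem subst_letPair_aux {A B H H' D : C} (φ : H' ⟶ H) (n : B ⊗ A ⊗ H ⟶ D) :
    (β_ A B).hom ▷ _ ≫ (α_ _ _ _).hom ≫ B ◁ A ◁ φ ≫ n =
      (A ⊗ B) ◁ φ ≫ (β_ A B).hom ▷ _ ≫ (α_ _ _ _).hom ≫ n := by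
  rw [whisker_exchange_assoc]
  simp

theorem fullSplit_cons_aux {S S' S₁ S₂ S₁' S₂' H H₁ H₂ H' H₁' H₂' : C} {φ : H' ⟶ H}
    {k : H ⟶ H₁ ⊗ H₂} {k' : H' ⟶ H₁' ⊗ H₂'} {φ₁ : H₁' ⟶ H₁} {φ₂ : H₂' ⟶ H₂}
    (h : φ ≫ k = k' ≫ (φ₁ ⊗ₘ φ₂)) {t : S' ⟶ S} {t₁ : S₁' ⟶ S₁} {t₂ : S₂' ⟶ S₂}
    {σ : S ⟶ S₁ ⊗ S₂} {σ' : S' ⟶ S₁' ⊗ S₂'} (hσ : t ≫ σ = σ' ≫ (t₁ ⊗ₘ t₂)) :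
    (t ⊗ₘ φ) ≫ (σ ⊗ₘ k) ≫ tensorμ _ _ _ _ =
      ((σ' ⊗ₘ k') ≫ tensorμ _ _ _ _) ≫ ((t₁ ⊗ₘ φ₁) ⊗ₘ (t₂ ⊗ₘ φ₂)) := by
  rw [Category.assoc, ← tensorμ_natural, tensorHom_comp_tensorHom_assoc, h, hσ,
    tensorHom_comp_tensorHom_assoc]

theorem fullSplit_whisker_aux {S S₁ S₂ H H₁ H₂ H' H₁' H₂' : C} {φ : H' ⟶ H}
    {k : H ⟶ H₁ ⊗ H₂} {k' : H' ⟶ H₁' ⊗ H₂'} {φ₁ : H₁' ⟶ H₁} {φ₂ : H₂' ⟶ H₂}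
    (h : φ ≫ k = k' ≫ (φ₁ ⊗ₘ φ₂)) (σ : S ⟶ S₁ ⊗ S₂) :
    S ◁ φ ≫ (σ ⊗ₘ k) ≫ tensorμ _ _ _ _ =
      ((σ ⊗ₘ k') ≫ tensorμ _ _ _ _) ≫ (S₁ ◁ φ₁ ⊗ₘ S₂ ◁ φ₂) := by
  have := fullSplit_cons_aux h (t := 𝟙 S) (t₁ := 𝟙 S₁) (t₂ := 𝟙 S₂) (σ := σ) (σ' := σ) (by simp)
  simpa only [id_tensorHom] using this

theorem fullSplit_unitor_aux {S S₁ S₂ H' H₁ H₂ H H₁' H₂' : C} {k : H ⟶ H₁ ⊗ H₂}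
    {k' : H' ⟶ H₁' ⊗ H₂'} {φ : H' ⟶ H} {φ₁ : H₁' ⟶ H₁} {φ₂ : H₂' ⟶ H₂}
    (h : φ ≫ k = k' ≫ (φ₁ ⊗ₘ φ₂)) {t : S ⟶ 𝟙_ C} {t₁ : S₁ ⟶ 𝟙_ C} {t₂ : S₂ ⟶ 𝟙_ C}
    {σ : S ⟶ S₁ ⊗ S₂} (hσ : σ ≫ (t₁ ⊗ₘ t₂) ≫ (λ_ _).hom = t) :
    ((t ⊗ₘ φ) ≫ (λ_ _).hom) ≫ k =
      ((σ ⊗ₘ k') ≫ tensorμ _ _ _ _) ≫ (((t₁ ⊗ₘ φ₁) ≫ (λ_ _).hom) ⊗ₘ ((t₂ ⊗ₘ φ₂) ≫ (λ_ _).hom)) := by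
  have hσ' : t ≫ (λ_ (𝟙_ C)).inv = σ ≫ (t₁ ⊗ₘ t₂) := by rw [← hσ]; simp
  rw [← tensorHom_comp_tensorHom, ← Category.assoc (_ ≫ tensorμ _ _ _ _),
    ← fullSplit_cons_aux h hσ', Category.assoc, Category.assoc]
  congr 1
  exact (split_nil_aux k).symm

theorem subst_both_aux {Q Q₁ Q₂ A : C} {θ : 𝟙_ C ⟶ A} {c : A ⟶ A ⊗ A}
    (h : θ ≫ c = (λ_ _).inv ≫ (θ ⊗ₘ θ)) (k : Q ⟶ Q₁ ⊗ Q₂) :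
    ((λ_ Q).inv ≫ θ ▷ _) ≫ (c ⊗ₘ k) ≫ tensorμ _ _ _ _ =
      k ≫ (((λ_ _).inv ≫ θ ▷ _) ⊗ₘ ((λ_ _).inv ≫ θ ▷ _)) := by
  have h' := split_nil_aux k
  rw [← Iso.inv_comp_eq] at h'
  rw [← tensorHom_comp_tensorHom, ← reassoc_of% h', tensorHom_comp_tensorHom_assoc]
  simp only [Iso.hom_inv_id]
  simp only [← tensorHom_id, Category.assoc]
  rw [tensorHom_comp_tensorHom_assoc, Category.id_comp, h, id_tensorHom_id, Category.id_comp,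
    ← tensorμ_natural, tensorHom_comp_tensorHom_assoc]
  simp

theorem tensorμ_unit_left (A B D : C) :
    (α_ A B D).hom ≫ (ρ_ A).inv ▷ _ ≫ tensorμ _ _ _ _ = (A ⊗ B) ◁ (λ_ D).inv := by
  rw [tensorμ, braiding_tensorUnit_left]
  monoidal

theorem tensorμ_unit_right (A B D : C) :
    (α_ A D B).hom ≫ A ◁ (β_ D B).hom ≫ (λ_ A).inv ▷ _ ≫ tensorμ _ _ _ _ =
      (β_ _ _).hom ≫ (λ_ B).inv ▷ _ := by
  rw [tensorμ, BraidedCategory.braiding_tensor_left_hom]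
  monoidal

theorem subst_left_aux {Q' Q Q₁ Q₂ N P A : C} {θ : P ⟶ A} {l : Q' ⟶ P ⊗ Q} {k : Q ⟶ Q₁ ⊗ Q₂}
    {s : Q' ⟶ N ⊗ Q₂} {t : N ⟶ P ⊗ Q₁} (h : l ≫ P ◁ k = s ≫ t ▷ _ ≫ (α_ _ _ _).hom) :
    (l ≫ θ ▷ _) ≫ ((ρ_ A).inv ⊗ₘ k) ≫ tensorμ _ _ _ _ =
      s ≫ ((t ≫ θ ▷ _) ⊗ₘ (λ_ _).inv) := by
  rw [MonoidalCategory.tensorHom_def', Category.assoc, Category.assoc,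
    ← whisker_exchange_assoc, reassoc_of% h, ← associator_naturality_left_assoc,
    tensorμ_unit_left, MonoidalCategory.tensorHom_def, comp_whiskerRight_assoc]

theorem subst_right_aux {Q' Q Q₁ Q₂ N P A : C} {θ : P ⟶ A} {l : Q' ⟶ P ⊗ Q} {k : Q ⟶ Q₁ ⊗ Q₂}
    {s : Q' ⟶ N ⊗ Q₁} {t : N ⟶ P ⊗ Q₂}
    (h : l ≫ P ◁ (k ≫ (β_ _ _).hom) = s ≫ t ▷ _ ≫ (α_ _ _ _).hom) :
    (l ≫ θ ▷ _) ≫ ((λ_ A).inv ⊗ₘ k) ≫ tensorμ _ _ _ _ =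
      (s ≫ (β_ _ _).hom) ≫ ((λ_ _).inv ⊗ₘ (t ≫ θ ▷ _)) := by
  have h' : l ≫ P ◁ k = s ≫ t ▷ _ ≫ (α_ _ _ _).hom ≫ P ◁ (β_ _ _).hom := by
    have := h =≫ P ◁ (β_ _ _).hom
    simpa [← MonoidalCategory.whiskerLeft_comp] using this
  rw [MonoidalCategory.tensorHom_def', Category.assoc, Category.assoc,
    ← whisker_exchange_assoc, reassoc_of% h', whisker_exchange_assoc,
    ← associator_naturality_left_assoc, tensorμ_unit_right, MonoidalCategory.tensorHom_def',
    Category.assoc, ← BraidedCategory.braiding_naturality_left_assoc, comp_whiskerRight_assoc]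

theorem tensor_comp_unitor_aux {S H L A : C} (d : S ⟶ 𝟙_ C) (p : H ⟶ L) (θ : L ⟶ A) :
    ((d ⊗ₘ p) ≫ (λ_ _).hom) ≫ θ = (d ⊗ₘ (p ≫ θ)) ≫ (λ_ _).hom := by
  simp [MonoidalCategory.tensorHom_def]

theorem whiskerLeft_proj_aux {S H H' L : C} {φ : H' ⟶ H} {p : H ⟶ L} {p' : H' ⟶ L}
    (h : φ ≫ p = p') (d : S ⟶ 𝟙_ C) :
    S ◁ φ ≫ (d ⊗ₘ p) ≫ (λ_ _).hom = (d ⊗ₘ p') ≫ (λ_ _).hom := by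
  rw [← h, MonoidalCategory.tensorHom_def', MonoidalCategory.tensorHom_def',
    MonoidalCategory.whiskerLeft_comp, Category.assoc, Category.assoc, Category.assoc]

theorem whiskerLeft_lookup_aux {S H H' : C} {φ : H' ⟶ H} {p : H ⟶ 𝟙_ C} {p' : H' ⟶ 𝟙_ C}
    (h : φ ≫ p = p') : S ◁ φ ≫ S ◁ p ≫ (ρ_ _).hom = S ◁ p' ≫ (ρ_ _).hom := by
  rw [← h, MonoidalCategory.whiskerLeft_comp_assoc]

theorem whiskerLeft_lookup_aux' {S H H' L : C} (φ : H' ⟶ H) (p : H ⟶ L) (d : S ⟶ 𝟙_ C) :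
    S ◁ φ ≫ (d ⊗ₘ p) ≫ (λ_ _).hom = (d ⊗ₘ (φ ≫ p)) ≫ (λ_ _).hom :=
  whiskerLeft_proj_aux rfl d

end Auxiliary

namespace Interp

open Functor.Monoidal

variable {V : Type u₁} [Category.{v₁} V] [CartesianMonoidalCategory V] [BraidedCategory V]
  [MonoidalClosed V] [HasFiniteCoproducts V]
  {C : Type u₂} [Category.{v₂} C] [MonoidalCategory C] [SymmetricCategory C]
  [MonoidalClosed C] [HasFiniteCoproducts C]
  {M : Type u₃} [Category.{v₃} M] [MonoidalCategory M] [SymmetricCategory M]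
  {X : Interp V C M} {δ : Prop} {K : Type k} {W : Type w} {i : W → M}

theorem IsIntuit.leftUnitor_inv {P : C} {Y : V} {e : P ≅ X.F.obj Y} :
    X.IsIntuit e (X.prodIso (εIso X.F) e) (λ_ P).inv := by
  refine ⟨(λ_ Y).inv, ?_⟩
  rw [← cancel_mono (λ_ P).hom, Iso.inv_hom_id, ← ofV_leftUnitor e, ofV_comp, Iso.inv_hom_id,
    ofV_id]

variable {cty : K → Ty δ W} (cst : X.Constants i cty)

/-- The possible terms substituted for a variable, with their interpretations: a variable, or a
closed term that can be typed, with the same interpretation, in every intuitionistic context. -/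
inductive VarImage : (t : Term δ K i) → (Γ : Ctx δ W) → (Q : LCtx W) → (A : Ty δ W) →
    (X.full i Γ Q ⟶ X.ty i A) → Prop
  | var {Γ : Ctx δ W} {n : ℕ} {A : Ty δ W} (l : Lookup Γ n A) :
      VarImage (.var n) Γ (LCtx.empty W) A (X.fullLookup i l)
  | closed {v : Term δ K i} {Q : LCtx W} {A : Ty δ W} (θ : X.lctx i Q ⟶ X.ty i A)
      (hv : ∀ r, v.rename r = v)
      (hθ : ∀ (Γ : Ctx δ W) (h : Γ.Intuit), ∃ d : Deriv cty Γ Q v A,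
        X.den cst d = X.proj i Γ h Q ≫ θ) {Γ : Ctx δ W} (h : Γ.Intuit) :
      VarImage v Γ Q A (X.proj i Γ h Q ≫ θ)

variable {cst}

theorem VarImage.exists_deriv {t : Term δ K i} {Γ : Ctx δ W} {Q : LCtx W} {A : Ty δ W}
    {ψ : X.full i Γ Q ⟶ X.ty i A} (h : VarImage cst t Γ Q A ψ) :
    ∃ d : Deriv cty Γ Q t A, X.den cst d = ψ := by
  cases h with
  | var l => exact ⟨.var l, X.den_var cst l⟩
  | closed θ hv hθ h => exact hθ Γ h

theorem VarImage.of_eq {t : Term δ K i} {Γ : Ctx δ W} {Q : LCtx W} {A : Ty δ W}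
    {ψ ψ' : X.full i Γ Q ⟶ X.ty i A} (h : VarImage cst t Γ Q A ψ) (e : ψ' = ψ) :
    VarImage cst t Γ Q A ψ' := e ▸ h

/-- The image of a variable is still one after extending the context by an unused variable. -/
theorem VarImage.succ {t : Term δ K i} {Γ : Ctx δ W} {Q : LCtx W} {A : Ty δ W}
    {ψ : X.full i Γ Q ⟶ X.ty i A} (h : VarImage cst t Γ Q A ψ) {o : Option (Ty δ W)}
    (ho : SlotIntuit o) : VarImage cst (t.rename Nat.succ) (o :: Γ) Q A
      ((X.discard (X.slotIso i o ho) ⊗ₘ ψ) ≫ (λ_ _).hom) := by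
  cases h with
  | var l => exact .var (.succ ho l)
  | closed θ hv hθ h =>
    rw [hv]
    exact (VarImage.closed θ hv hθ (Γ := o :: Γ) ⟨ho, h⟩).of_eq (tensor_comp_unitor_aux _ _ _).symm

/-- A relation between contexts `Γ'; Q'`, contexts `Γ; Q` and morphisms between their
interpretations. -/
abbrev CtxRel (X : Interp V C M) (δ : Prop) {W : Type w} (i : W → M) :=
  (Γ' : Ctx δ W) → (Q' : LCtx W) → (Γ : Ctx δ W) → (Q : LCtx W) →
    (X.full i Γ' Q' ⟶ X.full i Γ Q) → Prop

/-- The closure of a relation under extending both contexts by a variable, with the corresponding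
extension of a substitution: what happens when a substitution passes under a binder. -/
inductive Extend (B : CtxRel X δ i) (s₀ : ℕ → Term δ K i) : (s : ℕ → Term δ K i) →
    (Γ' : Ctx δ W) → (Q' : LCtx W) → (Γ : Ctx δ W) → (Q : LCtx W) →
    (X.full i Γ' Q' ⟶ X.full i Γ Q) → Prop
  | base {Γ' Γ : Ctx δ W} {Q' Q : LCtx W} {φ : X.full i Γ' Q' ⟶ X.full i Γ Q}
      (h : B Γ' Q' Γ Q φ) : Extend B s₀ s₀ Γ' Q' Γ Q φ
  | cons (o : Option (Ty δ W)) {s : ℕ → Term δ K i} {Γ' Γ : Ctx δ W} {Q' Q : LCtx W}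
      {φ : X.full i Γ' Q' ⟶ X.full i Γ Q} (h : Extend B s₀ s Γ' Q' Γ Q φ) :
      Extend B s₀ (upSubst s) (o :: Γ') Q' (o :: Γ) Q (X.slot i o ◁ φ)

variable (cst) in
/-- The conditions under which the morphisms of a relation interpret a substitution: they are
compatible with splitting contexts, with discarding intuitionistic contexts, with the `F`-structure
of intuitionistic contexts, and with variables. -/
structure IsSubstRel (B : CtxRel X δ i) (s₀ : ℕ → Term δ K i) : Prop where
  split {Γ' Γ Γ₁ Γ₂ : Ctx δ W} {Q' Q Q₁ Q₂ : LCtx W} {φ : X.full i Γ' Q' ⟶ X.full i Γ Q}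
    (h : B Γ' Q' Γ Q φ) (cs : CSplit Γ Γ₁ Γ₂) (ls : LSplit Q Q₁ Q₂) :
    ∃ (Γ₁' Γ₂' : Ctx δ W) (Q₁' Q₂' : LCtx W) (cs' : CSplit Γ' Γ₁' Γ₂') (ls' : LSplit Q' Q₁' Q₂')
      (φ₁ : X.full i Γ₁' Q₁' ⟶ X.full i Γ₁ Q₁) (φ₂ : X.full i Γ₂' Q₂' ⟶ X.full i Γ₂ Q₂),
      B Γ₁' Q₁' Γ₁ Q₁ φ₁ ∧ B Γ₂' Q₂' Γ₂ Q₂ φ₂ ∧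
        φ ≫ X.fullSplit i ls cs = X.fullSplit i ls' cs' ≫ (φ₁ ⊗ₘ φ₂)
  intuit {Γ' Γ : Ctx δ W} {Q' Q : LCtx W} {φ : X.full i Γ' Q' ⟶ X.full i Γ Q}
    (h : B Γ' Q' Γ Q φ) (hΓ : Γ.Intuit) : Γ'.Intuit ∧ Q' = Q
  comp_proj {Γ' Γ : Ctx δ W} {Q : LCtx W} {φ : X.full i Γ' Q ⟶ X.full i Γ Q}
    (h : B Γ' Q Γ Q φ) (hΓ : Γ.Intuit) (hΓ' : Γ'.Intuit) :
    φ ≫ X.proj i Γ hΓ Q = X.proj i Γ' hΓ' Q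
  isIntuit {Γ' Γ : Ctx δ W}
    {φ : X.full i Γ' (LCtx.empty W) ⟶ X.full i Γ (LCtx.empty W)}
    (h : B Γ' (LCtx.empty W) Γ (LCtx.empty W) φ) (hΓ : Γ.Intuit) (hΓ' : Γ'.Intuit) :
    X.IsIntuit (X.fullParamIso i Γ' hΓ') (X.fullParamIso i Γ hΓ) φ
  var {Γ' Γ : Ctx δ W} {Q' : LCtx W} {φ : X.full i Γ' Q' ⟶ X.full i Γ (LCtx.empty W)}
    (h : B Γ' Q' Γ (LCtx.empty W) φ) {n : ℕ} {A : Ty δ W} (l : Lookup Γ n A) :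
    VarImage cst (s₀ n) Γ' Q' A (φ ≫ X.fullLookup i l)

namespace Extend

variable {B : CtxRel X δ i} {s₀ s : ℕ → Term δ K i}

theorem split (hB : IsSubstRel cst B s₀) {Γ' Γ Γ₁ Γ₂ : Ctx δ W} {Q' Q Q₁ Q₂ : LCtx W}
    {φ : X.full i Γ' Q' ⟶ X.full i Γ Q} (h : Extend B s₀ s Γ' Q' Γ Q φ) (cs : CSplit Γ Γ₁ Γ₂)
    (ls : LSplit Q Q₁ Q₂) :
    ∃ (Γ₁' Γ₂' : Ctx δ W) (Q₁' Q₂' : LCtx W) (cs' : CSplit Γ' Γ₁' Γ₂') (ls' : LSplit Q' Q₁' Q₂')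
      (φ₁ : X.full i Γ₁' Q₁' ⟶ X.full i Γ₁ Q₁) (φ₂ : X.full i Γ₂' Q₂' ⟶ X.full i Γ₂ Q₂),
      Extend B s₀ s Γ₁' Q₁' Γ₁ Q₁ φ₁ ∧ Extend B s₀ s Γ₂' Q₂' Γ₂ Q₂ φ₂ ∧
        φ ≫ X.fullSplit i ls cs = X.fullSplit i ls' cs' ≫ (φ₁ ⊗ₘ φ₂) := by
  induction h generalizing Γ₁ Γ₂ with
  | base h =>
    obtain ⟨Γ₁', Γ₂', Q₁', Q₂', cs', ls', φ₁, φ₂, h₁, h₂, e⟩ := hB.split h cs ls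
    exact ⟨Γ₁', Γ₂', Q₁', Q₂', cs', ls', φ₁, φ₂, .base h₁, .base h₂, e⟩
  | cons o h ih =>
    cases cs with
    | none cs =>
      obtain ⟨Γ₁', Γ₂', Q₁', Q₂', cs', ls', φ₁, φ₂, h₁, h₂, e⟩ := ih cs ls
      exact ⟨_, _, _, _, .none cs', ls', _, _, .cons _ h₁, .cons _ h₂, fullSplit_whisker_aux e _⟩
    | both hP cs =>
      obtain ⟨Γ₁', Γ₂', Q₁', Q₂', cs', ls', φ₁, φ₂, h₁, h₂, e⟩ := ih cs ls
      exact ⟨_, _, _, _, .both hP cs', ls', _, _, .cons _ h₁, .cons _ h₂,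
        fullSplit_whisker_aux e _⟩
    | left cs =>
      obtain ⟨Γ₁', Γ₂', Q₁', Q₂', cs', ls', φ₁, φ₂, h₁, h₂, e⟩ := ih cs ls
      exact ⟨_, _, _, _, .left cs', ls', _, _, .cons _ h₁, .cons _ h₂, fullSplit_whisker_aux e _⟩
    | right cs =>
      obtain ⟨Γ₁', Γ₂', Q₁', Q₂', cs', ls', φ₁, φ₂, h₁, h₂, e⟩ := ih cs ls
      exact ⟨_, _, _, _, .right cs', ls', _, _, .cons _ h₁, .cons _ h₂,
        fullSplit_whisker_aux e _⟩

theorem intuit (hB : IsSubstRel cst B s₀) {Γ' Γ : Ctx δ W} {Q' Q : LCtx W}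
    {φ : X.full i Γ' Q' ⟶ X.full i Γ Q}
    (h : Extend B s₀ s Γ' Q' Γ Q φ) (hΓ : Γ.Intuit) : Γ'.Intuit ∧ Q' = Q := by
  induction h with
  | base h => exact hB.intuit h hΓ
  | cons o h ih => exact ⟨⟨hΓ.1, (ih hΓ.2).1⟩, (ih hΓ.2).2⟩

/-- The label contexts are related by an equation and not identified, so that the proof can be by
induction. -/
theorem comp_proj (hB : IsSubstRel cst B s₀) {Γ' Γ : Ctx δ W} {Q' Q : LCtx W}
    {φ : X.full i Γ' Q' ⟶ X.full i Γ Q}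
    (h : Extend B s₀ s Γ' Q' Γ Q φ) (e : Q = Q') (hΓ : Γ.Intuit) (hΓ' : Γ'.Intuit) :
    φ ≫ X.proj i Γ hΓ Q = X.proj i Γ' hΓ' Q' ≫ eqToHom (by rw [e]) := by
  induction h with
  | base h => subst e; simpa using hB.comp_proj h hΓ hΓ'
  | cons o h ih =>
    subst e
    have := ih rfl hΓ.2 hΓ'.2
    rw [eqToHom_refl, Category.comp_id] at this ⊢
    exact whiskerLeft_proj_aux this _

theorem isIntuit (hB : IsSubstRel cst B s₀) {Γ' Γ : Ctx δ W} {Q' Q : LCtx W}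
    {φ : X.full i Γ' Q' ⟶ X.full i Γ Q}
    (h : Extend B s₀ s Γ' Q' Γ Q φ) (e' : Q' = LCtx.empty W) (e : Q = LCtx.empty W)
    (hΓ : Γ.Intuit) (hΓ' : Γ'.Intuit) :
    X.IsIntuit (eqToIso (by rw [e']) ≪≫ X.fullParamIso i Γ' hΓ')
      (eqToIso (by rw [e]) ≪≫ X.fullParamIso i Γ hΓ) φ := by
  induction h with
  | base h =>
    subst e e'
    simpa using hB.isIntuit h hΓ hΓ'
  | cons o h ih =>
    subst e e'
    have := ih rfl rfl hΓ.2 hΓ'.2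
    simp only [eqToIso_refl, Iso.refl_trans] at this ⊢
    rw [← id_tensorHom]
    exact IsIntuit.tensor IsIntuit.id this

theorem var (hB : IsSubstRel cst B s₀) {Γ' Γ : Ctx δ W} {Q' Q : LCtx W}
    {φ : X.full i Γ' Q' ⟶ X.full i Γ Q}
    (h : Extend B s₀ s Γ' Q' Γ Q φ) (e : Q = LCtx.empty W) {n : ℕ} {A : Ty δ W}
    (l : Lookup Γ n A) :
    VarImage cst (s n) Γ' Q' A (φ ≫ eqToHom (by rw [e]) ≫ X.fullLookup i l) := by
  induction h generalizing n with
  | base h =>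
    subst e
    simpa using hB.var h l
  | cons o h ih =>
    subst e
    cases l with
    | zero hΓ =>
      obtain ⟨hΓ', rfl⟩ := h.intuit hB hΓ
      have e := h.comp_proj hB rfl hΓ hΓ'
      rw [eqToHom_refl, Category.comp_id] at e
      rw [eqToHom_refl, Category.id_comp]
      exact (VarImage.var (Lookup.zero hΓ')).of_eq (whiskerLeft_lookup_aux e)
    | succ ho l =>
      have := (ih rfl l).succ ho
      rw [eqToHom_refl, Category.id_comp] at this ⊢
      exact this.of_eq (whiskerLeft_lookup_aux' _ _ _)

/-- The substitution theorem, for the substitutions interpreted by the morphisms of a relation.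
Substitution under `lift` and `rec` is where intuitionistic morphisms are needed: the interpretation
of these terms is natural in the context only along such morphisms. -/
theorem exists_deriv (hB : IsSubstRel cst B s₀) {Γ : Ctx δ W} {Q : LCtx W} {m : Term δ K i}
    {A : Ty δ W} (d : Deriv cty Γ Q m A) : ∀ {s : ℕ → Term δ K i} {Γ' : Ctx δ W} {Q' : LCtx W}
    {φ : X.full i Γ' Q' ⟶ X.full i Γ Q}, Extend B s₀ s Γ' Q' Γ Q φ →
      ∃ d' : Deriv cty Γ' Q' (m.subst s) A, X.den cst d' = φ ≫ X.den cst d := by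
  induction d with
  | var l =>
    intro s Γ' Q' φ h
    dsimp only [Term.subst]
    have := h.var hB rfl l
    rw [eqToHom_refl, Category.id_comp] at this
    rw [den_var]
    exact this.exists_deriv
  | const hΓ c =>
    intro s Γ' Q' φ h
    dsimp only [Term.subst]
    obtain ⟨hΓ', rfl⟩ := h.intuit hB hΓ
    have e := h.comp_proj hB rfl hΓ hΓ'
    rw [eqToHom_refl, Category.comp_id] at e
    refine ⟨.const hΓ' c, ?_⟩
    rw [den_const, den_const, ← e]
    exact Category.assoc _ _ _
  | letIn cs ls dm dn ihm ihn =>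
    intro s Γ' Q' φ h
    dsimp only [Term.subst]
    obtain ⟨Γ₁', Γ₂', Q₁', Q₂', cs', ls', φ₁, φ₂, h₁, h₂, e⟩ := h.split hB cs ls
    obtain ⟨dm', em⟩ := ihm h₁
    obtain ⟨dn', en⟩ := ihn (.cons _ h₂)
    refine ⟨.letIn cs' ls' dm' dn', ?_⟩
    rw [den_letIn, den_letIn, em, en]
    exact subst_let_aux e _ _
  | abort dm ihm =>
    intro s Γ' Q' φ h
    dsimp only [Term.subst]
    obtain ⟨dm', em⟩ := ihm h
    exact ⟨.abort dm', by rw [den_abort, den_abort, em]; exact Category.assoc _ _ _⟩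
  | inl dm ihm =>
    intro s Γ' Q' φ h
    dsimp only [Term.subst]
    obtain ⟨dm', em⟩ := ihm h
    exact ⟨.inl dm', by rw [den_inl, den_inl, em]; exact Category.assoc _ _ _⟩
  | inr dm ihm =>
    intro s Γ' Q' φ h
    dsimp only [Term.subst]
    obtain ⟨dm', em⟩ := ihm h
    exact ⟨.inr dm', by rw [den_inr, den_inr, em]; exact Category.assoc _ _ _⟩
  | case cs ls dm dn dp ihm ihn ihp =>
    intro s Γ' Q' φ h
    dsimp only [Term.subst]
    obtain ⟨Γ₁', Γ₂', Q₁', Q₂', cs', ls', φ₁, φ₂, h₁, h₂, e⟩ := h.split hB cs ls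
    obtain ⟨dm', em⟩ := ihm h₁
    obtain ⟨dn', en⟩ := ihn (.cons _ h₂)
    obtain ⟨dp', ep⟩ := ihp (.cons _ h₂)
    refine ⟨.case cs' ls' dm' dn' dp', ?_⟩
    rw [den_case, den_case, em, en, ep]
    refine Eq.trans ?_ (subst_let_aux e _ _)
    exact congrArg (fun k => _ ≫ _ ≫ k) (whiskerLeft_caseMap _ _ _).symm
  | star hΓ =>
    intro s Γ' Q' φ h
    dsimp only [Term.subst]
    obtain ⟨hΓ', rfl⟩ := h.intuit hB hΓ
    have e := h.comp_proj hB rfl hΓ hΓ'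
    rw [eqToHom_refl, Category.comp_id] at e
    refine ⟨.star hΓ', ?_⟩
    rw [den_star, den_star]
    exact e.symm
  | seq cs ls dm dn ihm ihn =>
    intro s Γ' Q' φ h
    dsimp only [Term.subst]
    obtain ⟨Γ₁', Γ₂', Q₁', Q₂', cs', ls', φ₁, φ₂, h₁, h₂, e⟩ := h.split hB cs ls
    obtain ⟨dm', em⟩ := ihm h₁
    obtain ⟨dn', en⟩ := ihn h₂
    refine ⟨.seq cs' ls' dm' dn', ?_⟩
    rw [den_seq, den_seq, em, en]
    refine Eq.trans ?_ (subst_let_aux e _ _)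
    exact congrArg (fun k => _ ≫ _ ≫ k) (leftUnitor_naturality_assoc _ _).symm
  | pair cs ls dm dn ihm ihn =>
    intro s Γ' Q' φ h
    dsimp only [Term.subst]
    obtain ⟨Γ₁', Γ₂', Q₁', Q₂', cs', ls', φ₁, φ₂, h₁, h₂, e⟩ := h.split hB cs ls
    obtain ⟨dm', em⟩ := ihm h₁
    obtain ⟨dn', en⟩ := ihn h₂
    refine ⟨.pair cs' ls' dm' dn', ?_⟩
    rw [den_pair, den_pair, em, en]
    exact subst_tensor_aux e _ _
  | letPair cs ls dm dn ihm ihn =>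
    intro s Γ' Q' φ h
    dsimp only [Term.subst]
    obtain ⟨Γ₁', Γ₂', Q₁', Q₂', cs', ls', φ₁, φ₂, h₁, h₂, e⟩ := h.split hB cs ls
    obtain ⟨dm', em⟩ := ihm h₁
    obtain ⟨dn', en⟩ := ihn (.cons _ (.cons _ h₂))
    refine ⟨.letPair cs' ls' dm' dn', ?_⟩
    rw [den_letPair, den_letPair, em, en]
    refine Eq.trans ?_ (subst_let_aux e _ _)
    exact congrArg (fun k => _ ≫ _ ≫ k) (subst_letPair_aux _ _)
  | lam dm ihm =>
    intro s Γ' Q' φ h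
    dsimp only [Term.subst]
    obtain ⟨dm', em⟩ := ihm (.cons _ h)
    refine ⟨.lam dm', ?_⟩
    rw [den_lam, den_lam, em]
    exact MonoidalClosed.curry_natural_left _ _
  | app cs ls dm dn ihm ihn =>
    intro s Γ' Q' φ h
    dsimp only [Term.subst]
    obtain ⟨Γ₁', Γ₂', Q₁', Q₂', cs', ls', φ₁, φ₂, h₁, h₂, e⟩ := h.split hB cs ls
    obtain ⟨dm', em⟩ := ihm h₁
    obtain ⟨dn', en⟩ := ihn h₂
    refine ⟨.app cs' ls' dm' dn', ?_⟩
    rw [den_app, den_app, em, en]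
    exact subst_tensor_assoc_aux e _ _ _
  | lift hΓ dm ihm =>
    intro s Γ' Q' φ h
    dsimp only [Term.subst]
    obtain ⟨hΓ', rfl⟩ := h.intuit hB hΓ
    obtain ⟨dm', em⟩ := ihm h
    have hi := h.isIntuit hB rfl rfl hΓ hΓ'
    simp only [eqToIso_refl, Iso.refl_trans] at hi
    refine ⟨.lift hΓ' dm', ?_⟩
    rw [den_lift, den_lift, em, Functor.map_comp]
    exact (Category.assoc _ _ _).symm.trans ((hi.comp_lift.symm =≫ _).trans (Category.assoc _ _ _))
  | force dm ihm =>
    intro s Γ' Q' φ h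
    dsimp only [Term.subst]
    obtain ⟨dm', em⟩ := ihm h
    exact ⟨.force dm', by rw [den_force, den_force, em]; exact Category.assoc _ _ _⟩
  | fix hΓ dm ihm =>
    intro s Γ' Q' φ h
    dsimp only [Term.subst]
    obtain ⟨hΓ', rfl⟩ := h.intuit hB hΓ
    obtain ⟨dm', em⟩ := ihm (.cons _ h)
    have hi := h.isIntuit hB rfl rfl hΓ hΓ'
    simp only [eqToIso_refl, Iso.refl_trans] at hi
    refine ⟨.fix hΓ' dm', ?_⟩
    rw [den_fix, den_fix, em, hi.comp_gamma_sigma]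
    refine congrArg (fun k => X.gamma (X.fullParamIso i Γ' hΓ') ≫ X.sigma k) ?_
    exact (BraidedCategory.braiding_naturality_left_assoc _ _ _).symm
  | label h' hΓ l α =>
    intro s Γ' Q' φ h
    dsimp only [Term.subst]
    obtain ⟨hΓ', rfl⟩ := h.intuit hB hΓ
    have e := h.comp_proj hB rfl hΓ hΓ'
    rw [eqToHom_refl, Category.comp_id] at e
    refine ⟨.label h' hΓ' l α, ?_⟩
    rw [den_label, den_label, ← e]
    exact Category.assoc _ _ _
  | box h' dm ihm =>
    intro s Γ' Q' φ h
    dsimp only [Term.subst]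
    obtain ⟨dm', em⟩ := ihm h
    exact ⟨.box h' dm', by rw [den_box, den_box, em]; exact Category.assoc _ _ _⟩
  | apply h' cs ls dm dn ihm ihn =>
    intro s Γ' Q' φ h
    dsimp only [Term.subst]
    obtain ⟨Γ₁', Γ₂', Q₁', Q₂', cs', ls', φ₁, φ₂, h₁, h₂, e⟩ := h.split hB cs ls
    obtain ⟨dm', em⟩ := ihm h₁
    obtain ⟨dn', en⟩ := ihn h₂
    refine ⟨.apply h' cs' ls' dm' dn', ?_⟩
    rw [den_apply, den_apply, em, en, Category.assoc]
    exact subst_tensor_assoc_aux e _ _ _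
  | boxed h' hΓ da S db =>
    intro s Γ' Q' φ h
    dsimp only [Term.subst]
    obtain ⟨hΓ', rfl⟩ := h.intuit hB hΓ
    have e := h.comp_proj hB rfl hΓ hΓ'
    rw [eqToHom_refl, Category.comp_id] at e
    refine ⟨.boxed h' hΓ' da S db, ?_⟩
    rw [den_boxed, den_boxed, ← e]
    exact Category.assoc _ _ _

end Extend

end Interp

end LNL

namespace LNL

/-! ### Weakening and substitution of closed terms -/

section Auxiliary

variable {C : Type u₂} [Category.{v₂} C] [MonoidalCategory C] [SymmetricCategory C]

theorem subst_none_aux {H H₁ H₂ H' H₁' H₂' : C} {φ : H' ⟶ H} {k : H ⟶ H₁ ⊗ H₂}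
    {k' : H' ⟶ H₁' ⊗ H₂'} {φ₁ : H₁' ⟶ H₁} {φ₂ : H₂' ⟶ H₂} (h : φ ≫ k = k' ≫ (φ₁ ⊗ₘ φ₂)) :
    (φ ≫ (λ_ _).inv) ≫ ((λ_ _).inv ⊗ₘ k) ≫ tensorμ _ _ _ _ =
      k' ≫ ((φ₁ ≫ (λ_ _).inv) ⊗ₘ (φ₂ ≫ (λ_ _).inv)) := by
  have e := split_nil_aux k
  rw [← Iso.inv_comp_eq] at e
  have e' : ((λ_ (𝟙_ C)).inv ⊗ₘ k) ≫ tensorμ _ _ _ _ =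
      (λ_ _).hom ≫ k ≫ ((λ_ _).inv ⊗ₘ (λ_ _).inv) := by
    rw [← Iso.inv_comp_eq]
    nth_rewrite 2 [← e]
    simp [tensorHom_comp_tensorHom]
  rw [e', ← tensorHom_comp_tensorHom, ← reassoc_of% h, Category.assoc, Iso.inv_hom_id_assoc]

theorem subst_some_aux {N N₁ N₂ H H₁ H₂ A A₁ A₂ R Q' : C} {φ : N ⟶ H} {k : H ⟶ H₁ ⊗ H₂}
    {k' : N ⟶ N₁ ⊗ N₂} {φ₁ : N₁ ⟶ H₁} {φ₂ : N₂ ⟶ H₂} (h : φ ≫ k = k' ≫ (φ₁ ⊗ₘ φ₂))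
    {σ : A ⟶ A₁ ⊗ A₂} {l : Q' ⟶ R ⊗ N} {θ : R ⟶ A} {z : Q' ⟶ (A₁ ⊗ N₁) ⊗ (A₂ ⊗ N₂)}
    (hz : (l ≫ θ ▷ _) ≫ (σ ⊗ₘ k') ≫ tensorμ _ _ _ _ = z) :
    (l ≫ θ ▷ _ ≫ A ◁ φ) ≫ (σ ⊗ₘ k) ≫ tensorμ _ _ _ _ =
      z ≫ (A₁ ◁ φ₁ ⊗ₘ A₂ ◁ φ₂) := by
  rw [← hz, Category.assoc, Category.assoc, fullSplit_whisker_aux h]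
  simp only [Category.assoc]

theorem subst_both_aux' {N N₁ N₂ H H₁ H₂ A : C} {φ : N ⟶ H} {k : H ⟶ H₁ ⊗ H₂}
    {k' : N ⟶ N₁ ⊗ N₂} {φ₁ : N₁ ⟶ H₁} {φ₂ : N₂ ⟶ H₂} {θ : 𝟙_ C ⟶ A} {c : A ⟶ A ⊗ A}
    (hc : θ ≫ c = (λ_ _).inv ≫ (θ ⊗ₘ θ)) (h : φ ≫ k = k' ≫ (φ₁ ⊗ₘ φ₂)) :
    ((λ_ N).inv ≫ θ ▷ _ ≫ A ◁ φ) ≫ (c ⊗ₘ k) ≫ tensorμ _ _ _ _ =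
      k' ≫ (((λ_ _).inv ≫ θ ▷ _ ≫ A ◁ φ₁) ⊗ₘ ((λ_ _).inv ≫ θ ▷ _ ≫ A ◁ φ₂)) := by
  rw [subst_some_aux h (subst_both_aux hc k'), Category.assoc, tensorHom_comp_tensorHom]
  simp only [Category.assoc]

theorem subst_left_aux' {Q' N N₁ N₂ H H₁ H₂ R P A : C} {φ : N ⟶ H} {k : H ⟶ H₁ ⊗ H₂}
    {k' : N ⟶ N₁ ⊗ N₂} {φ₁ : N₁ ⟶ H₁} {φ₂ : N₂ ⟶ H₂} {θ : P ⟶ A} {l : Q' ⟶ P ⊗ N}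
    {s : Q' ⟶ R ⊗ N₂} {t : R ⟶ P ⊗ N₁} (hs : l ≫ P ◁ k' = s ≫ t ▷ _ ≫ (α_ _ _ _).hom)
    (h : φ ≫ k = k' ≫ (φ₁ ⊗ₘ φ₂)) :
    (l ≫ θ ▷ _ ≫ A ◁ φ) ≫ ((ρ_ A).inv ⊗ₘ k) ≫ tensorμ _ _ _ _ =
      s ≫ ((t ≫ θ ▷ _ ≫ A ◁ φ₁) ⊗ₘ (φ₂ ≫ (λ_ _).inv)) := by
  rw [subst_some_aux h (subst_left_aux hs), Category.assoc, tensorHom_comp_tensorHom,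
    leftUnitor_inv_naturality]
  simp only [Category.assoc]

theorem subst_right_aux' {Q' N N₁ N₂ H H₁ H₂ R P A : C} {φ : N ⟶ H} {k : H ⟶ H₁ ⊗ H₂}
    {k' : N ⟶ N₁ ⊗ N₂} {φ₁ : N₁ ⟶ H₁} {φ₂ : N₂ ⟶ H₂} {θ : P ⟶ A} {l : Q' ⟶ P ⊗ N}
    {s : Q' ⟶ R ⊗ N₁} {t : R ⟶ P ⊗ N₂}
    (hs : l ≫ P ◁ (k' ≫ (β_ _ _).hom) = s ≫ t ▷ _ ≫ (α_ _ _ _).hom)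
    (h : φ ≫ k = k' ≫ (φ₁ ⊗ₘ φ₂)) :
    (l ≫ θ ▷ _ ≫ A ◁ φ) ≫ ((λ_ A).inv ⊗ₘ k) ≫ tensorμ _ _ _ _ =
      (s ≫ (β_ _ _).hom) ≫ ((φ₁ ≫ (λ_ _).inv) ⊗ₘ (t ≫ θ ▷ _ ≫ A ◁ φ₂)) := by
  rw [subst_some_aux h (subst_right_aux hs), Category.assoc, tensorHom_comp_tensorHom,
    leftUnitor_inv_naturality]
  simp only [Category.assoc]

theorem subst_none_proj_aux {N H L : C} {φ : N ⟶ H} {p : H ⟶ L} {q : N ⟶ L} {d : 𝟙_ C ⟶ 𝟙_ C}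
    (hd : d = 𝟙 _) (h : φ ≫ p = q) : (φ ≫ (λ_ _).inv) ≫ (d ⊗ₘ p) ≫ (λ_ _).hom = q := by
  subst hd h
  simp

theorem subst_some_proj_aux {N H L A : C} {φ : N ⟶ H} {p : H ⟶ L} {q : N ⟶ L} {θ : 𝟙_ C ⟶ A}
    {d : A ⟶ 𝟙_ C} (hd : θ ≫ d = 𝟙 _) (h : φ ≫ p = q) :
    ((λ_ _).inv ≫ θ ▷ _ ≫ A ◁ φ) ≫ (d ⊗ₘ p) ≫ (λ_ _).hom = q := by
  have : (θ ▷ N ≫ A ◁ φ) ≫ (d ⊗ₘ p) = 𝟙 _ ⊗ₘ q := by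
    rw [← tensorHom_id, ← id_tensorHom, tensorHom_comp_tensorHom, tensorHom_comp_tensorHom]
    simp [hd, h]
  rw [Category.assoc, ← Category.assoc _ (d ⊗ₘ p), this]
  simp

theorem subst_some_zero_aux {P A H : C} {θ : P ⟶ A} {φ : 𝟙_ C ⟶ H} {p : H ⟶ 𝟙_ C}
    (h : φ ≫ p = 𝟙 _) :
    ((ρ_ _).inv ≫ θ ▷ _ ≫ A ◁ φ) ≫ A ◁ p ≫ (ρ_ _).hom = 𝟙 _ ≫ θ := by
  have : A ◁ φ ≫ A ◁ p = 𝟙 _ := by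
    rw [← MonoidalCategory.whiskerLeft_comp, h, MonoidalCategory.whiskerLeft_id]
  simp [reassoc_of% this]

theorem exists_inst_aux {Q' P Q A B : C} (l : Q' ⟶ P ⊗ Q) (θ : P ⟶ A) (n : A ⊗ Q ⟶ B) :
    (l ≫ θ ▷ _ ≫ A ◁ 𝟙 Q) ≫ n = l ≫ θ ▷ _ ≫ n := by
  simp

theorem exists_inst₂_aux {Q' P N P' Q A A' B : C} (l' : Q' ⟶ P' ⊗ N) (θ' : P' ⟶ A')
    (l : N ⟶ P ⊗ Q) (θ : P ⟶ A) (n : A' ⊗ A ⊗ Q ⟶ B) :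
    (l' ≫ θ' ▷ _ ≫ A' ◁ (l ≫ θ ▷ _ ≫ A ◁ 𝟙 Q)) ≫ n = l' ≫ θ' ▷ _ ≫ A' ◁ (l ≫ θ ▷ _) ≫ n := by
  simp

end Auxiliary

namespace Interp

open Functor.Monoidal

variable {V : Type u₁} [Category.{v₁} V] [CartesianMonoidalCategory V] [BraidedCategory V]
  [MonoidalClosed V] [HasFiniteCoproducts V]
  {C : Type u₂} [Category.{v₂} C] [MonoidalCategory C] [SymmetricCategory C]
  [MonoidalClosed C] [HasFiniteCoproducts C]
  {M : Type u₃} [Category.{v₃} M] [MonoidalCategory M] [SymmetricCategory M]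
  {X : Interp V C M} {δ : Prop} {K : Type k} {W : Type w} {i : W → M}

section Weakening

/-- An intuitionistic context can be duplicated. -/
theorem exists_dup (Γ : Ctx δ W) (h : Γ.Intuit) : ∃ cs : CSplit Γ Γ Γ,
    ∀ {Q Q₁ Q₂ : LCtx W} (ls : LSplit Q Q₁ Q₂),
      X.proj i Γ h Q ≫ (LSplit.map (X.wire i) ls).hom =
        X.fullSplit i ls cs ≫ (X.proj i Γ h Q₁ ⊗ₘ X.proj i Γ h Q₂) := by
  induction Γ with
  | nil =>
    refine ⟨.nil, fun {Q Q₁ Q₂} ls => ?_⟩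
    change 𝟙 _ ≫ _ = (LSplit.map (X.wire i) ls).hom ≫ (𝟙 _ ⊗ₘ 𝟙 _)
    rw [Category.id_comp, id_tensorHom_id, Category.comp_id]
  | cons o Γ ih =>
    obtain ⟨cs, hcs⟩ := ih h.2
    cases o with
    | none =>
      refine ⟨.none cs, fun ls => fullSplit_unitor_aux (hcs ls) ?_⟩
      change (λ_ _).inv ≫ (X.discard (εIso X.F) ⊗ₘ X.discard (εIso X.F)) ≫ (λ_ _).hom =
        X.discard (εIso X.F)
      simp [discard_εIso]
    | some P =>
      refine ⟨.both h.1 cs, fun ls => fullSplit_unitor_aux (hcs ls) ?_⟩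
      change X.copy (X.paramIso i P h.1) ≫ (X.discard (X.paramIso i P h.1) ⊗ₘ
        X.discard (X.paramIso i P h.1)) ≫ (λ_ _).hom = X.discard (X.paramIso i P h.1)
      rw [MonoidalCategory.tensorHom_def, Category.assoc, leftUnitor_naturality,
        reassoc_of% (copy_discard_left (X.paramIso i P h.1))]

theorem proj_isIntuit (Γ : Ctx δ W) (h : Γ.Intuit) :
    X.IsIntuit (X.fullParamIso i Γ h) (εIso X.F) (X.proj i Γ h (LCtx.empty W)) := by
  induction Γ with
  | nil => exact IsIntuit.id
  | cons o Γ ih =>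
    exact IsIntuit.comp (IsIntuit.tensor IsIntuit.discard (ih h.2)) IsIntuit.leftUnitor

/-- The projections from intuitionistic contexts to the empty one, which interpret weakening. -/
inductive ProjRel : CtxRel X δ i
  | mk {Γ : Ctx δ W} (h : Γ.Intuit) (Q : LCtx W) : ProjRel Γ Q [] Q (X.proj i Γ h Q)

variable {cty : K → Ty δ W} {cst : X.Constants i cty}

theorem projRel_isSubstRel : IsSubstRel cst ProjRel Term.var where
  split := by
    rintro _ _ _ _ _ _ _ _ _ ⟨h, Q⟩ cs ls
    cases cs
    obtain ⟨cs, hcs⟩ := X.exists_dup (i := i) _ h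
    exact ⟨_, _, _, _, cs, ls, _, _, .mk h _, .mk h _, hcs ls⟩
  intuit := by
    rintro _ _ _ _ _ ⟨h, Q⟩ _
    exact ⟨h, rfl⟩
  comp_proj := by
    rintro _ _ _ _ ⟨h, Q⟩ _ _
    exact Category.comp_id _
  isIntuit := by
    rintro _ _ _ ⟨h, Q⟩ _ _
    exact X.proj_isIntuit _ h
  var := by
    rintro _ _ _ _ ⟨h, Q⟩ _ _ l
    cases l

/-- Closed terms can be weakened to any intuitionistic context. -/
theorem exists_weaken {Q : LCtx W} {m : Term δ K i} {A : Ty δ W} (d : Deriv cty [] Q m A)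
    (Γ : Ctx δ W) (h : Γ.Intuit) :
    ∃ d' : Deriv cty Γ Q m A, X.den cst d' = X.proj i Γ h Q ≫ X.den cst d := by
  have := Extend.exists_deriv (projRel_isSubstRel (cst := cst)) d (.base (.mk h Q))
  rwa [Term.subst_var] at this

end Weakening

section Value

variable {cty : K → Ty δ W} (cst : X.Constants i cty)

/-- The property of the interpretation `⟦Q⟧ ⟶ ⟦A⟧` of a closed term that makes it possible to
substitute it: if the type is intuitionistic, there are no labels and the morphism is
intuitionistic. -/
inductive Substitutable : (A : Ty δ W) → (Q : LCtx W) → (X.lctx i Q ⟶ X.ty i A) → Prop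
  | linear {A : Ty δ W} {Q : LCtx W} (h : ¬ A.Intuit) (θ : X.lctx i Q ⟶ X.ty i A) :
      Substitutable A Q θ
  | intuit {A : Ty δ W} (h : A.Intuit) {θ : X.lctx i (LCtx.empty W) ⟶ X.ty i A}
      (hθ : X.IsIntuit (εIso X.F) (X.paramIso i A h) θ) : Substitutable A (LCtx.empty W) θ

/-- A closed term that may be substituted, with its type, labels and interpretation. It can be typed
in every intuitionistic context, as the variable for which it is substituted may occur below binders
or next to intuitionistic variables that are discarded. -/
structure Closed where
  term : Term δ K i
  ty : Ty δ W
  labels : LCtx W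
  hom : X.lctx i labels ⟶ X.ty i ty
  rename_eq : ∀ r, term.rename r = term
  exists_deriv : ∀ (Γ : Ctx δ W) (h : Γ.Intuit), ∃ d : Deriv cty Γ labels term ty,
    X.den cst d = X.proj i Γ h labels ≫ hom
  substitutable : Substitutable ty labels hom

variable {cst}

/-- The simultaneous substitution of a list of closed terms. -/
def Closed.subst : List (Closed cst) → ℕ → Term δ K i
  | [], n => .var n
  | v :: _, 0 => v.term
  | _ :: vs, n + 1 => Closed.subst vs n

theorem copy_εIso : X.copy (εIso X.F) = (λ_ (𝟙_ C)).inv := by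
  have := copy_discard_left (εIso X.F)
  rw [discard_εIso, id_whiskerRight, Category.id_comp] at this
  rw [← cancel_mono (λ_ _).hom, this, Iso.inv_hom_id]

/-- The interpretation of the substitution of closed terms for the variables of a context; the
terms for absent variables are ignored. -/
inductive ClosedRel : List (Closed cst) → CtxRel X δ i
  | nil (Q : LCtx W) : ClosedRel [] [] Q [] Q (𝟙 (X.lctx i Q))
  | none {v : Closed cst} {vs : List (Closed cst)} {Γ : Ctx δ W} {N Q : LCtx W}
      {φ : X.lctx i N ⟶ X.full i Γ Q} (h : ClosedRel vs [] N Γ Q φ) :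
      ClosedRel (v :: vs) [] N (none :: Γ) Q (φ ≫ (λ_ (X.full i Γ Q)).inv)
  | some {v : Closed cst} {vs : List (Closed cst)} {Γ : Ctx δ W} {Q' N Q : LCtx W}
      (ls : LSplit Q' v.labels N) {φ : X.lctx i N ⟶ X.full i Γ Q}
      (h : ClosedRel vs [] N Γ Q φ) :
      ClosedRel (v :: vs) [] Q' (some v.ty :: Γ) Q
        ((LSplit.map (X.wire i) ls).hom ≫ v.hom ▷ X.lctx i N ≫ X.ty i v.ty ◁ φ)

namespace ClosedRel

theorem split {vs : List (Closed cst)} {Γ' Γ Γ₁ Γ₂ : Ctx δ W} {Q' Q Q₁ Q₂ : LCtx W}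
    {φ : X.full i Γ' Q' ⟶ X.full i Γ Q}
    (h : ClosedRel vs Γ' Q' Γ Q φ) (cs : CSplit Γ Γ₁ Γ₂) (ls : LSplit Q Q₁ Q₂) :
    ∃ (Γ₁' Γ₂' : Ctx δ W) (Q₁' Q₂' : LCtx W) (cs' : CSplit Γ' Γ₁' Γ₂') (ls' : LSplit Q' Q₁' Q₂')
      (φ₁ : X.full i Γ₁' Q₁' ⟶ X.full i Γ₁ Q₁) (φ₂ : X.full i Γ₂' Q₂' ⟶ X.full i Γ₂ Q₂),
      ClosedRel vs Γ₁' Q₁' Γ₁ Q₁ φ₁ ∧ ClosedRel vs Γ₂' Q₂' Γ₂ Q₂ φ₂ ∧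
        φ ≫ X.fullSplit i ls cs = X.fullSplit i ls' cs' ≫ (φ₁ ⊗ₘ φ₂) := by
  induction h generalizing Γ₁ Γ₂ with
  | nil Q =>
    cases cs
    refine ⟨_, _, _, _, .nil, ls, _, _, .nil _, .nil _, ?_⟩
    refine (Category.id_comp _).trans ((Category.comp_id _).symm.trans ?_)
    exact congrArg (fun k => _ ≫ k) (id_tensorHom_id _ _).symm
  | none h ih =>
    cases cs with
    | none cs =>
      obtain ⟨Γ₁', Γ₂', Q₁', Q₂', cs', ls', φ₁, φ₂, h₁, h₂, e⟩ := ih cs ls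
      cases cs'
      exact ⟨_, _, _, _, .nil, ls', _, _, .none h₁, .none h₂, subst_none_aux e⟩
  | @some v vs Γ Q' N Q l φ h ih =>
    obtain ⟨t, A, P, θ, hv, hd, hs⟩ := v
    cases cs with
    | both hA cs =>
      obtain ⟨Γ₁', Γ₂', Q₁', Q₂', cs', ls', φ₁, φ₂, h₁, h₂, e⟩ := ih cs ls
      cases cs'
      cases hs with
      | linear h' => exact absurd hA h'
      | intuit h' hθ =>
        obtain rfl := LSplit.eq_of_empty_left l
        -- The term has no labels, so that it can be copied into both parts.
        let l₁ : LSplit Q₁' (LCtx.empty W) Q₁' := Interleave.nilLeft _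
        let l₂ : LSplit Q₂' (LCtx.empty W) Q₂' := Interleave.nilLeft _
        refine ⟨_, _, _, _, .nil, ls', _, _, .some l₁ h₁, .some l₂ h₂, ?_⟩
        rw [LSplit.map_empty_left, LSplit.map_empty_left, LSplit.map_empty_left]
        exact subst_both_aux' ((IsIntuit.comp_copy hθ).trans (by rw [copy_εIso])) e
    | left cs =>
      obtain ⟨Γ₁', Γ₂', Q₁', Q₂', cs', ls', φ₁, φ₂, h₁, h₂, e⟩ := ih cs ls
      cases cs'
      obtain ⟨N', s, t, e'⟩ := LSplit.exists_assoc (i := X.wire i) l ls'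
      exact ⟨_, _, _, _, .nil, s, _, _, .some t h₁, .none h₂, subst_left_aux' e' e⟩
    | right cs =>
      obtain ⟨Γ₁', Γ₂', Q₁', Q₂', cs', ls', φ₁, φ₂, h₁, h₂, e⟩ := ih cs ls
      cases cs'
      obtain ⟨ls'', e''⟩ := LSplit.exists_symm (i := X.wire i) ls'
      obtain ⟨N', s, t, e'⟩ := LSplit.exists_assoc (i := X.wire i) l ls''
      obtain ⟨s', es⟩ := LSplit.exists_symm (i := X.wire i) s
      refine ⟨_, _, _, _, .nil, s', _, _, .none h₁, .some t h₂, ?_⟩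
      rw [e''] at e'
      exact (subst_right_aux' e' e).trans (congrArg (fun k => k ≫ _) es.symm)

theorem intuit {vs : List (Closed cst)} {Γ' Γ : Ctx δ W} {Q' Q : LCtx W}
    {φ : X.full i Γ' Q' ⟶ X.full i Γ Q}
    (h : ClosedRel vs Γ' Q' Γ Q φ) (hΓ : Γ.Intuit) : Γ'.Intuit ∧ Q' = Q := by
  induction h with
  | nil Q => exact ⟨trivial, rfl⟩
  | none h ih => exact ih hΓ.2
  | @some v vs Γ Q' N Q l φ h ih =>
    obtain ⟨t, A, P, θ, hv, hd, hs⟩ := v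
    cases hs with
    | linear h' => exact absurd hΓ.1 h'
    | intuit h' hθ => exact ⟨trivial, (LSplit.eq_of_empty_left l).trans (ih hΓ.2).2⟩

theorem comp_proj {vs : List (Closed cst)} {Γ' Γ : Ctx δ W} {Q Q' : LCtx W}
    {φ : X.full i Γ' Q' ⟶ X.full i Γ Q}
    (h : ClosedRel vs Γ' Q' Γ Q φ) (e : Q = Q') (hΓ : Γ.Intuit) (hΓ' : Γ'.Intuit) :
    φ ≫ X.proj i Γ hΓ Q = X.proj i Γ' hΓ' Q' ≫ eqToHom (by rw [e]) := by
  induction h with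
  | nil Q =>
    rw [eqToHom_refl]
    rfl
  | none h ih =>
    subst e
    have := ih rfl hΓ.2 hΓ'
    rw [eqToHom_refl, Category.comp_id] at this ⊢
    refine (subst_none_proj_aux ?_ this)
    exact discard_εIso
  | @some v vs Γ Q' N Q l φ h ih =>
    obtain ⟨t, A, P, θ, hv, hd, hs⟩ := v
    cases hs with
    | linear h' => exact absurd hΓ.1 h'
    | intuit h' hθ =>
      obtain rfl := LSplit.eq_of_empty_left l
      subst e
      have := ih rfl hΓ.2 hΓ'
      rw [eqToHom_refl, Category.comp_id] at this ⊢
      rw [LSplit.map_empty_left]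
      exact subst_some_proj_aux ((IsIntuit.comp_discard hθ).trans discard_εIso) this

theorem isIntuit {vs : List (Closed cst)} {Γ' Γ : Ctx δ W} {Q Q' : LCtx W}
    {φ : X.full i Γ' Q' ⟶ X.full i Γ Q}
    (h : ClosedRel vs Γ' Q' Γ Q φ) (e' : Q' = LCtx.empty W) (e : Q = LCtx.empty W)
    (hΓ : Γ.Intuit) (hΓ' : Γ'.Intuit) :
    X.IsIntuit (eqToIso (by rw [e']) ≪≫ X.fullParamIso i Γ' hΓ')
      (eqToIso (by rw [e]) ≪≫ X.fullParamIso i Γ hΓ) φ := by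
  induction h with
  | nil Q =>
    subst e
    simp only [eqToIso_refl, Iso.refl_trans]
    exact IsIntuit.id
  | none h ih =>
    subst e e'
    have := ih rfl rfl hΓ.2 hΓ'
    simp only [eqToIso_refl, Iso.refl_trans] at this ⊢
    exact IsIntuit.comp this IsIntuit.leftUnitor_inv
  | @some v vs Γ Q' N Q l φ h ih =>
    obtain ⟨t, A, P, θ, hv, hd, hs⟩ := v
    cases hs with
    | linear h' => exact absurd hΓ.1 h'
    | intuit h' hθ =>
      obtain rfl := LSplit.eq_of_empty_left l
      subst e e'
      have := ih rfl rfl hΓ.2 hΓ'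
      simp only [eqToIso_refl, Iso.refl_trans] at this ⊢
      rw [LSplit.map_empty_left, ← tensorHom_id, ← id_tensorHom]
      exact IsIntuit.comp IsIntuit.leftUnitor_inv
        (IsIntuit.comp (IsIntuit.tensor hθ IsIntuit.id) (IsIntuit.tensor IsIntuit.id this))

theorem var {vs : List (Closed cst)} {Γ' Γ : Ctx δ W} {Q Q' : LCtx W}
    {φ : X.full i Γ' Q' ⟶ X.full i Γ Q} (h : ClosedRel vs Γ' Q' Γ Q φ) (e : Q = LCtx.empty W)
    {n : ℕ} {A : Ty δ W} (l : Lookup Γ n A) :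
    VarImage cst (Closed.subst vs n) Γ' Q' A (φ ≫ eqToHom (by rw [e]) ≫ X.fullLookup i l) := by
  induction h generalizing n with
  | nil Q => cases l
  | none h ih =>
    subst e
    cases l with
    | succ ho l =>
      have := ih rfl l
      rw [eqToHom_refl, Category.id_comp] at this ⊢
      exact this.of_eq (subst_none_proj_aux discard_εIso rfl)
  | @some v vs Γ Q' N Q ls φ h ih =>
    obtain ⟨t, A, P, θ, hv, hd, hs⟩ := v
    cases l with
    | zero hΓ =>
      obtain ⟨-, rfl⟩ := h.intuit hΓ
      subst e
      obtain rfl := LSplit.eq_of_empty_right ls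
      have := h.comp_proj rfl hΓ trivial
      rw [eqToHom_refl, Category.comp_id] at this
      rw [eqToHom_refl, Category.id_comp, LSplit.map_empty_right]
      exact (VarImage.closed θ hv hd (Γ := []) trivial).of_eq (subst_some_zero_aux this)
    | succ ho l =>
      cases hs with
      | linear h' => exact absurd ho h'
      | intuit h' hθ =>
        obtain rfl := LSplit.eq_of_empty_left ls
        subst e
        have := ih rfl l
        rw [eqToHom_refl, Category.id_comp] at this ⊢
        refine this.of_eq ?_
        rw [LSplit.map_empty_left]
        exact subst_some_proj_aux ((IsIntuit.comp_discard hθ).trans discard_εIso) rfl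

theorem isSubstRel (vs : List (Closed cst)) :
    IsSubstRel cst (ClosedRel vs) (Closed.subst vs) where
  split h cs ls := h.split cs ls
  intuit h hΓ := h.intuit hΓ
  comp_proj h hΓ hΓ' := by simpa using h.comp_proj rfl hΓ hΓ'
  isIntuit h hΓ hΓ' := by simpa using h.isIntuit rfl rfl hΓ hΓ'
  var h _ _ l := by simpa using h.var rfl l

end ClosedRel

/-- Substitution of one closed term. -/
theorem exists_inst {Q' P Q : LCtx W} {v n : Term δ K i} {A B : Ty δ W}
    (dv : Deriv cty [] P v A) (h : Substitutable A P (X.den cst dv)) (ls : LSplit Q' P Q)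
    (dn : Deriv cty [some A] Q n B) : ∃ d : Deriv cty [] Q' (n.inst v) B,
      X.den cst d = (LSplit.map (X.wire i) ls).hom ≫ X.den cst dv ▷ X.lctx i Q ≫ X.den cst dn := by
  let c : Closed cst := ⟨v, A, P, X.den cst dv, fun _ => dv.rename_eq (by simp),
      fun Γ hΓ => X.exists_weaken dv Γ hΓ, h⟩
  have hr : ClosedRel [c] [] Q' [some A] Q _ := .some (v := c) ls (.nil Q)
  obtain ⟨d, e⟩ := Extend.exists_deriv (ClosedRel.isSubstRel [c]) dn (.base hr)
  have hs : n.inst v = n.subst (Closed.subst [c]) := by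
    unfold Term.inst
    congr 1
    funext j
    cases j <;> rfl
  rw [hs]
  refine ⟨d, e.trans ?_⟩
  exact exists_inst_aux _ _ _

/-- Substitution of two closed terms, `v'` for the innermost variable and `v` for the next one. -/
theorem exists_inst₂ {Q' P P' N Q : LCtx W} {v v' n : Term δ K i} {A A' B : Ty δ W}
    (dv : Deriv cty [] P v A) (h : Substitutable A P (X.den cst dv))
    (dv' : Deriv cty [] P' v' A') (h' : Substitutable A' P' (X.den cst dv'))
    (ls' : LSplit Q' P' N) (ls : LSplit N P Q)
    (dn : Deriv cty [some A', some A] Q n B) : ∃ d : Deriv cty [] Q' (n.inst₂ v v') B,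
      X.den cst d = (LSplit.map (X.wire i) ls').hom ≫ X.den cst dv' ▷ X.lctx i N ≫
        X.ty i A' ◁ ((LSplit.map (X.wire i) ls).hom ≫ X.den cst dv ▷ X.lctx i Q) ≫
          X.den cst dn := by
  let c : Closed cst := ⟨v, A, P, X.den cst dv, fun _ => dv.rename_eq (by simp),
      fun Γ hΓ => X.exists_weaken dv Γ hΓ, h⟩
  let c' : Closed cst := ⟨v', A', P', X.den cst dv', fun _ => dv'.rename_eq (by simp),
      fun Γ hΓ => X.exists_weaken dv' Γ hΓ, h'⟩
  have hr : ClosedRel [c', c] [] Q' [some A', some A] Q _ :=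
    .some (v := c') ls' (.some (v := c) ls (.nil Q))
  obtain ⟨d, e⟩ := Extend.exists_deriv (ClosedRel.isSubstRel [c', c]) dn (.base hr)
  have hs : n.inst₂ v v' = n.subst (Closed.subst [c', c]) := by
    unfold Term.inst₂
    congr 1
    funext j
    match j with
    | 0 => rfl
    | 1 => rfl
    | j + 2 => rfl
  rw [hs]
  refine ⟨d, e.trans ?_⟩
  exact exists_inst₂_aux _ _ _ _ _

end Value

end Interp

end LNL

namespace LNL

/-! ### Coherence -/

theorem CSplit.unique {δ : Prop} {W : Type w} {Γ Γ₁ Γ₂ : Ctx δ W} (s s' : CSplit Γ Γ₁ Γ₂) :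
    s = s' := by
  induction s with
  | nil => cases s'; rfl
  | none s ih | both h s ih | left s ih | right s ih => cases s'; rw [ih]

section Slots

variable {δ : Prop} {W : Type w} {Γ Γ₁ Γ₂ : Ctx δ W} {n : ℕ} {A : Ty δ W}

theorem CSplit.getElem?_none (s : CSplit Γ Γ₁ Γ₂) (h : Γ[n]? = some Option.none) :
    Γ₁[n]? = some Option.none ∧ Γ₂[n]? = some Option.none := by
  induction s generalizing n with
  | nil => simp at h
  | none s ih | both h s ih | left s ih | right s ih =>
    cases n with
    | zero => simp_all
    | succ n => simpa using ih (by simpa using h)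

theorem CSplit.getElem?_some (s : CSplit Γ Γ₁ Γ₂)
    (h : Γ[n]? = some (some A)) : Γ₁[n]? = some (some A) ∨ Γ₂[n]? = some (some A) := by
  induction s generalizing n with
  | nil => simp at h
  | none s ih | both h s ih | left s ih | right s ih =>
    cases n with
    | zero => simp_all
    | succ n => simpa using ih (by simpa using h)

theorem CSplit.getElem?_left (s : CSplit Γ Γ₁ Γ₂) (hA : ¬ A.Intuit)
    (h : Γ₂[n]? = some (some A)) : Γ₁[n]? = some Option.none := by
  induction s generalizing n with
  | nil => simp at h
  | none s ih | both h s ih | left s ih | right s ih =>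
    cases n with
    | zero => simp_all
    | succ n => simpa using ih (by simpa using h)

theorem Ctx.Intuit.getElem? (hΓ : Γ.Intuit) (h : Γ[n]? = some (some A)) : A.Intuit := by
  induction Γ generalizing n with
  | nil => simp at h
  | cons o Γ ih =>
    cases n with
    | zero =>
      obtain rfl : o = some A := by simpa using h
      exact hΓ.1
    | succ n => exact ih hΓ.2 (by simpa using h)

theorem Lookup.eq_of_linear {k : ℕ} {B : Ty δ W} (l : Lookup Γ k B) (hA : ¬ A.Intuit)
    (h : Γ[n]? = some (some A)) : n = k := by
  induction l generalizing n with
  | zero hΓ =>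
    cases n with
    | zero => rfl
    | succ n => exact absurd (hΓ.getElem? (by simpa using h)) hA
  | @succ _ _ _ o ho l ih =>
    cases n with
    | zero =>
      obtain rfl : o = some A := by simpa using h
      exact absurd ho hA
    | succ n => rw [ih (n := n) (by simpa using h)]

theorem Lookup.getElem? (l : Lookup Γ n A) : Γ[n]? = some (some A) := by
  induction l with
  | zero h => rfl
  | succ h l ih => simpa using ih

theorem Lookup.unique {A' : Ty δ W} (l : Lookup Γ n A) (l' : Lookup Γ n A') :
    A = A' ∧ l ≍ l' := by
  induction l generalizing A' with
  | zero h => cases l'; simp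
  | succ h l ih =>
    cases l' with
    | succ h' l' =>
      obtain ⟨rfl, e⟩ := ih l'
      cases e
      simp

theorem MTy.toTy_injective (h : δ) : ∀ {T U : MTy W}, (T.toTy h : Ty δ W) = U.toTy h → T = U := by
  intro T
  induction T with
  | wire α => intro U e; cases U <;> simp_all [MTy.toTy]
  | one => intro U e; cases U <;> simp_all [MTy.toTy]
  | tensor T T' ih ih' =>
    intro U e
    cases U with
    | wire α => simp [MTy.toTy] at e
    | one => simp [MTy.toTy] at e
    | tensor U U' =>
      simp only [MTy.toTy, Ty.tensor.injEq] at e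
      rw [ih e.1, ih' e.2]

end Slots

section Usage

variable {δ : Prop} {K : Type k} {W : Type w} {M : Type u₃} [Category.{v₃} M]
  [MonoidalCategory M] {i : W → M} {cty : K → Ty δ W}

/-- The labels of a derivation are determined by the term. -/
theorem Deriv.mem_labels_iff {Γ Γ' : Ctx δ W} {Q Q' : LCtx W} {m : Term δ K i} {A A' : Ty δ W}
    (d : Deriv cty Γ Q m A) (d' : Deriv cty Γ' Q' m A') (l : ℕ) :
    l ∈ Q.labels ↔ l ∈ Q'.labels := by
  induction d generalizing Γ' Q' A' with
  | var | const | star | lift | fix | boxed => cases d'; rfl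
  | label h hΓ l α => cases d'; simp [LCtx.labels, LCtx.single]
  | abort dm ih | inl dm ih | inr dm ih | lam dm ih | force dm ih | box h dm ih =>
    cases d'
    exact ih ‹_›
  | letIn cs ls dm dn ihm ihn | seq cs ls dm dn ihm ihn | pair cs ls dm dn ihm ihn
  | letPair cs ls dm dn ihm ihn | apply h cs ls dm dn ihm ihn =>
    cases d'
    case _ cs' ls' dm' dn' =>
      rw [LSplit.mem_labels ls, LSplit.mem_labels ls', ihm dm', ihn dn']
  | app cs ls dm dn ihm ihn =>
    cases d' with
    | app cs' ls' dm' dn' =>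
      rw [LSplit.mem_labels ls, LSplit.mem_labels ls', ihm dm', ihn dn']
  | case cs ls dm dn dp ihm ihn ihp =>
    cases d' with
    | case cs' ls' dm' dn' dp' =>
      rw [LSplit.mem_labels ls, LSplit.mem_labels ls', ihm dm', ihn dn']

/-- Linear variables are used, and so are present in all contexts in which the term is typed. The
variable need not be linear in the second context. -/
theorem Deriv.linear_used {Γ Γ' : Ctx δ W} {Q Q' : LCtx W} {m : Term δ K i} {A A' B : Ty δ W}
    (d : Deriv cty Γ Q m A) (d' : Deriv cty Γ' Q' m A') (hB : ¬ B.Intuit) {n : ℕ}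
    (h : Γ[n]? = some (some B)) : Γ'[n]? ≠ some none := by
  induction d generalizing Γ' Q' A' n with
  | var l =>
    cases d' with
    | var l' =>
      obtain rfl := l.eq_of_linear hB h
      simp [l'.getElem?]
  | const hΓ | star hΓ | lift hΓ | fix hΓ | label _ hΓ | boxed _ hΓ =>
    exact absurd (hΓ.getElem? h) hB
  | abort dm ih | inl dm ih | inr dm ih | force dm ih | box _ dm ih =>
    cases d'
    exact ih ‹_› h
  | lam dm ih =>
    cases d' with
    | lam dm' => simpa using ih dm' (n := n + 1) (by simpa using h)
  | seq cs ls dm dn ihm ihn | pair cs ls dm dn ihm ihn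
  | apply _ cs ls dm dn ihm ihn =>
    cases d'
    case _ cs' ls' dm' dn' =>
      intro h'
      obtain ⟨h₁, h₂⟩ := cs'.getElem?_none h'
      rcases cs.getElem?_some h with h | h
      · exact ihm dm' h h₁
      · exact ihn dn' h h₂
  | app cs ls dm dn ihm ihn =>
    cases d' with
    | app cs' ls' dm' dn' =>
      intro h'
      obtain ⟨h₁, h₂⟩ := cs'.getElem?_none h'
      rcases cs.getElem?_some h with h | h
      · exact ihm dm' h h₁
      · exact ihn dn' h h₂
  | letIn cs ls dm dn ihm ihn =>
    cases d' with
    | letIn cs' ls' dm' dn' =>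
      intro h'
      obtain ⟨h₁, h₂⟩ := cs'.getElem?_none h'
      rcases cs.getElem?_some h with h | h
      · exact ihm dm' h h₁
      · exact ihn dn' (n := n + 1) (by simpa using h) (by simpa using h₂)
  | letPair cs ls dm dn ihm ihn =>
    cases d' with
    | letPair cs' ls' dm' dn' =>
      intro h'
      obtain ⟨h₁, h₂⟩ := cs'.getElem?_none h'
      rcases cs.getElem?_some h with h | h
      · exact ihm dm' h h₁
      · exact ihn dn' (n := n + 2) (by simpa using h) (by simpa using h₂)
  | case cs ls dm dn dp ihm ihn ihp =>
    cases d' with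
    | case cs' ls' dm' dn' dp' =>
      intro h'
      obtain ⟨h₁, h₂⟩ := cs'.getElem?_none h'
      rcases cs.getElem?_some h with h | h
      · exact ihm dm' h h₁
      · exact ihn dn' (n := n + 1) (by simpa using h) (by simpa using h₂)

variable (cty) in
/-- The variable `n` is linear in some context in which `m` is typed. This depends only on the term,
so that it can serve to choose the same splitting of a context for all typings of `m`. -/
def Term.Linear (m : Term δ K i) (n : ℕ) : Prop :=
  ∃ (Γ : Ctx δ W) (Q : LCtx W) (A B : Ty δ W),
    Nonempty (Deriv cty Γ Q m A) ∧ Γ[n]? = some (some B) ∧ ¬ B.Intuit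

end Usage

section Weaken

variable {δ : Prop} {W : Type w}

/-- Dropping an intuitionistic variable, or nothing. -/
inductive SlotWeaken : Option (Ty δ W) → Option (Ty δ W) → Type w
  | keep (o : Option (Ty δ W)) : SlotWeaken o o
  | drop {P : Ty δ W} (h : P.Intuit) : SlotWeaken (some P) none

/-- `Weaken Γ₀ Γ`: the context `Γ` is obtained from `Γ₀` by dropping intuitionistic variables. -/
inductive Weaken : Ctx δ W → Ctx δ W → Type w
  | nil : Weaken [] []
  | cons {o₀ o : Option (Ty δ W)} {Γ₀ Γ : Ctx δ W} (s : SlotWeaken o₀ o) (w : Weaken Γ₀ Γ) :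
      Weaken (o₀ :: Γ₀) (o :: Γ)

/-- Nothing is dropped. -/
def Weaken.refl : (Γ : Ctx δ W) → Weaken Γ Γ
  | [] => .nil
  | o :: Γ => .cons (.keep o) (refl Γ)

theorem SlotWeaken.intuit {o₀ o : Option (Ty δ W)} (s : SlotWeaken o₀ o) (h : SlotIntuit o) :
    SlotIntuit o₀ := by
  cases s with
  | keep => exact h
  | drop h' => exact h'

theorem Weaken.intuit {Γ₀ Γ : Ctx δ W} (w : Weaken Γ₀ Γ) (h : Γ.Intuit) : Γ₀.Intuit := by
  induction w with
  | nil => trivial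
  | cons s w ih => exact ⟨s.intuit h.1, ih h.2⟩

open Classical in
/-- The variables of a context that are intuitionistic or satisfy a predicate. -/
noncomputable def Ctx.part (p : ℕ → Prop) : Ctx δ W → Ctx δ W
  | [] => []
  | none :: Γ => none :: Ctx.part (fun n => p (n + 1)) Γ
  | some A :: Γ => (if A.Intuit ∨ p 0 then some A else none) :: Ctx.part (fun n => p (n + 1)) Γ

end Weaken

section Auxiliary

variable {C : Type u₂} [Category.{v₂} C] [MonoidalCategory C]

theorem tensor_unitor_comp_aux {S S' H H' L : C} {t : S ⟶ S'} {φ : H ⟶ H'} {d : S' ⟶ 𝟙_ C}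
    {p : H' ⟶ L} {d' : S ⟶ 𝟙_ C} {p' : H ⟶ L} (hd : t ≫ d = d') (hp : φ ≫ p = p') :
    (t ⊗ₘ φ) ≫ (d ⊗ₘ p) ≫ (λ_ _).hom = (d' ⊗ₘ p') ≫ (λ_ _).hom := by
  rw [tensorHom_comp_tensorHom_assoc, hd, hp]

theorem id_comp_aux {S S₁ S₂ : C} (σ : S ⟶ S₁ ⊗ S₂) : 𝟙 _ ≫ σ = σ ≫ (𝟙 _ ⊗ₘ 𝟙 _) := by
  simp

theorem copy_discard_right_aux {P : C} {c : P ⟶ P ⊗ P} {d : P ⟶ 𝟙_ C}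
    (h : c ≫ P ◁ d ≫ (ρ_ P).hom = 𝟙 P) : 𝟙 _ ≫ (ρ_ P).inv = c ≫ (𝟙 _ ⊗ₘ d) := by
  rw [← cancel_mono (ρ_ P).hom]
  simpa using h.symm

theorem copy_discard_left_aux {P : C} {c : P ⟶ P ⊗ P} {d : P ⟶ 𝟙_ C}
    (h : c ≫ d ▷ P ≫ (λ_ P).hom = 𝟙 P) : 𝟙 _ ≫ (λ_ P).inv = c ≫ (d ⊗ₘ 𝟙 _) := by
  rw [← cancel_mono (λ_ P).hom]
  simpa using h.symm

end Auxiliary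

namespace Interp

open Functor.Monoidal

variable {V : Type u₁} [Category.{v₁} V] [CartesianMonoidalCategory V] [BraidedCategory V]
  [MonoidalClosed V] [HasFiniteCoproducts V]
  {C : Type u₂} [Category.{v₂} C] [MonoidalCategory C] [SymmetricCategory C]
  [MonoidalClosed C] [HasFiniteCoproducts C]
  {M : Type u₃} [Category.{v₃} M] [MonoidalCategory M] [SymmetricCategory M]
  (X : Interp V C M) {δ : Prop} {K : Type k} {W : Type w} (i : W → M)

/-- The morphism discarding a dropped variable. -/
noncomputable def slotWeaken : {o₀ o : Option (Ty δ W)} → SlotWeaken o₀ o →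
    (X.slot i o₀ ⟶ X.slot i o)
  | _, _, .keep _ => 𝟙 _
  | _, _, .drop (P := P) h => X.discard (X.paramIso i P h)

/-- The morphism discarding the dropped variables. -/
noncomputable def weaken : {Γ₀ Γ : Ctx δ W} → Weaken Γ₀ Γ → (Q : LCtx W) →
    (X.full i Γ₀ Q ⟶ X.full i Γ Q)
  | _, _, .nil, Q => 𝟙 (X.lctx i Q)
  | _, _, .cons s w, Q => X.slotWeaken i s ⊗ₘ weaken w Q

variable {X i}

theorem weaken_refl (Γ : Ctx δ W) (Q : LCtx W) : X.weaken i (Weaken.refl Γ) Q = 𝟙 _ := by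
  induction Γ with
  | nil => rfl
  | cons o Γ ih =>
    refine (congrArg (fun k => 𝟙 (X.slot i o) ⊗ₘ k) ih).trans ?_
    exact id_tensorHom_id _ _

theorem slotWeaken_discard {o₀ o : Option (Ty δ W)} (s : SlotWeaken o₀ o) (h : SlotIntuit o) :
    X.slotWeaken i s ≫ X.discard (X.slotIso i o h) = X.discard (X.slotIso i o₀ (s.intuit h)) := by
  cases s with
  | keep => exact Category.id_comp _
  | drop hP =>
    refine (congrArg (fun k => _ ≫ k) discard_εIso).trans ?_
    exact Category.comp_id _

theorem weaken_proj {Γ₀ Γ : Ctx δ W} (w : Weaken Γ₀ Γ) (h : Γ.Intuit) (Q : LCtx W) :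
    X.weaken i w Q ≫ X.proj i Γ h Q = X.proj i Γ₀ (w.intuit h) Q := by
  induction w with
  | nil => exact Category.id_comp _
  | cons s w ih => exact tensor_unitor_comp_aux (slotWeaken_discard s h.1) (ih h.2)

theorem weaken_lookup {Γ₀ Γ : Ctx δ W} (w : Weaken Γ₀ Γ) {n : ℕ} {A : Ty δ W}
    (l : Lookup Γ n A) : ∃ l₀ : Lookup Γ₀ n A,
      X.weaken i w (LCtx.empty W) ≫ X.fullLookup i l = X.fullLookup i l₀ := by
  induction l generalizing Γ₀ with
  | zero h =>
    cases w with
    | cons s w =>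
      cases s with
      | keep =>
        refine ⟨.zero (w.intuit h), ?_⟩
        refine (congrArg (fun k => k ≫ _) (id_tensorHom _ _)).trans ?_
        exact whiskerLeft_lookup_aux (weaken_proj w h _)
  | succ h l ih =>
    cases w with
    | cons s w =>
      obtain ⟨l₀, e⟩ := ih w
      exact ⟨.succ (s.intuit h) l₀, tensor_unitor_comp_aux (slotWeaken_discard s h) e⟩

theorem weaken_isIntuit {Γ₀ Γ : Ctx δ W} (w : Weaken Γ₀ Γ) (h : Γ.Intuit) :
    X.IsIntuit (X.fullParamIso i Γ₀ (w.intuit h)) (X.fullParamIso i Γ h)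
      (X.weaken i w (LCtx.empty W)) := by
  induction w with
  | nil => exact IsIntuit.id
  | cons s w ih =>
    refine IsIntuit.tensor ?_ (ih h.2)
    cases s with
    | keep => exact IsIntuit.id
    | drop hP => exact IsIntuit.discard

/-- Given a splitting of `Γ`, where `Γ` is obtained from `Γ₀` by dropping intuitionistic
variables, `Γ₀` can be split by duplicating all intuitionistic variables and sending the linear
ones where the predicate `p` says. The given splitting is recovered by discarding copies, as copying
and then discarding one copy is the identity. -/
theorem exists_part {Γ₀ Γ Γ₁ Γ₂ : Ctx δ W} (w : Weaken Γ₀ Γ) (cs : CSplit Γ Γ₁ Γ₂)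
    (p : ℕ → Prop) (h₁ : ∀ n A, ¬ A.Intuit → Γ₁[n]? = some (some A) → p n)
    (h₂ : ∀ n A, ¬ A.Intuit → Γ₂[n]? = some (some A) → ¬ p n) :
    ∃ (cs₀ : CSplit Γ₀ (Γ₀.part p) (Γ₀.part fun n => ¬ p n))
      (w₁ : Weaken (Γ₀.part p) Γ₁) (w₂ : Weaken (Γ₀.part fun n => ¬ p n) Γ₂),
      ∀ {Q Q₁ Q₂ : LCtx W} (ls : LSplit Q Q₁ Q₂),
        X.weaken i w Q ≫ X.fullSplit i ls cs =
          X.fullSplit i ls cs₀ ≫ (X.weaken i w₁ Q₁ ⊗ₘ X.weaken i w₂ Q₂) := by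
  induction cs generalizing Γ₀ p with
  | nil =>
    cases w
    refine ⟨.nil, .nil, .nil, fun ls => ?_⟩
    refine (Category.id_comp _).trans ((Category.comp_id _).symm.trans ?_)
    exact congrArg (fun k => _ ≫ k) (id_tensorHom_id _ _).symm
  | none cs ih =>
    cases w with
    | cons s w =>
      obtain ⟨cs₀, w₁, w₂, e⟩ := ih w (fun n => p (n + 1))
        (fun n A hA h => h₁ (n + 1) A hA (by simpa using h))
        (fun n A hA h => h₂ (n + 1) A hA (by simpa using h))
      cases s with
      | keep =>
        refine ⟨.none cs₀, .cons (.keep _) w₁, .cons (.keep _) w₂, fun ls => ?_⟩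
        exact fullSplit_cons_aux (e ls) (id_comp_aux _)
      | @drop P hP =>
        rw [Ctx.part, Ctx.part, if_pos (.inl hP), if_pos (.inl hP)]
        refine ⟨.both hP cs₀, .cons (.drop hP) w₁, .cons (.drop hP) w₂, fun ls => ?_⟩
        -- The variable is dropped before the splitting; copying it and dropping both copies has
        -- the same effect.
        refine fullSplit_cons_aux (e ls) ?_
        refine .trans ?_ (IsIntuit.comp_copy (IsIntuit.discard (e := X.paramIso i P hP)))
        exact congrArg (fun k => _ ≫ k) copy_εIso.symm
  | @both Γ Γ₁ Γ₂ P hP cs ih =>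
    cases w with
    | cons s w =>
      obtain ⟨cs₀, w₁, w₂, e⟩ := ih w (fun n => p (n + 1))
        (fun n A hA h => h₁ (n + 1) A hA (by simpa using h))
        (fun n A hA h => h₂ (n + 1) A hA (by simpa using h))
      cases s with
      | keep =>
        rw [Ctx.part, Ctx.part, if_pos (.inl hP), if_pos (.inl hP)]
        refine ⟨.both hP cs₀, .cons (.keep _) w₁, .cons (.keep _) w₂, fun ls => ?_⟩
        exact fullSplit_cons_aux (e ls) (id_comp_aux _)
  | @left Γ Γ₁ Γ₂ A cs ih =>
    cases w with
    | cons s w =>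
      obtain ⟨cs₀, w₁, w₂, e⟩ := ih w (fun n => p (n + 1))
        (fun n A hA h => h₁ (n + 1) A hA (by simpa using h))
        (fun n A hA h => h₂ (n + 1) A hA (by simpa using h))
      cases s with
      | keep =>
        by_cases hA : A.Intuit
        · rw [Ctx.part, Ctx.part, if_pos (.inl hA), if_pos (.inl hA)]
          refine ⟨.both hA cs₀, .cons (.keep _) w₁, .cons (.drop hA) w₂, fun ls => ?_⟩
          exact fullSplit_cons_aux (e ls) (copy_discard_right_aux (copy_discard_right _))
        · have hp := h₁ 0 A hA rfl
          rw [Ctx.part, Ctx.part, if_pos (.inr hp), if_neg (by simp [hA, hp])]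
          refine ⟨.left cs₀, .cons (.keep _) w₁, .cons (.keep _) w₂, fun ls => ?_⟩
          exact fullSplit_cons_aux (e ls) (id_comp_aux _)
  | @right Γ Γ₁ Γ₂ A cs ih =>
    cases w with
    | cons s w =>
      obtain ⟨cs₀, w₁, w₂, e⟩ := ih w (fun n => p (n + 1))
        (fun n A hA h => h₁ (n + 1) A hA (by simpa using h))
        (fun n A hA h => h₂ (n + 1) A hA (by simpa using h))
      cases s with
      | keep =>
        by_cases hA : A.Intuit
        · rw [Ctx.part, Ctx.part, if_pos (.inl hA), if_pos (.inl hA)]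
          refine ⟨.both hA cs₀, .cons (.drop hA) w₁, .cons (.keep _) w₂, fun ls => ?_⟩
          exact fullSplit_cons_aux (e ls) (copy_discard_left_aux (copy_discard_left _))
        · have hp := h₂ 0 A hA rfl
          rw [Ctx.part, Ctx.part, if_neg (by simp [hA, hp]), if_pos (.inr hp)]
          refine ⟨.right cs₀, .cons (.keep _) w₁, .cons (.keep _) w₂, fun ls => ?_⟩
          exact fullSplit_cons_aux (e ls) (id_comp_aux _)

end Interp

end LNL

namespace LNL

section Auxiliary

variable {C : Type u₂} [Category.{v₂} C] [MonoidalCategory C] [SymmetricCategory C]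

theorem coh_let_aux {H₀ H H₁ H₂ K₁ K₂ H' H₁' H₂' A D : C} {w : H₀ ⟶ H} {w' : H₀ ⟶ H'}
    {k : H ⟶ H₁ ⊗ H₂} {k' : H' ⟶ H₁' ⊗ H₂'} {k₀ : H₀ ⟶ K₁ ⊗ K₂} {w₁ : K₁ ⟶ H₁} {w₂ : K₂ ⟶ H₂}
    {w₁' : K₁ ⟶ H₁'} {w₂' : K₂ ⟶ H₂'} (e : w ≫ k = k₀ ≫ (w₁ ⊗ₘ w₂))
    (e' : w' ≫ k' = k₀ ≫ (w₁' ⊗ₘ w₂')) {m : H₁ ⟶ A} {m' : H₁' ⟶ A}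
    {n : A ⊗ H₂ ⟶ D} {n' : A ⊗ H₂' ⟶ D} (hm : w₁ ≫ m = w₁' ≫ m')
    (hn : (𝟙 A ⊗ₘ w₂) ≫ n = (𝟙 A ⊗ₘ w₂') ≫ n') :
    w ≫ k ≫ m ▷ _ ≫ n = w' ≫ k' ≫ m' ▷ _ ≫ n' := by
  rw [id_tensorHom, id_tensorHom] at hn
  rw [← subst_let_aux e, ← subst_let_aux e', hm, hn]

theorem coh_tensor_aux {H₀ H H₁ H₂ K₁ K₂ H' H₁' H₂' A B : C} {w : H₀ ⟶ H} {w' : H₀ ⟶ H'}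
    {k : H ⟶ H₁ ⊗ H₂} {k' : H' ⟶ H₁' ⊗ H₂'} {k₀ : H₀ ⟶ K₁ ⊗ K₂} {w₁ : K₁ ⟶ H₁} {w₂ : K₂ ⟶ H₂}
    {w₁' : K₁ ⟶ H₁'} {w₂' : K₂ ⟶ H₂'} (e : w ≫ k = k₀ ≫ (w₁ ⊗ₘ w₂))
    (e' : w' ≫ k' = k₀ ≫ (w₁' ⊗ₘ w₂')) {m : H₁ ⟶ A} {m' : H₁' ⟶ A}
    {n : H₂ ⟶ B} {n' : H₂' ⟶ B} (hm : w₁ ≫ m = w₁' ≫ m') (hn : w₂ ≫ n = w₂' ≫ n') :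
    w ≫ k ≫ (m ⊗ₘ n) = w' ≫ k' ≫ (m' ⊗ₘ n') := by
  rw [← subst_tensor_aux e, ← subst_tensor_aux e', hm, hn]

theorem coh_seq_aux {K₂ H₂ H₂' D : C} {w₂ : K₂ ⟶ H₂} {w₂' : K₂ ⟶ H₂'} {n : H₂ ⟶ D}
    {n' : H₂' ⟶ D} (hn : w₂ ≫ n = w₂' ≫ n') :
    (𝟙 _ ⊗ₘ w₂) ≫ (λ_ _).hom ≫ n = (𝟙 _ ⊗ₘ w₂') ≫ (λ_ _).hom ≫ n' := by
  rw [id_tensorHom, id_tensorHom, leftUnitor_naturality_assoc, leftUnitor_naturality_assoc, hn]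

theorem coh_letPair_aux {A B K₂ H₂ H₂' D : C} {w₂ : K₂ ⟶ H₂} {w₂' : K₂ ⟶ H₂'}
    {n : B ⊗ A ⊗ H₂ ⟶ D} {n' : B ⊗ A ⊗ H₂' ⟶ D}
    (hn : (𝟙 B ⊗ₘ (𝟙 A ⊗ₘ w₂)) ≫ n = (𝟙 B ⊗ₘ (𝟙 A ⊗ₘ w₂')) ≫ n') :
    (𝟙 (A ⊗ B) ⊗ₘ w₂) ≫ (β_ A B).hom ▷ _ ≫ (α_ _ _ _).hom ≫ n =
      (𝟙 (A ⊗ B) ⊗ₘ w₂') ≫ (β_ A B).hom ▷ _ ≫ (α_ _ _ _).hom ≫ n' := by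
  simp only [id_tensorHom] at hn ⊢
  rw [← subst_letPair_aux, ← subst_letPair_aux, hn]

theorem coh_lam_aux [MonoidalClosed C] {A K H H' D : C} {w : K ⟶ H} {w' : K ⟶ H'}
    {n : A ⊗ H ⟶ D} {n' : A ⊗ H' ⟶ D} (hn : (𝟙 A ⊗ₘ w) ≫ n = (𝟙 A ⊗ₘ w') ≫ n') :
    w ≫ MonoidalClosed.curry n = w' ≫ MonoidalClosed.curry n' := by
  simp only [id_tensorHom] at hn
  rw [← MonoidalClosed.curry_natural_left, ← MonoidalClosed.curry_natural_left, hn]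

theorem coh_comp_aux {H₀ H H' A B : C} {w : H₀ ⟶ H} {w' : H₀ ⟶ H'} {m : H ⟶ A} {m' : H' ⟶ A}
    (h : w ≫ m = w' ≫ m') (f : A ⟶ B) : w ≫ m ≫ f = w' ≫ m' ≫ f := by
  rw [← Category.assoc, h, Category.assoc]

theorem coh_lift_aux (B : C ⥤ C) {H₀ H H' A : C} {w : H₀ ⟶ H} {w' : H₀ ⟶ H'} {m : H ⟶ A}
    {m' : H' ⟶ A} {l : H ⟶ B.obj H} {l' : H' ⟶ B.obj H'} {l₀ : H₀ ⟶ B.obj H₀}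
    (hl : w ≫ l = l₀ ≫ B.map w) (hl' : w' ≫ l' = l₀ ≫ B.map w') (h : w ≫ m = w' ≫ m') :
    w ≫ l ≫ B.map m = w' ≫ l' ≫ B.map m' := by
  rw [reassoc_of% hl, reassoc_of% hl', ← B.map_comp, ← B.map_comp, h]

theorem coh_braid_aux {A K H H' D : C} {w : K ⟶ H} {w' : K ⟶ H'}
    {n : A ⊗ H ⟶ D} {n' : A ⊗ H' ⟶ D} (hn : (𝟙 A ⊗ₘ w) ≫ n = (𝟙 A ⊗ₘ w') ≫ n') :
    w ▷ A ≫ (β_ _ _).hom ≫ n = w' ▷ A ≫ (β_ _ _).hom ≫ n' := by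
  simp only [id_tensorHom] at hn
  rw [BraidedCategory.braiding_naturality_left_assoc,
    BraidedCategory.braiding_naturality_left_assoc, hn]

end Auxiliary

namespace Interp

open Functor.Monoidal

variable {V : Type u₁} [Category.{v₁} V] [CartesianMonoidalCategory V] [BraidedCategory V]
  [MonoidalClosed V] [HasFiniteCoproducts V]
  {C : Type u₂} [Category.{v₂} C] [MonoidalCategory C] [SymmetricCategory C]
  [MonoidalClosed C] [HasFiniteCoproducts C]
  {M : Type u₃} [Category.{v₃} M] [MonoidalCategory M] [SymmetricCategory M]
  {X : Interp V C M} {δ : Prop} {K : Type k} {W : Type w} {i : W → M}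

theorem coh_case_aux {A B K₂ H₂ H₂' D : C} {w : K₂ ⟶ H₂} {w' : K₂ ⟶ H₂'}
    {n : A ⊗ H₂ ⟶ D} {n' : A ⊗ H₂' ⟶ D} {p : B ⊗ H₂ ⟶ D} {p' : B ⊗ H₂' ⟶ D}
    (hn : (𝟙 A ⊗ₘ w) ≫ n = (𝟙 A ⊗ₘ w') ≫ n') (hp : (𝟙 B ⊗ₘ w) ≫ p = (𝟙 B ⊗ₘ w') ≫ p') :
    (𝟙 (A ⨿ B) ⊗ₘ w) ≫ caseMap n p = (𝟙 (A ⨿ B) ⊗ₘ w') ≫ caseMap n' p' := by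
  simp only [id_tensorHom] at hn hp ⊢
  rw [whiskerLeft_caseMap, whiskerLeft_caseMap, hn, hp]

variable {cty : K → Ty δ W} (cst : X.Constants i cty)

/-- Two splittings of contexts, for the typing of the same terms, can be replaced by the same
splitting of a larger context, in which all intuitionistic variables are duplicated and the linear
variables of `m` go to the left. -/
theorem exists_common {Γ₀ Γ Γ₁ Γ₂ Γ' Γ₁' Γ₂' : Ctx δ W} (w : Weaken Γ₀ Γ) (w' : Weaken Γ₀ Γ')
    (cs : CSplit Γ Γ₁ Γ₂) (cs' : CSplit Γ' Γ₁' Γ₂') {P P' : LCtx W} {m : Term δ K i}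
    {A A' : Ty δ W} (d : Deriv cty Γ₁ P m A) (d' : Deriv cty Γ₁' P' m A') :
    ∃ (Δ₁ Δ₂ : Ctx δ W) (cs₀ : CSplit Γ₀ Δ₁ Δ₂) (w₁ : Weaken Δ₁ Γ₁) (w₂ : Weaken Δ₂ Γ₂)
      (w₁' : Weaken Δ₁ Γ₁') (w₂' : Weaken Δ₂ Γ₂'), ∀ {Q Q₁ Q₂ : LCtx W} (ls : LSplit Q Q₁ Q₂),
      X.weaken i w Q ≫ X.fullSplit i ls cs =
          X.fullSplit i ls cs₀ ≫ (X.weaken i w₁ Q₁ ⊗ₘ X.weaken i w₂ Q₂) ∧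
        X.weaken i w' Q ≫ X.fullSplit i ls cs' =
          X.fullSplit i ls cs₀ ≫ (X.weaken i w₁' Q₁ ⊗ₘ X.weaken i w₂' Q₂) := by
  have key : ∀ {Γ Γ₁ Γ₂ : Ctx δ W} (w : Weaken Γ₀ Γ) (cs : CSplit Γ Γ₁ Γ₂) {P : LCtx W}
      {A : Ty δ W} (d : Deriv cty Γ₁ P m A),
      ∃ (cs₀ : CSplit Γ₀ (Γ₀.part (m.Linear cty)) (Γ₀.part fun n => ¬ m.Linear cty n))
      (w₁ : Weaken (Γ₀.part (m.Linear cty)) Γ₁)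
      (w₂ : Weaken (Γ₀.part fun n => ¬ m.Linear cty n) Γ₂),
      ∀ {Q Q₁ Q₂ : LCtx W} (ls : LSplit Q Q₁ Q₂),
        X.weaken i w Q ≫ X.fullSplit i ls cs =
          X.fullSplit i ls cs₀ ≫ (X.weaken i w₁ Q₁ ⊗ₘ X.weaken i w₂ Q₂) := by
    intro Γ Γ₁ Γ₂ w cs P A d
    refine exists_part w cs (m.Linear cty) (fun n B hB h => ⟨_, _, _, _, ⟨d⟩, h, hB⟩) ?_
    -- A linear variable in the right part is absent from the left part, where `m` is typed, and so
    -- cannot be a linear variable of `m`.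
    rintro n B hB h ⟨Γ', Q', A', B', ⟨d'⟩, h', hB'⟩
    exact d'.linear_used d hB' h' (cs.getElem?_left hB h)
  obtain ⟨cs₀, w₁, w₂, e⟩ := key w cs d
  obtain ⟨cs₀', w₁', w₂', e'⟩ := key w' cs' d'
  obtain rfl := CSplit.unique cs₀ cs₀'
  exact ⟨_, _, cs₀, w₁, w₂, w₁', w₂', fun ls => ⟨e ls, e' ls⟩⟩

/-- Coherence, in the form that can be proved by induction: derivations that type a term in
contexts obtained from the same context by dropping intuitionistic variables. The types are part of
the conclusion, as the type of an eliminated subterm is not determined by the judgement; this is the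
reason for the heterogeneous equality. -/
theorem weaken_den_unique {Γ : Ctx δ W} {Q : LCtx W} {m : Term δ K i} {A : Ty δ W}
    (d : Deriv cty Γ Q m A) : ∀ {Γ₀ Γ' : Ctx δ W} {Q' : LCtx W} {A' : Ty δ W}
      (d' : Deriv cty Γ' Q' m A') (w : Weaken Γ₀ Γ) (w' : Weaken Γ₀ Γ'), Q = Q' →
      A = A' ∧ X.weaken i w Q ≫ X.den cst d ≍ X.weaken i w' Q' ≫ X.den cst d' := by
  induction d with
  | var l =>
    intro Γ₀ Γ' Q' A' d' w w' hQ
    cases d' with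
    | var l' =>
      obtain ⟨l₀, e⟩ := weaken_lookup (X := X) (i := i) w l
      obtain ⟨l₀', e'⟩ := weaken_lookup (X := X) (i := i) w' l'
      obtain ⟨rfl, h⟩ := l₀.unique l₀'
      cases h
      rw [den_var, den_var, e, e']
      exact ⟨rfl, .rfl⟩
  | const hΓ c =>
    intro Γ₀ Γ' Q' A' d' w w' hQ
    cases d' with
    | const hΓ' =>
      refine ⟨rfl, heq_of_eq ?_⟩
      rw [den_const, den_const]
      exact coh_comp_aux ((weaken_proj w hΓ _).trans (weaken_proj w' hΓ' _).symm) _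
  | star hΓ =>
    intro Γ₀ Γ' Q' A' d' w w' hQ
    cases d' with
    | star hΓ' =>
      refine ⟨rfl, heq_of_eq ?_⟩
      rw [den_star, den_star]
      exact (weaken_proj w hΓ _).trans (weaken_proj w' hΓ' _).symm
  | label h hΓ l α =>
    intro Γ₀ Γ' Q' A' d' w w' hQ
    cases d' with
    | label _ hΓ' _ α' =>
      have : α = α' := by simpa [LCtx.single] using hQ
      subst this
      refine ⟨rfl, heq_of_eq ?_⟩
      rw [den_label, den_label]
      exact coh_comp_aux ((weaken_proj w hΓ _).trans (weaken_proj w' hΓ' _).symm) _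
  | boxed h hΓ da S db =>
    intro Γ₀ Γ' Q' A' d' w w' hQ
    cases d' with
    | boxed _ hΓ' da' _ db' =>
      obtain ⟨rfl, h₁⟩ := da.unique da' rfl
      obtain ⟨rfl, h₂⟩ := db.unique db' rfl
      cases h₁; cases h₂
      refine ⟨rfl, heq_of_eq ?_⟩
      rw [den_boxed, den_boxed]
      exact coh_comp_aux ((weaken_proj w hΓ _).trans (weaken_proj w' hΓ' _).symm) _
  | abort dm ihm =>
    intro Γ₀ Γ' Q' A' d' w w' hQ
    cases d' with
    | abort dm' =>
      subst hQ
      obtain ⟨-, e⟩ := ihm dm' w w' rfl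
      refine ⟨rfl, heq_of_eq ?_⟩
      rw [den_abort, den_abort]
      exact coh_comp_aux (eq_of_heq e) _
  | inl dm ihm =>
    intro Γ₀ Γ' Q' A' d' w w' hQ
    cases d' with
    | inl dm' =>
      subst hQ
      obtain ⟨-, e⟩ := ihm dm' w w' rfl
      refine ⟨rfl, heq_of_eq ?_⟩
      rw [den_inl, den_inl]
      exact coh_comp_aux (eq_of_heq e) _
  | inr dm ihm =>
    intro Γ₀ Γ' Q' A' d' w w' hQ
    cases d' with
    | inr dm' =>
      subst hQ
      obtain ⟨-, e⟩ := ihm dm' w w' rfl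
      refine ⟨rfl, heq_of_eq ?_⟩
      rw [den_inr, den_inr]
      exact coh_comp_aux (eq_of_heq e) _
  | force dm ihm =>
    intro Γ₀ Γ' Q' A' d' w w' hQ
    cases d' with
    | force dm' =>
      subst hQ
      obtain ⟨hA, e⟩ := ihm dm' w w' rfl
      cases hA
      refine ⟨rfl, heq_of_eq ?_⟩
      rw [den_force, den_force]
      exact coh_comp_aux (eq_of_heq e) _
  | box h dm ihm =>
    intro Γ₀ Γ' Q' A' d' w w' hQ
    cases d' with
    | box _ dm' =>
      subst hQ
      obtain ⟨hA, e⟩ := ihm dm' w w' rfl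
      simp only [Ty.bang.injEq, Ty.lolli.injEq, true_and] at hA
      obtain rfl := MTy.toTy_injective h hA
      refine ⟨rfl, heq_of_eq ?_⟩
      rw [den_box, den_box]
      exact coh_comp_aux (eq_of_heq e) _
  | lam dm ihm =>
    intro Γ₀ Γ' Q' A' d' w w' hQ
    cases d' with
    | lam dm' =>
      subst hQ
      obtain ⟨rfl, e⟩ := ihm dm' (.cons (.keep _) w) (.cons (.keep _) w') rfl
      refine ⟨rfl, heq_of_eq ?_⟩
      rw [den_lam, den_lam]
      exact coh_lam_aux (eq_of_heq e)
  | lift hΓ dm ihm =>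
    intro Γ₀ Γ' Q' A' d' w w' hQ
    cases d' with
    | lift hΓ' dm' =>
      obtain ⟨rfl, e⟩ := ihm dm' w w' rfl
      refine ⟨rfl, heq_of_eq ?_⟩
      rw [den_lift, den_lift]
      exact coh_lift_aux X.bang (weaken_isIntuit w hΓ).comp_lift
        (weaken_isIntuit w' hΓ').comp_lift (eq_of_heq e)
  | fix hΓ dm ihm =>
    intro Γ₀ Γ' Q' A' d' w w' hQ
    cases d' with
    | fix hΓ' dm' =>
      obtain ⟨-, e⟩ := ihm dm' (.cons (.keep _) w) (.cons (.keep _) w') rfl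
      refine ⟨rfl, heq_of_eq ?_⟩
      rw [den_fix, den_fix]
      refine ((weaken_isIntuit w hΓ).comp_gamma_sigma _).trans (.trans ?_
        ((weaken_isIntuit w' hΓ').comp_gamma_sigma _).symm)
      exact congrArg (fun k => X.gamma _ ≫ X.sigma k) (coh_braid_aux (eq_of_heq e))
  | letIn cs ls dm dn ihm ihn =>
    intro Γ₀ Γ' Q' A' d' w w' hQ
    cases d' with
    | letIn cs' ls' dm' dn' =>
      subst hQ
      -- Both derivations type the second subterm, and so split the labels in the same way.
      obtain ⟨rfl, rfl, hls⟩ := LSplit.unique ls ls'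
        (fun l h h' => LSplit.disjoint ls h ((dn.mem_labels_iff dn' l).2 h'))
        (fun l h h' => LSplit.disjoint ls' h' ((dn.mem_labels_iff dn' l).1 h))
      cases hls
      obtain ⟨Δ₁, Δ₂, cs₀, w₁, w₂, w₁', w₂', e⟩ :=
        exists_common (X := X) w w' cs cs' dm dm'
      obtain ⟨rfl, em⟩ := ihm dm' w₁ w₁' rfl
      obtain ⟨rfl, en⟩ := ihn dn' (.cons (.keep _) w₂) (.cons (.keep _) w₂') rfl
      refine ⟨rfl, heq_of_eq ?_⟩
      rw [den_letIn, den_letIn]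
      exact coh_let_aux (e ls).1 (e ls).2 (eq_of_heq em) (eq_of_heq en)
  | case cs ls dm dn dp ihm ihn ihp =>
    intro Γ₀ Γ' Q' A' d' w w' hQ
    cases d' with
    | case cs' ls' dm' dn' dp' =>
      subst hQ
      obtain ⟨rfl, rfl, hls⟩ := LSplit.unique ls ls'
        (fun l h h' => LSplit.disjoint ls h ((dn.mem_labels_iff dn' l).2 h'))
        (fun l h h' => LSplit.disjoint ls' h' ((dn.mem_labels_iff dn' l).1 h))
      cases hls
      obtain ⟨Δ₁, Δ₂, cs₀, w₁, w₂, w₁', w₂', e⟩ :=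
        exists_common (X := X) w w' cs cs' dm dm'
      obtain ⟨hA, em⟩ := ihm dm' w₁ w₁' rfl
      cases hA
      obtain ⟨rfl, en⟩ := ihn dn' (.cons (.keep _) w₂) (.cons (.keep _) w₂') rfl
      obtain ⟨-, ep⟩ := ihp dp' (.cons (.keep _) w₂) (.cons (.keep _) w₂') rfl
      refine ⟨rfl, heq_of_eq ?_⟩
      rw [den_case, den_case]
      exact coh_let_aux (e ls).1 (e ls).2 (eq_of_heq em)
        (coh_case_aux (eq_of_heq en) (eq_of_heq ep))
  | seq cs ls dm dn ihm ihn =>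
    intro Γ₀ Γ' Q' A' d' w w' hQ
    cases d' with
    | seq cs' ls' dm' dn' =>
      subst hQ
      obtain ⟨rfl, rfl, hls⟩ := LSplit.unique ls ls'
        (fun l h h' => LSplit.disjoint ls h ((dn.mem_labels_iff dn' l).2 h'))
        (fun l h h' => LSplit.disjoint ls' h' ((dn.mem_labels_iff dn' l).1 h))
      cases hls
      obtain ⟨Δ₁, Δ₂, cs₀, w₁, w₂, w₁', w₂', e⟩ :=
        exists_common (X := X) w w' cs cs' dm dm'
      obtain ⟨-, em⟩ := ihm dm' w₁ w₁' rfl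
      obtain ⟨rfl, en⟩ := ihn dn' w₂ w₂' rfl
      refine ⟨rfl, heq_of_eq ?_⟩
      rw [den_seq, den_seq]
      exact coh_let_aux (e ls).1 (e ls).2 (eq_of_heq em) (coh_seq_aux (eq_of_heq en))
  | pair cs ls dm dn ihm ihn =>
    intro Γ₀ Γ' Q' A' d' w w' hQ
    cases d' with
    | pair cs' ls' dm' dn' =>
      subst hQ
      obtain ⟨rfl, rfl, hls⟩ := LSplit.unique ls ls'
        (fun l h h' => LSplit.disjoint ls h ((dn.mem_labels_iff dn' l).2 h'))
        (fun l h h' => LSplit.disjoint ls' h' ((dn.mem_labels_iff dn' l).1 h))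
      cases hls
      obtain ⟨Δ₁, Δ₂, cs₀, w₁, w₂, w₁', w₂', e⟩ :=
        exists_common (X := X) w w' cs cs' dm dm'
      obtain ⟨rfl, em⟩ := ihm dm' w₁ w₁' rfl
      obtain ⟨rfl, en⟩ := ihn dn' w₂ w₂' rfl
      refine ⟨rfl, heq_of_eq ?_⟩
      rw [den_pair, den_pair]
      exact coh_tensor_aux (e ls).1 (e ls).2 (eq_of_heq em) (eq_of_heq en)
  | letPair cs ls dm dn ihm ihn =>
    intro Γ₀ Γ' Q' A' d' w w' hQ
    cases d' with
    | letPair cs' ls' dm' dn' =>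
      subst hQ
      obtain ⟨rfl, rfl, hls⟩ := LSplit.unique ls ls'
        (fun l h h' => LSplit.disjoint ls h ((dn.mem_labels_iff dn' l).2 h'))
        (fun l h h' => LSplit.disjoint ls' h' ((dn.mem_labels_iff dn' l).1 h))
      cases hls
      obtain ⟨Δ₁, Δ₂, cs₀, w₁, w₂, w₁', w₂', e⟩ :=
        exists_common (X := X) w w' cs cs' dm dm'
      obtain ⟨hA, em⟩ := ihm dm' w₁ w₁' rfl
      cases hA
      obtain ⟨rfl, en⟩ := ihn dn' (.cons (.keep _) (.cons (.keep _) w₂))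
        (.cons (.keep _) (.cons (.keep _) w₂')) rfl
      refine ⟨rfl, heq_of_eq ?_⟩
      rw [den_letPair, den_letPair]
      exact coh_let_aux (e ls).1 (e ls).2 (eq_of_heq em) (coh_letPair_aux (eq_of_heq en))
  | app cs ls dm dn ihm ihn =>
    intro Γ₀ Γ' Q' A' d' w w' hQ
    cases d' with
    | app cs' ls' dm' dn' =>
      subst hQ
      obtain ⟨rfl, rfl, hls⟩ := LSplit.unique ls ls'
        (fun l h h' => LSplit.disjoint ls h ((dn.mem_labels_iff dn' l).2 h'))
        (fun l h h' => LSplit.disjoint ls' h' ((dn.mem_labels_iff dn' l).1 h))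
      cases hls
      obtain ⟨Δ₁, Δ₂, cs₀, w₁, w₂, w₁', w₂', e⟩ :=
        exists_common (X := X) w w' cs cs' dm dm'
      obtain ⟨hA, em⟩ := ihm dm' w₁ w₁' rfl
      cases hA
      obtain ⟨-, en⟩ := ihn dn' w₂ w₂' rfl
      refine ⟨rfl, heq_of_eq ?_⟩
      rw [den_app, den_app, ← Category.assoc (X.fullSplit i ls cs),
        ← Category.assoc (X.fullSplit i ls cs')]
      exact coh_comp_aux (coh_tensor_aux (e ls).1 (e ls).2 (eq_of_heq em) (eq_of_heq en)) _
  | apply h cs ls dm dn ihm ihn =>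
    intro Γ₀ Γ' Q' A' d' w w' hQ
    cases d' with
    | apply _ cs' ls' dm' dn' =>
      subst hQ
      obtain ⟨rfl, rfl, hls⟩ := LSplit.unique ls ls'
        (fun l h h' => LSplit.disjoint ls h ((dn.mem_labels_iff dn' l).2 h'))
        (fun l h h' => LSplit.disjoint ls' h' ((dn.mem_labels_iff dn' l).1 h))
      cases hls
      obtain ⟨Δ₁, Δ₂, cs₀, w₁, w₂, w₁', w₂', e⟩ :=
        exists_common (X := X) w w' cs cs' dm dm'
      obtain ⟨hA, em⟩ := ihm dm' w₁ w₁' rfl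
      cases hA
      obtain ⟨-, en⟩ := ihn dn' w₂ w₂' rfl
      refine ⟨rfl, heq_of_eq ?_⟩
      rw [den_apply, den_apply, ← Category.assoc (X.fullSplit i ls cs),
        ← Category.assoc (X.fullSplit i ls cs')]
      exact coh_comp_aux (coh_tensor_aux (e ls).1 (e ls).2 (eq_of_heq em)
        (coh_comp_aux (eq_of_heq en) _)) _

/-- Coherence: all derivations of a judgement have the same interpretation. -/
theorem deriv_unique {Γ : Ctx δ W} {Q : LCtx W} {m : Term δ K i} {A : Ty δ W}
    (d d' : Deriv cty Γ Q m A) : X.deriv i cst d = X.deriv i cst d' := by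
  obtain ⟨-, e⟩ := weaken_den_unique cst d d' (Weaken.refl Γ) (Weaken.refl Γ) rfl
  rw [weaken_refl, Category.id_comp, Category.id_comp] at e
  rw [deriv_eq, deriv_eq, eq_of_heq e]

end Interp

end LNL

namespace LNL

/-! ### String diagrams and label tuples -/

theorem Ctx.intuit_nil {δ : Prop} {W : Type w} : Ctx.Intuit ([] : Ctx δ W) := trivial

namespace Interp

open Functor.Monoidal

variable {V : Type u₁} [Category.{v₁} V] [CartesianMonoidalCategory V] [BraidedCategory V]
  [MonoidalClosed V] [HasFiniteCoproducts V]
  {C : Type u₂} [Category.{v₂} C] [MonoidalCategory C] [SymmetricCategory C]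
  [MonoidalClosed C] [HasFiniteCoproducts C]
  {M : Type u₃} [Category.{v₃} M] [MonoidalCategory M] [SymmetricCategory M]
  (X : Interp V C M) {δ : Prop} {K : Type k} {W : Type w} (i : W → M)

/-- `⟦T⟧` is the image under `E` of the interpretation of `T` in the category of diagrams. -/
def mtyMapIso : (T : MTy W) → (T.obj (X.wire i) ≅ X.E.obj (T.obj i))
  | .wire _ => Iso.refl _
  | .one => εIso X.E
  | .tensor T U => (mtyMapIso T ⊗ᵢ mtyMapIso U) ≪≫ μIso X.E _ _

variable {X i}

section Auxiliary

variable {D : Type u₁} [Category.{v₁} D] [MonoidalCategory D] [SymmetricCategory D]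

theorem entriesIso_nil_aux (E : M ⥤ D) [E.Braided] :
    (λ_ (𝟙_ D)).inv ≫ (Functor.LaxMonoidal.ε E ⊗ₘ Functor.LaxMonoidal.ε E) ≫
      Functor.LaxMonoidal.μ E _ _ = Functor.LaxMonoidal.ε E ≫ E.map (λ_ (𝟙_ M)).inv := by
  rw [← Functor.LaxMonoidal.left_unitality_inv, MonoidalCategory.tensorHom_def', Category.assoc,
    leftUnitor_inv_naturality_assoc]

theorem entriesIso_left_aux (E : M ⥤ D) [E.Braided] {x l l₁ l₂ : M} {L L₁ L₂ : D} {e : L ⟶ E.obj l}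
    {e₁ : L₁ ⟶ E.obj l₁} {e₂ : L₂ ⟶ E.obj l₂} {s : l ⟶ l₁ ⊗ l₂} {S : L ⟶ L₁ ⊗ L₂}
    (h : S ≫ (e₁ ⊗ₘ e₂) ≫ Functor.LaxMonoidal.μ E _ _ = e ≫ E.map s) :
    (E.obj x ◁ S ≫ (α_ _ _ _).inv) ≫ ((E.obj x ◁ e₁ ≫ Functor.LaxMonoidal.μ E _ _) ⊗ₘ e₂) ≫
        Functor.LaxMonoidal.μ E _ _ =
      (E.obj x ◁ e ≫ Functor.LaxMonoidal.μ E _ _) ≫ E.map (x ◁ s ≫ (α_ _ _ _).inv) := by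
  have h' := congrArg (fun k => E.obj x ◁ k) h
  simp only [MonoidalCategory.whiskerLeft_comp] at h'
  simp only [E.map_comp, Category.assoc]
  rw [← Functor.LaxMonoidal.μ_natural_right_assoc, ← reassoc_of% h',
    Functor.LaxMonoidal.associativity_inv]
  simp only [MonoidalCategory.tensorHom_def, MonoidalCategory.whiskerLeft_comp,
    comp_whiskerRight, Category.assoc, associator_inv_naturality_right_assoc,
    associator_inv_naturality_middle_assoc, whisker_exchange_assoc]

theorem entriesIso_right_aux (E : M ⥤ D) [E.Braided] {x l l₁ l₂ : M} {L L₁ L₂ : D}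
    {e : L ⟶ E.obj l}
    {e₁ : L₁ ⟶ E.obj l₁} {e₂ : L₂ ⟶ E.obj l₂} {s : l ⟶ l₁ ⊗ l₂} {S : L ⟶ L₁ ⊗ L₂}
    (h : S ≫ (e₁ ⊗ₘ e₂) ≫ Functor.LaxMonoidal.μ E _ _ = e ≫ E.map s) :
    (E.obj x ◁ S ≫ (α_ _ _ _).inv ≫ (β_ _ _).hom ▷ _ ≫ (α_ _ _ _).hom) ≫
        (e₁ ⊗ₘ (E.obj x ◁ e₂ ≫ Functor.LaxMonoidal.μ E _ _)) ≫
        Functor.LaxMonoidal.μ E _ _ =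
      (E.obj x ◁ e ≫ Functor.LaxMonoidal.μ E _ _) ≫
        E.map (x ◁ s ≫ (α_ _ _ _).inv ≫ (β_ _ _).hom ▷ _ ≫ (α_ _ _ _).hom) := by
  have h' := congrArg (fun k => E.obj x ◁ k) h
  simp only [MonoidalCategory.whiskerLeft_comp] at h'
  have hb : Functor.LaxMonoidal.μ E x l₁ ▷ E.obj l₂ ≫ E.map (β_ x l₁).hom ▷ E.obj l₂ =
      (β_ _ _).hom ▷ E.obj l₂ ≫ Functor.LaxMonoidal.μ E l₁ x ▷ E.obj l₂ := by
    rw [← comp_whiskerRight, ← comp_whiskerRight, Functor.LaxBraided.braided]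
  simp only [E.map_comp, Category.assoc]
  rw [← Functor.LaxMonoidal.μ_natural_right_assoc, ← reassoc_of% h',
    Functor.LaxMonoidal.associativity_inv_assoc, ← Functor.LaxMonoidal.μ_natural_left_assoc,
    reassoc_of% hb, Functor.LaxMonoidal.associativity]
  have hn : E.obj x ◁ e₁ ▷ L₂ ≫ E.obj x ◁ E.obj l₁ ◁ e₂ ≫ (α_ _ _ _).inv ≫
      (β_ (E.obj x) (E.obj l₁)).hom ▷ E.obj l₂ ≫ (α_ _ _ _).hom =
      (α_ _ _ _).inv ≫ (β_ (E.obj x) L₁).hom ▷ L₂ ≫ (α_ _ _ _).hom ≫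
        e₁ ▷ (E.obj x ⊗ L₂) ≫ E.obj l₁ ◁ E.obj x ◁ e₂ := by
    rw [associator_inv_naturality_right_assoc, associator_inv_naturality_middle_assoc,
      whisker_exchange_assoc, ← comp_whiskerRight_assoc, BraidedCategory.braiding_naturality_right]
    simp
  simp only [MonoidalCategory.tensorHom_def, MonoidalCategory.whiskerLeft_comp, Category.assoc,
    reassoc_of% hn]

theorem mtyMapIso_pair_aux (E : M ⥤ D) [E.Braided] {q q₁ q₂ t u : M} {L L₁ L₂ T U : D}
    {e : L ⟶ E.obj q}
    {e₁ : L₁ ⟶ E.obj q₁} {e₂ : L₂ ⟶ E.obj q₂} {s : q ⟶ q₁ ⊗ q₂} {S : L ⟶ L₁ ⊗ L₂}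
    (h : S ≫ (e₁ ⊗ₘ e₂) ≫ Functor.LaxMonoidal.μ E _ _ = e ≫ E.map s)
    {a : L₁ ⟶ T} {b : L₂ ⟶ U} {a' : q₁ ⟶ t} {b' : q₂ ⟶ u} {j : T ⟶ E.obj t} {k : U ⟶ E.obj u}
    (ha : a ≫ j = e₁ ≫ E.map a') (hb : b ≫ k = e₂ ≫ E.map b') :
    (S ≫ (a ⊗ₘ b)) ≫ (j ⊗ₘ k) ≫ Functor.LaxMonoidal.μ E _ _ = e ≫ E.map (s ≫ (a' ⊗ₘ b')) := by
  rw [E.map_comp, ← reassoc_of% h, ← Functor.LaxMonoidal.μ_natural, Category.assoc,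
    tensorHom_comp_tensorHom_assoc, ha, hb, tensorHom_comp_tensorHom_assoc]

theorem tensor_comp_aux {L L₁ L₂ T U T' U' : D} (s : L ⟶ L₁ ⊗ L₂) (a : L₁ ⟶ T) (b : L₂ ⟶ U)
    (j : T ⟶ T') (k : U ⟶ U') : s ≫ ((a ≫ j) ⊗ₘ (b ≫ k)) = (s ≫ (a ⊗ₘ b)) ≫ (j ⊗ₘ k) := by
  simp

theorem mtyMapIso_label_aux (E : M ⥤ D) [E.Braided] (x : M) :
    (ρ_ (E.obj x)).hom ≫ 𝟙 _ = (E.obj x ◁ Functor.LaxMonoidal.ε E ≫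
      Functor.LaxMonoidal.μ E _ _) ≫ E.map (ρ_ x).hom := by
  simp

theorem diagram_comp_aux (E : M ⥤ D) {q q' q'' : M} {L L' L'' : D} (e : L ≅ E.obj q)
    (e' : L' ≅ E.obj q') (e'' : L'' ≅ E.obj q'') (f : q ⟶ q') (g : q' ⟶ q'') :
    e.hom ≫ E.map (f ≫ g) ≫ e''.inv =
      (e.hom ≫ E.map f ≫ e'.inv) ≫ e'.hom ≫ E.map g ≫ e''.inv := by
  simp

theorem diagram_iso_aux (E : M ⥤ D) {q q' t : M} {L L' T : D} {e : L ≅ E.obj q}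
    {e' : L' ≅ E.obj q'} {d : q ≅ t} {d' : q' ≅ t} {c : L ≅ T} {c' : L' ≅ T} {j : T ⟶ E.obj t}
    (h : c.hom ≫ j = e.hom ≫ E.map d.hom) (h' : c'.hom ≫ j = e'.hom ≫ E.map d'.hom) :
    e.hom ≫ E.map (d.hom ≫ d'.inv) ≫ e'.inv = c.hom ≫ c'.inv := by
  have hj : j = c'.inv ≫ e'.hom ≫ E.map d'.hom := by rw [← h', Iso.inv_hom_id_assoc]
  rw [E.map_comp, Category.assoc, ← reassoc_of% h, hj]
  simp only [Category.assoc]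
  rw [← E.map_comp_assoc, Iso.hom_inv_id, CategoryTheory.Functor.map_id, Category.id_comp,
    Iso.hom_inv_id, Category.comp_id]

theorem diagram_split_aux (E : M ⥤ D) [E.Braided] {r r' q q' p : M} {R R' Q Q' P : D}
    {er : R ≅ E.obj r} {er' : R' ≅ E.obj r'} {eq : Q ≅ E.obj q} {eq' : Q' ≅ E.obj q'}
    {ep : P ≅ E.obj p} {s : r ≅ q ⊗ p} {s' : r' ≅ q' ⊗ p} {S : R ≅ Q ⊗ P} {S' : R' ≅ Q' ⊗ P}
    (h : S.hom ≫ (eq.hom ⊗ₘ ep.hom) ≫ Functor.LaxMonoidal.μ E _ _ = er.hom ≫ E.map s.hom)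
    (h' : S'.hom ≫ (eq'.hom ⊗ₘ ep.hom) ≫ Functor.LaxMonoidal.μ E _ _ = er'.hom ≫ E.map s'.hom)
    (x : q ⟶ q') :
    er.hom ≫ E.map (s.hom ≫ x ▷ _ ≫ s'.inv) ≫ er'.inv =
      S.hom ≫ (eq.hom ≫ E.map x ≫ eq'.inv) ▷ _ ≫ S'.inv := by
  have h'' : er'.hom = S'.hom ≫ (eq'.hom ⊗ₘ ep.hom) ≫ Functor.LaxMonoidal.μ E _ _ ≫
      E.map s'.inv := by
    rw [reassoc_of% h', ← E.map_comp, Iso.hom_inv_id, CategoryTheory.Functor.map_id,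
      Category.comp_id]
  rw [← cancel_mono er'.hom]
  simp only [Category.assoc, Iso.inv_hom_id, Category.comp_id]
  rw [h'']
  simp only [E.map_comp, Iso.inv_hom_id_assoc]
  rw [← reassoc_of% h, ← Functor.LaxMonoidal.μ_natural_left_assoc]
  simp only [← Category.assoc]
  congr 2
  simp [MonoidalCategory.tensorHom_def, whisker_exchange]

end Auxiliary

/-- `E` preserves the splitting of label contexts, because it is a symmetric monoidal functor. -/
theorem iso_entriesIso {l l₁ l₂ : List (ℕ × W)} (s : Interleave l l₁ l₂) :
    (s.iso (X.wire i)).hom ≫ ((X.entriesIso i l₁).hom ⊗ₘ (X.entriesIso i l₂).hom) ≫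
        Functor.LaxMonoidal.μ X.E _ _ = (X.entriesIso i l).hom ≫ X.E.map (s.iso i).hom := by
  induction s with
  | nil => exact entriesIso_nil_aux X.E
  | left s ih => exact entriesIso_left_aux X.E ih
  | right s ih => exact entriesIso_right_aux X.E ih

/-- `E` preserves the interpretation of label tuples. -/
theorem iso_mtyMapIso {Q : LCtx W} {a : LTuple} {T : MTy W} (d : LTyping Q a T) :
    (d.iso (X.wire i)).hom ≫ (X.mtyMapIso i T).hom =
      (X.entriesIso i Q.entries).hom ≫ X.E.map (d.iso i).hom := by
  induction d with
  | label l α => exact mtyMapIso_label_aux X.E (i α)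
  | unit =>
    refine (Category.id_comp _).trans ((Category.comp_id _).symm.trans ?_)
    exact congrArg (fun k => _ ≫ k) (X.E.map_id _).symm
  | pair s d e ihd ihe => exact mtyMapIso_pair_aux X.E (iso_entriesIso s) ihd ihe

theorem diagram_comp {Q Q' Q'' : LCtx W} (f : Q.obj i ⟶ Q'.obj i) (g : Q'.obj i ⟶ Q''.obj i) :
    X.diagram i (f ≫ g) = X.diagram i f ≫ X.diagram i g := by
  exact diagram_comp_aux X.E _ _ _ _ _

theorem diagram_id (Q : LCtx W) : X.diagram i (𝟙 (Q.obj i)) = 𝟙 (X.lctx i Q) := by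
  refine (congrArg (fun k => _ ≫ k ≫ _) (X.E.map_id (Q.obj i))).trans ?_
  refine (congrArg (fun k => _ ≫ k) (Category.id_comp _)).trans ?_
  exact Iso.hom_inv_id _

theorem diagram_iso {Q Q' : LCtx W} {a b : LTuple} {T : MTy W} (d : LTyping Q a T)
    (e : LTyping Q' b T) : X.diagram i ((d.iso i).hom ≫ (e.iso i).inv) =
      (d.iso (X.wire i)).hom ≫ (e.iso (X.wire i)).inv :=
  diagram_iso_aux X.E (iso_mtyMapIso d) (iso_mtyMapIso e)

/-- A diagram next to unused labels is interpreted as a tensor product. -/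
theorem diagram_split {R R' Q Q' P : LCtx W} (s : LSplit R Q P) (s' : LSplit R' Q' P)
    (x : Q.obj i ⟶ Q'.obj i) :
    X.diagram i ((LSplit.map i s).hom ≫ x ▷ _ ≫ (LSplit.map i s').inv) =
      (LSplit.map (X.wire i) s).hom ≫ X.diagram i x ▷ _ ≫ (LSplit.map (X.wire i) s').inv :=
  diagram_split_aux X.E (iso_entriesIso s) (iso_entriesIso s') x

section Tuples

variable {cty : K → Ty δ W} (cst : X.Constants i cty)

/-- Label tuples can be typed as terms. -/
theorem exists_deriv_of_ltyping (h : δ) {Q : LCtx W} {a : LTuple} {T : MTy W}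
    (d : LTyping Q a T) : ∃ d' : Deriv cty [] Q (a.toTerm h) (T.toTy h),
      X.den cst d' = (d.iso (X.wire i)).hom ≫ (X.mtyIso i h T).inv := by
  induction d with
  | label l α =>
    exact ⟨.label h Ctx.intuit_nil l α, (X.den_label cst h Ctx.intuit_nil l α).trans
      ((Category.id_comp _).trans (Category.comp_id _).symm)⟩
  | unit =>
    exact ⟨.star Ctx.intuit_nil, (X.den_star cst Ctx.intuit_nil).trans (Category.comp_id _).symm⟩
  | pair s d e ihd ihe =>
    obtain ⟨d', hd⟩ := ihd
    obtain ⟨e', he⟩ := ihe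
    refine ⟨.pair .nil s d' e', (X.den_pair cst .nil s d' e').trans ?_⟩
    refine (congrArg₂ (fun k l => _ ≫ (k ⊗ₘ l)) hd he).trans ?_
    exact tensor_comp_aux _ _ _ _ _

/-- Inversion of the typing of a label tuple as a term. -/
theorem exists_ltyping {h : δ} {Q : LCtx W} {a : LTuple} {A : Ty δ W}
    (d : Deriv cty [] Q (a.toTerm h : Term δ K i) A) : ∃ T : MTy W, A = T.toTy h ∧
      Nonempty (LTyping Q a T) := by
  induction a generalizing Q A with
  | label l =>
    cases d with
    | label _ _ _ α => exact ⟨.wire α, rfl, ⟨.label l α⟩⟩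
  | unit =>
    cases d with
    | star => exact ⟨.one, rfl, ⟨.unit⟩⟩
  | pair a b iha ihb =>
    cases d with
    | pair cs ls d e =>
      cases cs
      obtain ⟨T, rfl, ⟨d'⟩⟩ := iha d
      obtain ⟨U, rfl, ⟨e'⟩⟩ := ihb e
      exact ⟨.tensor T U, rfl, ⟨.pair ls d' e'⟩⟩

/-- The derivations of a label tuple as a term are those as a label tuple. -/
theorem exists_ltyping_den {h : δ} {Q : LCtx W} {a : LTuple} {T : MTy W}
    (d : Deriv cty [] Q (a.toTerm h : Term δ K i) (T.toTy h)) : ∃ d' : LTyping Q a T,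
      X.den cst d = (d'.iso (X.wire i)).hom ≫ (X.mtyIso i h T).inv := by
  obtain ⟨T', e, ⟨d'⟩⟩ := exists_ltyping d
  obtain rfl := MTy.toTy_injective h e
  obtain ⟨d'', e⟩ := exists_deriv_of_ltyping cst h d'
  refine ⟨d', ?_⟩
  rw [← e, den, den, deriv_unique cst d d'']

end Tuples

/-! ### Values -/

section Values

theorem isIntuit_inl {P R : C} {Y Z : V} (e : P ≅ X.F.obj Y) (e' : R ≅ X.F.obj Z) :
    haveI := X.adj.leftAdjoint_preservesColimits
    X.IsIntuit e (coprod.mapIso e e' ≪≫ PreservesColimitPair.iso X.F Y Z) coprod.inl := by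
  refine ⟨coprod.inl, ?_⟩
  rw [ofV, ← Category.assoc, Iso.eq_comp_inv]
  simp [PreservesColimitPair.iso_hom]

theorem isIntuit_inr {P R : C} {Y Z : V} (e : P ≅ X.F.obj Y) (e' : R ≅ X.F.obj Z) :
    haveI := X.adj.leftAdjoint_preservesColimits
    X.IsIntuit e' (coprod.mapIso e e' ≪≫ PreservesColimitPair.iso X.F Y Z) coprod.inr := by
  refine ⟨coprod.inr, ?_⟩
  rw [ofV, ← Category.assoc, Iso.eq_comp_inv]
  simp [PreservesColimitPair.iso_hom]

/-- The interpretation of `lift` is the promotion of `f` along the adjunction. -/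
theorem lift_bang_map {P A : C} {Y : V} (e : P ≅ X.F.obj Y) (f : P ⟶ A) :
    X.lift e ≫ X.bang.map f = e.hom ≫ X.F.map (X.adj.unit.app Y ≫ X.G.map (e.inv ≫ f)) := by
  simp [Interp.lift, CLNLModel.bang]

/-- Forcing a lifted term yields the term. -/
theorem lift_bang_map_counit {P A : C} {Y : V} (e : P ≅ X.F.obj Y) (f : P ⟶ A) :
    (X.lift e ≫ X.bang.map f) ≫ X.adj.counit.app A = f := by
  refine (congrArg (fun k => k ≫ X.adj.counit.app A) (lift_bang_map e f)).trans ?_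
  change (e.hom ≫ X.F.map (X.adj.unit.app Y ≫ X.G.map (e.inv ≫ f)) : P ⟶ X.F.obj (X.G.obj A)) ≫
    X.adj.counit.app A = f
  simp

end Values

end Interp

end LNL

namespace LNL

section Values

variable {δ : Prop} {K : Type k} {W : Type w} {M : Type u₃} [Category.{v₃} M]
  [MonoidalCategory M] {i : W → M}

/-- The results of evaluation. -/
inductive Term.IsVal : Term δ K i → Prop
  | const (c : K) : IsVal (.const c)
  | inl {A B : Ty δ W} {v : Term δ K i} (h : v.IsVal) : IsVal (.inl A B v)
  | inr {A B : Ty δ W} {v : Term δ K i} (h : v.IsVal) : IsVal (.inr A B v)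
  | star : IsVal .star
  | pair {v v' : Term δ K i} (h : v.IsVal) (h' : v'.IsVal) : IsVal (.pair v v')
  | lam (A : Ty δ W) (m : Term δ K i) : IsVal (.lam A m)
  | lift (m : Term δ K i) : IsVal (.lift m)
  | label (h : δ) (l : ℕ) : IsVal (.label h l)
  | boxed (h : δ) (a : LTuple) {Q Q' : LCtx W} (S : Q.obj i ⟶ Q'.obj i) (b : LTuple) :
      IsVal (.boxed h a S b)

theorem LTuple.isVal_toTerm (h : δ) (a : LTuple) : (a.toTerm h : Term δ K i).IsVal := by
  induction a with
  | label l => exact .label h l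
  | unit => exact .star
  | pair a b iha ihb => exact .pair iha ihb

theorem Eval.isVal [SymmetricCategory M] {S S' : LDiagram i} {m v : Term δ K i}
    (h : Eval S m S' v) : v.IsVal := by
  induction h with
  | const => exact .const _
  | inl _ ih => exact .inl ih
  | inr _ ih => exact .inr ih
  | star => exact .star
  | pair _ _ ih ih' => exact .pair ih ih'
  | lam => exact .lam _ _
  | lift => exact .lift _
  | label => exact .label _ _
  | boxed | box => exact .boxed _ _ _ _
  | apply => exact LTuple.isVal_toTerm _ _
  | letIn _ _ _ ih | caseInl _ _ _ ih | caseInr _ _ _ ih | seq _ _ _ ih | letPair _ _ _ ih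
  | app _ _ _ _ _ ih | force _ _ _ ih | fix _ ih => exact ih

end Values

section Auxiliary

variable {C : Type u₂} [Category.{v₂} C] [MonoidalCategory C] [SymmetricCategory C]

theorem frame_aux {R Q P Q₁ Q₂ N A B : C} {s : R ⟶ Q ⊗ P} {ls : Q ⟶ Q₁ ⊗ Q₂} {s₁ : R ⟶ Q₁ ⊗ N}
    {t : N ⟶ Q₂ ⊗ P} (e : s₁ ≫ Q₁ ◁ t = s ≫ ls ▷ _ ≫ (α_ _ _ _).hom) (m : Q₁ ⟶ A)
    (k : A ⊗ Q₂ ⟶ B) :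
    s ≫ (ls ≫ m ▷ _ ≫ k) ▷ P = s₁ ≫ m ▷ N ≫ A ◁ t ≫ (α_ _ _ _).inv ≫ k ▷ P := by
  rw [← whisker_exchange_assoc, reassoc_of% e]
  simp

theorem unary_aux {L R R' Q Q' P A B : C} {f : L ⟶ R} {s : R ⟶ Q ⊗ P} {m : Q ⟶ A} {f' : L ⟶ R'}
    {s' : R' ⟶ Q' ⊗ P} {m' : Q' ⟶ A} {k : A ⟶ B}
    (h : (f ≫ s ≫ m ▷ P) ≫ k ▷ P = (f' ≫ s' ≫ m' ▷ P) ≫ k ▷ P) :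
    f ≫ s ≫ (m ≫ k) ▷ P = f' ≫ s' ≫ (m' ≫ k) ▷ P := by
  simpa using h

theorem left_aux {L R Q P Q₁ Q₂ N A R' Q' Q₁' : C} {f : L ⟶ R} {f' : L ⟶ R'} {s : R ⟶ Q ⊗ P}
    {ls : Q ⟶ Q₁ ⊗ Q₂} {s₁ : R ⟶ Q₁ ⊗ N}
    {t : N ⟶ Q₂ ⊗ P} (e : s ≫ ls ▷ _ ≫ (α_ _ _ _).hom = s₁ ≫ Q₁ ◁ t)
    {s' : R' ⟶ Q' ⊗ P} {ls' : Q' ⟶ Q₁' ⊗ Q₂} {s₁' : R' ⟶ Q₁' ⊗ N}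
    (e' : s₁' ≫ Q₁' ◁ t = s' ≫ ls' ▷ _ ≫ (α_ _ _ _).hom) {m : Q₁ ⟶ A} {m' : Q₁' ⟶ A}
    (h : f ≫ s₁ ≫ m ▷ N = f' ≫ s₁' ≫ m' ▷ N) {B : C} (k : A ⊗ Q₂ ⟶ B) :
    f ≫ s ≫ (ls ≫ m ▷ _ ≫ k) ▷ P = f' ≫ s' ≫ (ls' ≫ m' ▷ _ ≫ k) ▷ P := by
  rw [frame_aux e.symm, frame_aux e', reassoc_of% h]

theorem right_aux {L R Q P Q₁ Q₂ A R' Q' Q₂' : C} {f : L ⟶ R} {f' : L ⟶ R'} {s : R ⟶ Q ⊗ P}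
    {ls : Q ⟶ Q₁ ⊗ Q₂} {t : Q ⟶ Q₂ ⊗ Q₁} (e : t = ls ≫ (β_ _ _).hom) {s' : R' ⟶ Q' ⊗ P}
    {ls' : Q' ⟶ Q₂' ⊗ Q₁} {t' : Q' ⟶ Q₁ ⊗ Q₂'} (e' : t' = ls' ≫ (β_ _ _).hom)
    {n : Q₂ ⟶ A} {n' : Q₂' ⟶ A} {B : C} {k : Q₁ ⊗ A ⟶ B}
    (h : f ≫ s ≫ (t ≫ n ▷ _ ≫ (β_ _ _).hom ≫ k) ▷ P =
      f' ≫ s' ≫ (ls' ≫ n' ▷ _ ≫ (β_ _ _).hom ≫ k) ▷ P) :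
    f ≫ s ≫ (ls ≫ Q₁ ◁ n ≫ k) ▷ P = f' ≫ s' ≫ (t' ≫ Q₁ ◁ n' ≫ k) ▷ P := by
  subst e e'
  simpa using h

theorem tensor_aux {L R R' R'' Q Q' Q'' P Q₁ Q₁' Q₂ Q₂' A B D : C} {f : L ⟶ R} {f' : L ⟶ R'}
    {f'' : L ⟶ R''} {s : R ⟶ Q ⊗ P} {s' : R' ⟶ Q' ⊗ P} {s'' : R'' ⟶ Q'' ⊗ P}
    {ls : Q ⟶ Q₁ ⊗ Q₂} {ls' : Q' ⟶ Q₁' ⊗ Q₂} {ls'' : Q'' ⟶ Q₁' ⊗ Q₂'} {m : Q₁ ⟶ A}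
    {m' : Q₁' ⟶ A} {n : Q₂ ⟶ B} {n' : Q₂' ⟶ B} {k : A ⊗ B ⟶ D}
    (h : f ≫ s ≫ (ls ≫ m ▷ _ ≫ A ◁ n ≫ k) ▷ P = f' ≫ s' ≫ (ls' ≫ m' ▷ _ ≫ A ◁ n ≫ k) ▷ P)
    (h' : f' ≫ s' ≫ (ls' ≫ Q₁' ◁ n ≫ m' ▷ _ ≫ k) ▷ P =
      f'' ≫ s'' ≫ (ls'' ≫ Q₁' ◁ n' ≫ m' ▷ _ ≫ k) ▷ P) :
    f ≫ s ≫ (ls ≫ (m ⊗ₘ n) ≫ k) ▷ P = f'' ≫ s'' ≫ (ls'' ≫ (m' ⊗ₘ n') ≫ k) ▷ P := by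
  rw [MonoidalCategory.tensorHom_def, Category.assoc, h, ← whisker_exchange_assoc, h',
    MonoidalCategory.tensorHom_def', Category.assoc]

end Auxiliary

namespace Interp

open Functor.Monoidal

variable {V : Type u₁} [Category.{v₁} V] [CartesianMonoidalCategory V] [BraidedCategory V]
  [MonoidalClosed V] [HasFiniteCoproducts V]
  {C : Type u₂} [Category.{v₂} C] [MonoidalCategory C] [SymmetricCategory C]
  [MonoidalClosed C] [HasFiniteCoproducts C]
  {M : Type u₃} [Category.{v₃} M] [MonoidalCategory M] [SymmetricCategory M]
  {X : Interp V C M} {δ : Prop} {K : Type k} {W : Type w} {i : W → M}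
  {cty : K → Ty δ W} {cst : X.Constants i cty}

theorem IsIntuit.of_eq {P P' : C} {Y Y' : V} {e : P ≅ X.F.obj Y} {e' : P' ≅ X.F.obj Y'}
    {φ φ' : P ⟶ P'} (h : X.IsIntuit e e' φ) (hφ : φ' = φ) : X.IsIntuit e e' φ' := hφ ▸ h

theorem Substitutable.of_eq {A : Ty δ W} {Q : LCtx W} {θ θ' : X.lctx i Q ⟶ X.ty i A}
    (h : Substitutable A Q θ) (e : θ' = θ) : Substitutable A Q θ' := e ▸ h

/-- Closed values of intuitionistic types have no labels and are interpreted as intuitionistic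
morphisms. This is what makes call-by-value evaluation sound. -/
theorem isVal_substitutable {v : Term δ K i} (hv : v.IsVal) : ∀ {Q : LCtx W} {A : Ty δ W}
    (d : Deriv cty [] Q v A), Substitutable A Q (X.den cst d) := by
  induction hv with
  | const c =>
    intro Q A d
    cases d with
    | const hΓ =>
      by_cases hA : (cty c).Intuit
      · refine (Substitutable.intuit hA ?_).of_eq ((X.den_const cst hΓ c).trans
          (Category.id_comp _))
        exact cst.intuit c hA
      · exact .linear hA _
  | star =>
    intro Q A d
    cases d with
    | star hΓ =>
      refine (Substitutable.intuit (A := .one) trivial ?_).of_eq (X.den_star cst hΓ)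
      exact (IsIntuit.id : X.IsIntuit (εIso X.F) (εIso X.F) (𝟙 _))
  | lam A m =>
    intro Q A d
    cases d with
    | lam => exact Substitutable.linear (A := .lolli _ _) (fun h => h) _
  | label h l =>
    intro Q A d
    cases d with
    | label => exact Substitutable.linear (A := .wire _ _) (fun h => h) _
  | boxed h a S b =>
    intro Q A d
    cases d with
    | boxed _ hΓ da _ db =>
      refine (Substitutable.intuit (A := .diag h _ _) trivial ?_).of_eq
        ((X.den_boxed cst h hΓ da S db).trans (Category.id_comp _))
      exact ⟨_, congrArg (fun k => _ ≫ k) (Category.comp_id _).symm⟩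
  | lift m =>
    intro Q A d
    cases d with
    | lift hΓ dm =>
      refine (Substitutable.intuit (A := .bang _) trivial ?_).of_eq (X.den_lift cst hΓ dm)
      exact ⟨_, (lift_bang_map (εIso X.F) (X.den cst dm)).trans
        (congrArg (fun k => _ ≫ k) (Category.comp_id _).symm)⟩
  | @inl A B _ h ih =>
    intro Q _ d
    cases d with
    | inl dm =>
      by_cases hA : (Ty.sum A B).Intuit
      · cases ih dm with
        | linear h => exact absurd hA.1 h
        | intuit h hθ =>
          exact (Substitutable.intuit hA
            (IsIntuit.comp hθ (isIntuit_inl _ (X.paramIso i B hA.2)))).of_eq (X.den_inl cst dm)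
      · exact .linear hA _
  | @inr A B _ h ih =>
    intro Q _ d
    cases d with
    | inr dm =>
      by_cases hA : (Ty.sum A B).Intuit
      · cases ih dm with
        | linear h => exact absurd hA.2 h
        | intuit h hθ =>
          exact (Substitutable.intuit hA
            (IsIntuit.comp hθ (isIntuit_inr (X.paramIso i A hA.1) _))).of_eq (X.den_inr cst dm)
      · exact .linear hA _
  | pair h h' ih ih' =>
    intro Q A d
    cases d with
    | @pair _ _ _ _ _ _ _ _ A B cs ls dm dn =>
      cases cs
      by_cases hA : (Ty.tensor A B).Intuit
      · -- The interpretations are replaced by variables, so that the case distinctions below may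
        -- replace the label contexts by the empty one.
        generalize hd : X.den cst (Deriv.pair CSplit.nil ls dm dn) = θ
        have hd' := hd.symm.trans (X.den_pair cst .nil ls dm dn)
        generalize hm : X.den cst dm = φ at hd'
        generalize hn : X.den cst dn = ψ at hd'
        have h₁ := hm ▸ ih dm
        have h₂ := hn ▸ ih' dn
        clear hm hn hd
        cases h₁ with
        | linear h => exact absurd hA.1 h
        | intuit h hφ =>
          cases h₂ with
          | linear h => exact absurd hA.2 h
          | intuit h' hψ =>
            obtain rfl := LSplit.eq_of_empty_left ls
            subst hd'
            refine .intuit hA ?_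
            exact IsIntuit.comp (e' := X.prodIso (εIso X.F) (εIso X.F))
              (IsIntuit.leftUnitor_inv.of_eq (LSplit.map_empty_left (X.wire i) ls))
              (IsIntuit.tensor hφ hψ)
      · exact .linear hA _

/-! ### Evaluation of a part of a configuration -/

variable (cst) in
/-- Replacing the configuration `(S, m)` by `(S', v)` preserves types and interpretations. -/
def Sound (S : LDiagram i) (m : Term δ K i) (S' : LDiagram i) (v : Term δ K i) : Prop :=
  ∀ {Q : LCtx W} {A : Ty δ W} {Q' : LCtx W} (D : ConfigDeriv cty Q S m A Q'),
    ∃ D' : ConfigDeriv cty Q S' v A Q', X.config i cst D = X.config i cst D'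

/-- Equality of the interpretations of configurations, with the interpretations of their terms
rewritten. -/
theorem config_eq_config {Q R R' P P' Q' : LCtx W} {f : Q.obj i ⟶ R.obj i}
    {f' : Q.obj i ⟶ R'.obj i} {m m' : Term δ K i} {A : Ty δ W} {s : LSplit R P Q'}
    {s' : LSplit R' P' Q'} {d : Deriv cty [] P m A} {d' : Deriv cty [] P' m' A}
    {x : X.lctx i P ⟶ X.ty i A} {x' : X.lctx i P' ⟶ X.ty i A} (e : X.den cst d = x)
    (e' : X.den cst d' = x')
    (h : X.diagram i f ≫ (LSplit.map (X.wire i) s).hom ≫ x ▷ X.lctx i Q' =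
      X.diagram i f' ≫ (LSplit.map (X.wire i) s').hom ≫ x' ▷ X.lctx i Q') :
    X.config i cst (.mk (f := f) s d) = X.config i cst (.mk (f := f') s' d') := by
  subst e e'
  exact h

namespace Sound

variable {Q R P Q₁ Q₂ Q' : LCtx W} {f : Q.obj i ⟶ R.obj i} {S' S'' : LDiagram i}
  {m n v v' : Term δ K i} {A B : Ty δ W}

/-- A term is evaluated in the context `k`. -/
theorem unary (h : Sound cst ⟨Q, R, f⟩ m S' v) (s : LSplit R P Q') (dm : Deriv cty [] P m A) :
    ∃ (R' P' : LCtx W) (f' : Q.obj i ⟶ R'.obj i) (s' : LSplit R' P' Q')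
      (dv : Deriv cty [] P' v A), S' = ⟨Q, R', f'⟩ ∧ ∀ {Z : C} (k : X.ty i A ⟶ Z),
        X.diagram i f ≫ (LSplit.map (X.wire i) s).hom ≫ (X.den cst dm ≫ k) ▷ X.lctx i Q' =
          X.diagram i f' ≫ (LSplit.map (X.wire i) s').hom ≫ (X.den cst dv ≫ k) ▷ X.lctx i Q' := by
  obtain ⟨D', e⟩ := h (.mk s dm)
  cases D' with
  | @mk R' P' _ f' _ _ s' dv =>
    refine ⟨R', P', f', s', dv, rfl, fun k => ?_⟩
    have e' := e =≫ k ▷ X.lctx i Q'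
    exact unary_aux e'

/-- A term is evaluated while the labels `Q₂` of the rest of the configuration are set aside as
additional outputs of the diagram. -/
theorem left (h : Sound cst ⟨Q, R, f⟩ m S' v) (s : LSplit R P Q') (ls : LSplit P Q₁ Q₂)
    (dm : Deriv cty [] Q₁ m A) :
    ∃ (R' P' Qv : LCtx W) (f' : Q.obj i ⟶ R'.obj i) (s' : LSplit R' P' Q')
      (ls' : LSplit P' Qv Q₂) (dv : Deriv cty [] Qv v A), S' = ⟨Q, R', f'⟩ ∧
      ∀ {Z : C} (k : X.ty i A ⊗ X.lctx i Q₂ ⟶ Z),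
        X.diagram i f ≫ (LSplit.map (X.wire i) s).hom ≫
          ((LSplit.map (X.wire i) ls).hom ≫ X.den cst dm ▷ X.lctx i Q₂ ≫ k) ▷ X.lctx i Q' =
        X.diagram i f' ≫ (LSplit.map (X.wire i) s').hom ≫
          ((LSplit.map (X.wire i) ls').hom ≫ X.den cst dv ▷ X.lctx i Q₂ ≫ k) ▷ X.lctx i Q' := by
  obtain ⟨N, s₁, t, e⟩ := LSplit.exists_assoc_symm (i := X.wire i) s ls
  obtain ⟨D', eD⟩ := h (.mk s₁ dm)
  cases D' with
  | @mk R' P' _ f' _ _ s₂ dv =>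
    obtain ⟨P'', s', ls', e'⟩ := LSplit.exists_assoc (i := X.wire i) s₂ t
    refine ⟨R', P'', P', f', s', ls', dv, rfl, fun k => ?_⟩
    exact left_aux e.symm e' eD k

/-- As `Sound.left`, for the second of two parts. -/
theorem right (h : Sound cst ⟨Q, R, f⟩ n S' v) (s : LSplit R P Q') (ls : LSplit P Q₁ Q₂)
    (dn : Deriv cty [] Q₂ n A) :
    ∃ (R' P' Qv : LCtx W) (f' : Q.obj i ⟶ R'.obj i) (s' : LSplit R' P' Q')
      (ls' : LSplit P' Q₁ Qv) (dv : Deriv cty [] Qv v A), S' = ⟨Q, R', f'⟩ ∧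
      ∀ {Z : C} (k : X.lctx i Q₁ ⊗ X.ty i A ⟶ Z),
        X.diagram i f ≫ (LSplit.map (X.wire i) s).hom ≫
          ((LSplit.map (X.wire i) ls).hom ≫ X.lctx i Q₁ ◁ X.den cst dn ≫ k) ▷ X.lctx i Q' =
        X.diagram i f' ≫ (LSplit.map (X.wire i) s').hom ≫
          ((LSplit.map (X.wire i) ls').hom ≫ X.lctx i Q₁ ◁ X.den cst dv ≫ k) ▷ X.lctx i Q' := by
  obtain ⟨t, e⟩ := LSplit.exists_symm (i := X.wire i) ls
  obtain ⟨R', P', Qv, f', s', ls', dv, rfl, H⟩ := h.left s t dn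
  obtain ⟨t', e'⟩ := LSplit.exists_symm (i := X.wire i) ls'
  refine ⟨R', P', Qv, f', s', t', dv, rfl, fun k => ?_⟩
  have := H ((β_ _ _).hom ≫ k)
  exact right_aux e e' this

/-- Two terms are evaluated one after the other: the labels of the second term are set aside during
the first evaluation, and those of the resulting value during the second one. -/
theorem tensor (hm : Sound cst ⟨Q, R, f⟩ m S' v) (hn : Sound cst S' n S'' v')
    (s : LSplit R P Q') (ls : LSplit P Q₁ Q₂)
    (dm : Deriv cty [] Q₁ m A) (dn : Deriv cty [] Q₂ n B) :
    ∃ (R' P' Qv Qv' : LCtx W) (f' : Q.obj i ⟶ R'.obj i) (s' : LSplit R' P' Q')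
      (ls' : LSplit P' Qv Qv') (dv : Deriv cty [] Qv v A) (dv' : Deriv cty [] Qv' v' B),
      S'' = ⟨Q, R', f'⟩ ∧ ∀ {Z : C} (k : X.ty i A ⊗ X.ty i B ⟶ Z),
        X.diagram i f ≫ (LSplit.map (X.wire i) s).hom ≫
          ((LSplit.map (X.wire i) ls).hom ≫ (X.den cst dm ⊗ₘ X.den cst dn) ≫ k) ▷ X.lctx i Q' =
        X.diagram i f' ≫ (LSplit.map (X.wire i) s').hom ≫
          ((LSplit.map (X.wire i) ls').hom ≫ (X.den cst dv ⊗ₘ X.den cst dv') ≫ k) ▷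
            X.lctx i Q' := by
  obtain ⟨R', P', Qv, f', s', ls', dv, rfl, H⟩ := hm.left s ls dm
  obtain ⟨R'', P'', Qv', f'', s'', ls'', dv', rfl, H'⟩ := hn.right s' ls' dn
  refine ⟨R'', P'', Qv, Qv', f'', s'', ls'', dv, dv', rfl, fun k => ?_⟩
  exact tensor_aux (H (_ ◁ X.den cst dn ≫ k)) (H' (X.den cst dv ▷ _ ≫ k))

end Sound

end Interp

end LNL

namespace LNL

/-! ### Soundness -/

section Auxiliary

variable {C : Type u₂} [Category.{v₂} C] [MonoidalCategory C] [SymmetricCategory C]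

theorem frame_congr {L R Q P A : C} {f : L ⟶ R} {s : R ⟶ Q ⊗ P} {x y : Q ⟶ A} (h : x = y) :
    f ≫ s ≫ x ▷ P = f ≫ s ≫ y ▷ P := by rw [h]

theorem comp_map_aux {Q Q₁ Q₂ A B D : C} {ls : Q ⟶ Q₁ ⊗ Q₂} {m : Q₁ ⟶ A} {j : A ⟶ B}
    {k : B ⊗ Q₂ ⟶ D} {n : A ⊗ Q₂ ⟶ D} (h : j ▷ Q₂ ≫ k = n) :
    ls ≫ (m ≫ j) ▷ Q₂ ≫ k = ls ≫ m ▷ Q₂ ≫ n := by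
  subst h
  simp

theorem seq_aux {Q D : C} {ls : Q ⟶ 𝟙_ C ⊗ Q} (h : ls = (λ_ Q).inv) {x : 𝟙_ C ⟶ 𝟙_ C}
    (hx : x = 𝟙 _) (n : Q ⟶ D) : ls ≫ x ▷ Q ≫ (λ_ Q).hom ≫ n = n := by
  subst h hx
  simp

theorem letPair_aux {P Qv Q₂ Qa Qb N A B D : C} {ls : P ⟶ Qv ⊗ Q₂} {lv : Qv ⟶ Qa ⊗ Qb}
    {lv' : Qv ⟶ Qb ⊗ Qa} (h : lv' = lv ≫ (β_ _ _).hom) {s : P ⟶ Qb ⊗ N} {t : N ⟶ Qa ⊗ Q₂}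
    (e : s ≫ Qb ◁ t = ls ≫ lv' ▷ _ ≫ (α_ _ _ _).hom) (a : Qa ⟶ A) (b : Qb ⟶ B)
    (n : B ⊗ A ⊗ Q₂ ⟶ D) :
    ls ≫ (lv ≫ (a ⊗ₘ b)) ▷ Q₂ ≫ (β_ A B).hom ▷ Q₂ ≫ (α_ _ _ _).hom ≫ n =
      s ≫ b ▷ N ≫ B ◁ (t ≫ a ▷ Q₂) ≫ n := by
  subst h
  have e' : s ≫ b ▷ N ≫ B ◁ (t ≫ a ▷ Q₂) ≫ n = (s ≫ Qb ◁ t) ≫ b ▷ _ ≫ B ◁ a ▷ Q₂ ≫ n := by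
    simp only [MonoidalCategory.whiskerLeft_comp, Category.assoc, whisker_exchange_assoc]
  rw [e', e]
  simp only [comp_whiskerRight, Category.assoc]
  rw [← comp_whiskerRight_assoc (a ⊗ₘ b), BraidedCategory.braiding_naturality]
  simp [MonoidalCategory.tensorHom_def]

theorem app_aux [MonoidalClosed C] {Q Q₁ Q₂ A B : C} {ls : Q ⟶ Q₁ ⊗ Q₂} {ls' : Q ⟶ Q₂ ⊗ Q₁}
    (h : ls' = ls ≫ (β_ _ _).hom) {m : Q₁ ⟶ (ihom A).obj B} {m' : A ⊗ Q₁ ⟶ B}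
    (hm : m = MonoidalClosed.curry m') (n : Q₂ ⟶ A) :
    ls ≫ (m ⊗ₘ n) ≫ (β_ _ _).hom ≫ (ihom.ev A).app B = ls' ≫ n ▷ Q₁ ≫ m' := by
  subst h hm
  have e : (MonoidalClosed.curry m' ⊗ₘ n) ≫ (β_ _ _).hom ≫ (ihom.ev A).app B =
      (β_ _ _).hom ≫ n ▷ _ ≫ A ◁ MonoidalClosed.curry m' ≫ (ihom.ev A).app B := by
    rw [BraidedCategory.braiding_naturality_assoc, MonoidalCategory.tensorHom_def,
      Category.assoc]
  rw [e, Category.assoc, ← MonoidalClosed.uncurry_eq, MonoidalClosed.uncurry_curry]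

theorem fix_aux {A B : C} {c ls : 𝟙_ C ⟶ 𝟙_ C ⊗ 𝟙_ C} (hc : c = (λ_ _).inv)
    (hl : ls = (λ_ _).inv) {x y : 𝟙_ C ⟶ B} (h : y = x) (n : B ⊗ 𝟙_ C ⟶ A) :
    ls ≫ y ▷ _ ≫ n = c ≫ 𝟙_ C ◁ x ≫ (β_ _ _).hom ≫ n := by
  subst hc hl h
  simp [unitors_inv_equal, unitors_equal]

end Auxiliary

namespace Interp

open Functor.Monoidal

variable {V : Type u₁} [Category.{v₁} V] [CartesianMonoidalCategory V] [BraidedCategory V]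
  [MonoidalClosed V] [HasFiniteCoproducts V]
  {C : Type u₂} [Category.{v₂} C] [MonoidalCategory C] [SymmetricCategory C]
  [MonoidalClosed C] [HasFiniteCoproducts C]
  {M : Type u₃} [Category.{v₃} M] [MonoidalCategory M] [SymmetricCategory M]
  {X : Interp V C M} {δ : Prop} {K : Type k} {W : Type w} {i : W → M}
  {cty : K → Ty δ W} {cst : X.Constants i cty}

theorem sound_letIn {S S' S'' : LDiagram i} {m n v u : Term δ K i} (hv : v.IsVal)
    (h : Sound cst S m S' v) (h' : Sound cst S' (n.inst v) S'' u) :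
    Sound cst S (.letIn m n) S'' u := by
  rintro Q B Q' ⟨s, d⟩
  cases d with
  | letIn cs ls dm dn =>
    cases cs
    obtain ⟨R', P', Qv, f', s', ls', dv, rfl, H⟩ := h.left s ls dm
    obtain ⟨d, e⟩ := exists_inst dv (isVal_substitutable (cst := cst) hv dv) ls' dn
    obtain ⟨D', E⟩ := h' (.mk s' d)
    exact ⟨D', (config_eq_config (X.den_letIn cst .nil ls dm dn) e (H (X.den cst dn))).trans E⟩

theorem sound_caseInl {S S' S'' : LDiagram i} {A B : Ty δ W} {m n p v u : Term δ K i}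
    (hv : v.IsVal) (h : Sound cst S m S' (.inl A B v)) (h' : Sound cst S' (n.inst v) S'' u) :
    Sound cst S (.case m n p) S'' u := by
  rintro Q D Q' ⟨s, d⟩
  cases d with
  | case cs ls dm dn dp =>
    cases cs
    obtain ⟨R', P', Qv, f', s', ls', dv, rfl, H⟩ := h.left s ls dm
    cases dv with
    | inl dv =>
      obtain ⟨d, e⟩ := exists_inst dv (isVal_substitutable (cst := cst) hv dv) ls' dn
      obtain ⟨D', E⟩ := h' (.mk s' d)
      refine ⟨D', (config_eq_config (X.den_case cst .nil ls dm dn dp) e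
        ((H (caseMap (X.den cst dn) (X.den cst dp))).trans (frame_congr ?_))).trans E⟩
      refine (congrArg (fun k => _ ≫ k ▷ _ ≫ _) (X.den_inl cst dv)).trans ?_
      exact comp_map_aux (inl_caseMap _ _)

theorem sound_caseInr {S S' S'' : LDiagram i} {A B : Ty δ W} {m n p v u : Term δ K i}
    (hv : v.IsVal) (h : Sound cst S m S' (.inr A B v)) (h' : Sound cst S' (p.inst v) S'' u) :
    Sound cst S (.case m n p) S'' u := by
  rintro Q D Q' ⟨s, d⟩
  cases d with
  | case cs ls dm dn dp =>
    cases cs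
    obtain ⟨R', P', Qv, f', s', ls', dv, rfl, H⟩ := h.left s ls dm
    cases dv with
    | inr dv =>
      obtain ⟨d, e⟩ := exists_inst dv (isVal_substitutable (cst := cst) hv dv) ls' dp
      obtain ⟨D', E⟩ := h' (.mk s' d)
      refine ⟨D', (config_eq_config (X.den_case cst .nil ls dm dn dp) e
        ((H (caseMap (X.den cst dn) (X.den cst dp))).trans (frame_congr ?_))).trans E⟩
      refine (congrArg (fun k => _ ≫ k ▷ _ ≫ _) (X.den_inr cst dv)).trans ?_
      exact comp_map_aux (inr_caseMap _ _)

theorem sound_seq {S S' S'' : LDiagram i} {m n v : Term δ K i}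
    (h : Sound cst S m S' .star) (h' : Sound cst S' n S'' v) :
    Sound cst S (.seq m n) S'' v := by
  rintro Q D Q' ⟨s, d⟩
  cases d with
  | seq cs ls dm dn =>
    cases cs
    obtain ⟨R', P', Qv, f', s', ls', dv, rfl, H⟩ := h.left s ls dm
    cases dv with
    | star hΓ =>
      obtain rfl := LSplit.eq_of_empty_left ls'
      obtain ⟨D', E⟩ := h' (.mk s' dn)
      refine ⟨D', (config_eq_config (X.den_seq cst .nil ls dm dn) rfl
        ((H ((λ_ _).hom ≫ X.den cst dn)).trans (frame_congr ?_))).trans E⟩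
      exact seq_aux (LSplit.map_empty_left (X.wire i) ls') (X.den_star cst hΓ) _

theorem sound_inl {S S' : LDiagram i} {A B : Ty δ W} {m v : Term δ K i}
    (h : Sound cst S m S' v) : Sound cst S (.inl A B m) S' (.inl A B v) := by
  rintro Q D Q' ⟨s, d⟩
  cases d with
  | inl dm =>
    obtain ⟨R', P', f', s', dv, rfl, H⟩ := h.unary s dm
    exact ⟨.mk s' (.inl dv), config_eq_config (X.den_inl cst dm) (X.den_inl cst dv) (H _)⟩

theorem sound_inr {S S' : LDiagram i} {A B : Ty δ W} {m v : Term δ K i}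
    (h : Sound cst S m S' v) : Sound cst S (.inr A B m) S' (.inr A B v) := by
  rintro Q D Q' ⟨s, d⟩
  cases d with
  | inr dm =>
    obtain ⟨R', P', f', s', dv, rfl, H⟩ := h.unary s dm
    exact ⟨.mk s' (.inr dv), config_eq_config (X.den_inr cst dm) (X.den_inr cst dv) (H _)⟩

theorem sound_pair {S S' S'' : LDiagram i} {m n v v' : Term δ K i}
    (h : Sound cst S m S' v) (h' : Sound cst S' n S'' v') :
    Sound cst S (.pair m n) S'' (.pair v v') := by
  rintro Q D Q' ⟨s, d⟩
  cases d with
  | pair cs ls dm dn =>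
    cases cs
    obtain ⟨R', P', Qv, Qv', f', s', ls', dv, dv', rfl, H⟩ := h.tensor h' s ls dm dn
    refine ⟨.mk s' (.pair .nil ls' dv dv'), config_eq_config
      ((X.den_pair cst .nil ls dm dn).trans ?_) ((X.den_pair cst .nil ls' dv dv').trans ?_)
      (H (𝟙 _))⟩
    · exact congrArg (fun k => _ ≫ k) (Category.comp_id _).symm
    · exact congrArg (fun k => _ ≫ k) (Category.comp_id _).symm

theorem sound_letPair {S S' S'' : LDiagram i} {m n v v' u : Term δ K i} (hv : v.IsVal)
    (hv' : v'.IsVal) (h : Sound cst S m S' (.pair v v'))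
    (h' : Sound cst S' (n.inst₂ v v') S'' u) : Sound cst S (.letPair m n) S'' u := by
  rintro Q D Q' ⟨s, d⟩
  cases d with
  | letPair cs ls dm dn =>
    cases cs
    obtain ⟨R', P', Qv, f', s', ls', dv, rfl, H⟩ := h.left s ls dm
    cases dv with
    | pair cs lv da db =>
      cases cs
      -- The second component of the pair is the innermost variable of `n`, so its labels come
      -- first.
      obtain ⟨lv', el⟩ := LSplit.exists_symm (i := X.wire i) lv
      obtain ⟨N, s₁, t₁, e₁⟩ := LSplit.exists_assoc_symm (i := X.wire i) ls' lv'
      obtain ⟨d, e⟩ := exists_inst₂ da (isVal_substitutable (cst := cst) hv da) db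
        (isVal_substitutable (cst := cst) hv' db) s₁ t₁ dn
      obtain ⟨D', E⟩ := h' (.mk s' d)
      refine ⟨D', (config_eq_config (X.den_letPair cst .nil ls dm dn) e
        ((H ((β_ _ _).hom ▷ _ ≫ (α_ _ _ _).hom ≫ X.den cst dn)).trans
          (frame_congr ?_))).trans E⟩
      refine (congrArg (fun k => _ ≫ k ▷ _ ≫ _) (X.den_pair cst .nil lv da db)).trans ?_
      exact letPair_aux el e₁ _ _ _

theorem sound_app {S S' S'' S''' : LDiagram i} {A : Ty δ W} {m m' n v u : Term δ K i}
    (hv : v.IsVal) (h : Sound cst S m S' (.lam A m')) (h' : Sound cst S' n S'' v)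
    (h'' : Sound cst S'' (m'.inst v) S''' u) : Sound cst S (.app m n) S''' u := by
  rintro Q D Q' ⟨s, d⟩
  cases d with
  | app cs ls dm dn =>
    cases cs
    obtain ⟨R', P', Qv, Qv', f', s', ls', dv, dv', rfl, H⟩ := h.tensor h' s ls dm dn
    cases dv with
    | lam dv =>
      obtain ⟨t, et⟩ := LSplit.exists_symm (i := X.wire i) ls'
      obtain ⟨d, e⟩ := exists_inst dv' (isVal_substitutable (cst := cst) hv dv') t dv
      obtain ⟨D', E⟩ := h'' (.mk s' d)
      refine ⟨D', (config_eq_config (X.den_app cst .nil ls dm dn) e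
        ((H ((β_ _ _).hom ≫ (ihom.ev _).app _)).trans (frame_congr ?_))).trans E⟩
      exact app_aux et (X.den_lam cst dv) _

theorem sound_force {S S' S'' : LDiagram i} {m m' v : Term δ K i}
    (h : Sound cst S m S' (.lift m')) (h' : Sound cst S' m' S'' v) :
    Sound cst S (.force m) S'' v := by
  rintro Q D Q' ⟨s, d⟩
  cases d with
  | force dm =>
    obtain ⟨R', P', f', s', dv, rfl, H⟩ := h.unary s dm
    cases dv with
    | lift hΓ dv =>
      obtain ⟨D', E⟩ := h' (.mk s' dv)
      refine ⟨D', (config_eq_config (X.den_force cst dm) rfl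
        ((H (X.adj.counit.app _)).trans (frame_congr ?_))).trans E⟩
      refine (congrArg (fun k => k ≫ X.adj.counit.app _) (X.den_lift cst hΓ dv)).trans ?_
      exact lift_bang_map_counit (εIso X.F) _

/-- Unfolding a recursive term is the fixed point equation `gamma_sigma_fixed`, in the empty
context. -/
theorem sound_fix {S S' : LDiagram i} {A : Ty δ W} {m v : Term δ K i}
    (h : Sound cst S (m.inst (.lift (.fix A m))) S' v) : Sound cst S (.fix A m) S' v := by
  rintro Q D Q' ⟨s, d⟩
  cases d with
  | fix hΓ dm =>
    obtain ⟨d, e⟩ := exists_inst (.lift hΓ (.fix hΓ dm))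
      (isVal_substitutable (cst := cst) (.lift _) _) (Interleave.nilLeft _) dm
    obtain ⟨D', E⟩ := h (.mk s d)
    refine ⟨D', (config_eq_config (X.den_fix cst hΓ dm) e (frame_congr ?_)).trans E⟩
    refine (gamma_sigma_fixed (εIso X.F) _).trans (Eq.symm ?_)
    refine fix_aux copy_εIso (LSplit.map_empty_left (X.wire i) _) ?_ _
    refine (X.den_lift cst hΓ (.fix hΓ dm)).trans ?_
    exact congrArg (fun k => X.lift (εIso X.F) ≫ X.bang.map k) (X.den_fix cst hΓ dm)

end Interp

end LNL

namespace LNL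

/-! ### Soundness for diagrams -/

section Auxiliary

variable {C : Type u₂} [Category.{v₂} C] [MonoidalCategory C] [SymmetricCategory C]
  [MonoidalClosed C]

theorem unit_tensor_aux {A A' B : C} (x : 𝟙_ C ⟶ B) (t : A' ⟶ A) :
    (λ_ A').inv ≫ (x ⊗ₘ t) ≫ (β_ _ _).hom = (ρ_ A').inv ≫ A' ◁ x ≫ t ▷ _ := by
  have : (λ_ A').inv ≫ (β_ (𝟙_ C) A').hom = (ρ_ A').inv := by
    rw [braiding_tensorUnit_left]
    simp
  rw [BraidedCategory.braiding_naturality, MonoidalCategory.tensorHom_def', reassoc_of% this]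

/-- A function applied to the inputs of a diagram yields the diagram. -/
theorem box_aux {Q R A A' B B' : C} {d : Q ≅ A'} (t : A ≅ A') {r : R ≅ B'} (u : B ≅ B')
    {l : Q ⟶ 𝟙_ C ⊗ Q} (hl : l = (λ_ _).inv) {x : 𝟙_ C ⟶ (ihom A).obj B} {g₀ : Q ⟶ Q}
    (hg₀ : g₀ = 𝟙 _) {g : Q ⟶ R} {p : Q ⟶ Q ⊗ 𝟙_ C} (hp : p = (ρ_ _).inv) {q : R ⟶ R ⊗ 𝟙_ C}
    (hq : q = (ρ_ _).inv)
    (e : g₀ ≫ p ≫ (l ≫ (x ⊗ₘ d.hom ≫ t.inv) ≫ (β_ _ _).hom ≫ (ihom.ev A).app B) ▷ 𝟙_ C =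
      g ≫ q ≫ (r.hom ≫ u.inv) ▷ 𝟙_ C) :
    MonoidalClosed.curry ((ρ_ A').hom ≫ d.inv ≫ g ≫ r.hom) =
      x ≫ MonoidalClosed.curry (t.inv ▷ _ ≫ (ihom.ev A).app B ≫ u.hom) := by
  subst hl hg₀ hp hq
  have e₁ : (λ_ _).inv ≫ (x ⊗ₘ d.hom ≫ t.inv) ≫ (β_ _ _).hom ≫ (ihom.ev A).app B =
      g ≫ r.hom ≫ u.inv := by
    rw [← cancel_mono (ρ_ B).inv, Category.assoc, Category.assoc, Category.assoc]
    simpa using e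
  have e₂ : d.inv ≫ g ≫ r.hom = (ρ_ _).inv ≫ A' ◁ x ≫ t.inv ▷ _ ≫ (ihom.ev A).app B ≫ u.hom := by
    rw [Iso.inv_comp_eq, ← cancel_mono u.inv, Category.assoc, ← e₁, reassoc_of% unit_tensor_aux]
    simp [whisker_exchange_assoc]
  rw [e₂, Iso.hom_inv_id_assoc, ← MonoidalClosed.curry_natural_left]

theorem boxed_aux {D : Type u₁} [Category.{v₁} D] {F : D ⥤ C} {G : C ⥤ D} (adj : F ⊣ G)
    {Y Z : D} {P A A' : C} {ε : P ≅ F.obj Y} {b : P ⟶ F.obj (G.obj A)} {x : P ⟶ A}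
    (hb : b = ε.hom ≫ F.map (adj.unit.app Y ≫ G.map (ε.inv ≫ x))) {j : A ⟶ A'} {x' : P ⟶ A'}
    (hx : x' = x ≫ j) (i : G.obj A' ⟶ Z) :
    ε.hom ≫ F.map (adj.homEquiv _ _ (ε.inv ≫ x') ≫ i) = b ≫ F.map (G.map j) ≫ F.map i := by
  subst hb hx
  simp [Adjunction.homEquiv_unit]

theorem unboxed_aux {D : Type u₁} [Category.{v₁} D] {F : D ⥤ C} {G : C ⥤ D} (adj : F ⊣ G)
    {Y Z : D} {P A : C} (ε : P ≅ F.obj Y) (x : P ⟶ A) (i : G.obj A ≅ Z) :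
    (ε.hom ≫ F.map (adj.homEquiv _ _ (ε.inv ≫ x) ≫ i.hom)) ≫ F.map i.inv ≫ adj.counit.app A =
      x := by
  simp [Adjunction.homEquiv_unit]

/-- Applying a boxed diagram to a tuple of labels is composing with the diagram. -/
theorem apply_aux {Q A B T' U' Z : C} {l : Q ⟶ 𝟙_ C ⊗ Q} (hl : l = (λ_ _).inv)
    {b : 𝟙_ C ⟶ Z} {z : Z ⟶ (ihom T').obj U'} {d : Q ⟶ T'} {f : T' ⟶ U'} {t : A ≅ T'} {u : B ≅ U'}
    (h : b ≫ z = MonoidalClosed.curry ((ρ_ _).hom ≫ f)) :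
    l ≫ (b ⊗ₘ d ≫ t.inv) ≫ _ ◁ t.hom ≫ z ▷ _ ≫ (β_ _ _).hom ≫ (ihom.ev _).app _ ≫ u.inv =
      d ≫ f ≫ u.inv := by
  subst hl
  have e : (b ⊗ₘ d ≫ t.inv) ≫ _ ◁ t.hom ≫ z ▷ _ = (b ≫ z) ⊗ₘ d := by
    simp [MonoidalCategory.tensorHom_def, whisker_exchange, whisker_exchange_assoc]
  have e' : (ρ_ Q).inv ≫ d ▷ _ = d ≫ (ρ_ _).inv := by simp
  rw [reassoc_of% e, h, reassoc_of% unit_tensor_aux, whisker_exchange_assoc, reassoc_of% e',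
    ← Category.assoc (_ ◁ _), ← MonoidalClosed.uncurry_eq, MonoidalClosed.uncurry_curry,
    Category.assoc, Iso.inv_hom_id_assoc]

theorem tensor_whiskerLeft_aux {Q Q₁ Q₂ A B B' D : C} {ls : Q ⟶ Q₁ ⊗ Q₂} (m : Q₁ ⟶ A) (n : Q₂ ⟶ B)
    (t : B ⟶ B') (k : A ⊗ B' ⟶ D) :
    ls ≫ (m ⊗ₘ n ≫ t) ≫ k = ls ≫ (m ⊗ₘ n) ≫ A ◁ t ≫ k := by
  simp [MonoidalCategory.tensorHom_def]

theorem append_aux {L R P Q Q' R' T U B : C} {f : L ⟶ R} {s : R ⟶ Q ⊗ P} {c : Q ⟶ T} {g : T ⟶ U}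
    {c' : Q' ≅ U} (t : R' ≅ Q' ⊗ P) (u : U ⟶ B) {x : Q ⟶ Q'} (hx : x = c ≫ g ≫ c'.inv)
    {f' : L ⟶ R'} (h : f' = f ≫ s ≫ x ▷ P ≫ t.inv) :
    f ≫ s ≫ (c ≫ g ≫ u) ▷ P = f' ≫ t.hom ≫ (c'.hom ≫ u) ▷ P := by
  subst h hx
  simp

theorem relabel_aux {A B D E G H : C} (a : A ⟶ B) (b : B ⟶ D) (g : D ⟶ E) (c : E ⟶ G)
    (d : G ⟶ H) : (a ≫ b) ≫ g ≫ c ≫ d = a ≫ (b ≫ g ≫ c) ≫ d := by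
  simp

end Auxiliary

namespace Interp

open Functor.Monoidal

variable {V : Type u₁} [Category.{v₁} V] [CartesianMonoidalCategory V] [BraidedCategory V]
  [MonoidalClosed V] [HasFiniteCoproducts V]
  {C : Type u₂} [Category.{v₂} C] [MonoidalCategory C] [SymmetricCategory C]
  [MonoidalClosed C] [HasFiniteCoproducts C]
  {M : Type u₃} [Category.{v₃} M] [MonoidalCategory M] [SymmetricCategory M]
  {X : Interp V C M} {δ : Prop} {K : Type k} {W : Type w} {i : W → M}
  {cty : K → Ty δ W} {cst : X.Constants i cty}

/-- Boxing a morphism and unboxing it yields the curried morphism. -/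
theorem psi_homIso_inv_counit {A B : C} (f : A ⟶ B) :
    ((εIso X.F).hom ≫ X.F.map (X.psi f)) ≫ X.F.map (X.homIso A B).inv ≫ X.adj.counit.app _ =
      MonoidalClosed.curry ((ρ_ A).hom ≫ f) :=
  unboxed_aux X.adj (εIso X.F) _ (X.homIso A B)

/-- A diagram with its inputs and outputs relabelled. -/
theorem diagram_relabel {Q Q' R R' : LCtx W} {a b c c' : LTuple} {T U : MTy W} (da : LTyping Q a T)
    (dc : LTyping R c T) (db : LTyping Q' b U) (dc' : LTyping R' c' U) (g : Q.obj i ⟶ Q'.obj i) :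
    X.diagram i ((dc.iso i).hom ≫ (da.iso i).inv ≫ g ≫ (db.iso i).hom ≫ (dc'.iso i).inv) =
      (dc.iso (X.wire i)).hom ≫ ((da.iso (X.wire i)).inv ≫ X.diagram i g ≫
        (db.iso (X.wire i)).hom) ≫ (dc'.iso (X.wire i)).inv := by
  have e : (dc.iso i).hom ≫ (da.iso i).inv ≫ g ≫ (db.iso i).hom ≫ (dc'.iso i).inv =
      ((dc.iso i).hom ≫ (da.iso i).inv) ≫ g ≫ (db.iso i).hom ≫ (dc'.iso i).inv := by simp
  rw [e, diagram_comp, diagram_comp, diagram_iso, diagram_iso]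
  exact relabel_aux _ _ _ _ _

/-- The evaluation of the function applied to fresh labels, which is sound by the induction
hypothesis, shows that the resulting diagram is interpreted as the function. -/
theorem sound_box {S S' D : LDiagram i} {h : δ} {T : MTy W} {m n : Term δ K i} {Q : LCtx W}
    {a b : LTuple} (h₁ : Sound cst S m S' (.lift n)) (fl : FreshLabels S' n T Q a)
    (h₂ : Sound cst (LDiagram.id i Q) (.app n (a.toTerm h)) D (b.toTerm h)) :
    Sound cst S (.box h T m) S' (.boxed h a D.hom b) := by
  rintro L A Q' ⟨s, d⟩
  cases d with
  | @box _ _ _ _ _ U dm =>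
    obtain ⟨R', P', f', s', dv, rfl, H⟩ := h₁.unary s dm
    cases dv with
    | lift hΓ dn =>
      obtain ⟨da⟩ := fl.typing
      obtain ⟨da', ea⟩ := exists_deriv_of_ltyping cst h da
      let l : LSplit Q (LCtx.empty W) Q := Interleave.nilLeft _
      let l' : LSplit Q Q (LCtx.empty W) := Interleave.nilRight _
      obtain ⟨D', E⟩ := h₂ (.mk l' (.app .nil l dn da'))
      cases D' with
      | @mk R'' P'' _ g _ _ s'' db' =>
        obtain rfl := LSplit.eq_of_empty_right s''
        obtain ⟨db, eb⟩ := exists_ltyping_den cst db'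
        refine ⟨.mk s' (.boxed h Ctx.intuit_nil da g db), config_eq_config (X.den_box cst h dm)
          ((X.den_boxed cst h Ctx.intuit_nil da g db).trans (Category.id_comp _))
          ((H _).trans (frame_congr (Eq.symm ?_)))⟩
        refine boxed_aux X.adj ((X.den_lift cst hΓ dn).trans (lift_bang_map (εIso X.F) _)) ?_ _
        refine box_aux (X.mtyIso i h T) (X.mtyIso i h U)
          (LSplit.map_empty_left (X.wire i) l) (diagram_id Q)
          (LSplit.map_empty_right (X.wire i) l') (LSplit.map_empty_right (X.wire i) s'') ?_
        have e₁ := (X.den_app cst .nil l dn da').trans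
          (congrArg (fun k => _ ≫ (_ ⊗ₘ k) ≫ _) ea)
        exact ((frame_congr e₁).symm.trans E).trans (frame_congr eb)

/-- Appending a diagram composes its interpretation with the given one, next to unused labels. -/
theorem sound_apply {S S' S'' S''' : LDiagram i} {h : δ} {m n : Term δ K i} {a b c c' : LTuple}
    {Q Q' : LCtx W} {g : Q.obj i ⟶ Q'.obj i} (h₁ : Sound cst S m S' (.boxed h a g b))
    (h₂ : Sound cst S' n S'' (c.toTerm h)) (ha : Append S'' c a ⟨Q, Q', g⟩ b S''' c') :
    Sound cst S (.apply h m n) S''' (c'.toTerm h) := by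
  rintro L A N ⟨s, d⟩
  cases d with
  | apply _ cs ls dm dn =>
    cases cs
    obtain ⟨R', P', Qv, Qv', f', s', ls', dv, dv', rfl, H⟩ := h₁.tensor h₂ s ls dm dn
    cases dv with
    | boxed _ hΓ da _ db =>
      obtain rfl := LSplit.eq_of_empty_left ls'
      obtain ⟨dc, ec⟩ := exists_ltyping_den cst dv'
      cases ha with
      | mk da₁ dc₁ db₁ dc' t t' fresh =>
        -- `Append` comes with its own typings of the label tuples. These coincide with those of the
        -- derivation, as typings of label tuples are unique.
        have hl : ∀ l, l ∈ LCtx.labels _ ↔ l ∈ LCtx.labels _ := fun l =>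
          (LTyping.mem_labels dc l).trans (LTyping.mem_labels dc₁ l).symm
        obtain ⟨rfl, rfl, e⟩ := LSplit.unique s' t
          (fun l h₁ h₂ => LSplit.disjoint t ((hl l).1 h₁) h₂)
          (fun l h₁ h₂ => LSplit.disjoint s' ((hl l).2 h₂) h₁)
        cases e
        obtain ⟨rfl, e⟩ := LTyping.unique dc dc₁ rfl
        cases e
        obtain ⟨-, e⟩ := LTyping.unique da da₁ rfl
        cases e
        obtain ⟨rfl, e⟩ := LTyping.unique db db₁ rfl
        cases e
        obtain ⟨d', ed⟩ := exists_deriv_of_ltyping cst h dc'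
        refine ⟨.mk t' d', config_eq_config (X.den_apply cst .nil ls h dm dn) ed ?_⟩
        refine (frame_congr (tensor_whiskerLeft_aux _ _ _ _)).trans ((H _).trans ?_)
        refine (frame_congr ?_).trans (append_aux (LSplit.map (X.wire i) t') _
          (diagram_relabel da dc db dc' g) ((diagram_comp _ _).trans
            (congrArg (fun k => _ ≫ k) (diagram_split s' t' _))))
        refine (congrArg₂ (fun k l => _ ≫ (k ⊗ₘ l) ≫ _)
          ((X.den_boxed cst h hΓ da g db).trans (Category.id_comp _)) ec).trans ?_
        exact apply_aux (LSplit.map_empty_left (X.wire i) ls') (psi_homIso_inv_counit _)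

variable (cst) in
/-- Evaluation preserves the types and the interpretations of configurations. -/
theorem sound {S S' : LDiagram i} {m v : Term δ K i} (h : Eval S m S' v) : Sound cst S m S' v := by
  induction h with
  | const | star | lam | lift | label | boxed => exact fun D => ⟨D, rfl⟩
  | letIn h _ ih ih' => exact sound_letIn h.isVal ih ih'
  | inl _ ih => exact sound_inl ih
  | inr _ ih => exact sound_inr ih
  | caseInl h _ ih ih' =>
    cases h.isVal with
    | inl hv => exact sound_caseInl hv ih ih'
  | caseInr h _ ih ih' =>
    cases h.isVal with
    | inr hv => exact sound_caseInr hv ih ih'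
  | seq _ _ ih ih' => exact sound_seq ih ih'
  | pair _ _ ih ih' => exact sound_pair ih ih'
  | letPair h _ ih ih' =>
    cases h.isVal with
    | pair hv hv' => exact sound_letPair hv hv' ih ih'
  | app _ h _ ih ih' ih'' => exact sound_app h.isVal ih ih' ih''
  | force _ _ ih ih' => exact sound_force ih ih'
  | fix _ ih => exact sound_fix ih
  | box _ fl _ ih ih' => exact sound_box ih fl ih'
  | apply _ _ ha ih ih' => exact sound_apply ih ih' ha

variable (cst) in
/-- The interpretation of a configuration is independent of its derivation. -/
theorem config_unique {Q Q' : LCtx W} {S : LDiagram i} {m : Term δ K i} {A : Ty δ W}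
    (D D' : ConfigDeriv cty Q S m A Q') : X.config i cst D = X.config i cst D' := by
  cases D with
  | mk s d =>
    cases D' with
    | mk s' d' =>
      obtain ⟨rfl, e⟩ := LSplit.unique_right s s'
      cases e
      simp only [config, X.deriv_unique cst d d']

end Interp

end LNL

namespace LNL

/-! ### Error freeness -/

section CanonicalForms

variable {δ : Prop} {K : Type k} {W : Type w} {M : Type u₃} [Category.{v₃} M]
  [MonoidalCategory M] {i : W → M} {cty : K → Ty δ W} {v : Term δ K i} {Q : LCtx W}

/-- Type `0` has no introduction form, so that its closed values are constants. -/
theorem Term.IsVal.isConst_of_zero (hv : v.IsVal) (d : Deriv cty [] Q v .zero) : v.IsConst := by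
  generalize hA : Ty.zero = A at d
  cases hv
  case const => trivial
  all_goals cases d; cases hA

theorem Term.IsVal.not_notSum (hv : v.IsVal) {A B : Ty δ W} (d : Deriv cty [] Q v (.sum A B)) :
    ¬ v.NotSum := by
  generalize hA : Ty.sum A B = A' at d
  cases hv
  case const | inl | inr => exact id
  all_goals cases d; cases hA

theorem Term.IsVal.not_notStar (hv : v.IsVal) (d : Deriv cty [] Q v .one) : ¬ v.NotStar := by
  generalize hA : Ty.one = A' at d
  cases hv
  case const | star => exact id
  all_goals cases d; cases hA

theorem Term.IsVal.not_notPair (hv : v.IsVal) {A B : Ty δ W}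
    (d : Deriv cty [] Q v (.tensor A B)) : ¬ v.NotPair := by
  generalize hA : Ty.tensor A B = A' at d
  cases hv
  case const | pair => exact id
  all_goals cases d; cases hA

theorem Term.IsVal.not_notLam (hv : v.IsVal) {A B : Ty δ W}
    (d : Deriv cty [] Q v (.lolli A B)) : ¬ v.NotLam := by
  generalize hA : Ty.lolli A B = A' at d
  cases hv
  case const | lam => exact id
  all_goals cases d; cases hA

theorem Term.IsVal.not_notLift (hv : v.IsVal) {A : Ty δ W} (d : Deriv cty [] Q v (.bang A)) :
    ¬ v.NotLift := by
  generalize hA : Ty.bang A = A' at d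
  cases hv
  case const | lift => exact id
  all_goals cases d; cases hA

theorem Term.IsVal.not_notBoxed (hv : v.IsVal) {h : δ} {T U : MTy W}
    (d : Deriv cty [] Q v (.diag h T U)) : ¬ v.NotBoxed := by
  generalize hA : Ty.diag h T U = A' at d
  cases hv
  case const | boxed => exact id
  all_goals cases d; cases hA

theorem Term.IsVal.not_notTuple (hv : v.IsVal) {h : δ} {T : MTy W}
    (d : Deriv cty [] Q v (T.toTy h)) : ¬ v.NotTuple := by
  induction hv generalizing T Q with
  | const | star | label => exact id
  | pair _ _ ih ih' =>
    generalize hA : T.toTy h = A' at d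
    cases d with
    | pair cs ls d d' =>
      cases cs
      cases T with
      | tensor T U =>
        cases hA
        rintro (h | h)
        exacts [ih d h, ih' d' h]
      | _ => cases hA
  | _ =>
    generalize hA : T.toTy h = A' at d
    cases d
    cases T <;> cases hA

end CanonicalForms

section Append

variable {W : Type w} {M : Type u₃} [Category.{v₃} M] [MonoidalCategory M] [SymmetricCategory M]
  {i : W → M}

/-- Label contexts can be joined if all labels of one are below those of the other. -/
theorem LSplit.exists_of_lt {Q Q' : LCtx W} (h : ∀ l ∈ Q.labels, ∀ l' ∈ Q'.labels, l < l') :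
    ∃ R : LCtx W, Nonempty (LSplit R Q' Q) := by
  refine ⟨⟨Q.entries ++ Q'.entries, List.pairwise_append.2 ⟨Q.sorted, Q'.sorted, ?_⟩⟩,
    ⟨(Interleave.append _ _).symm⟩⟩
  exact fun a ha b hb => h _ (List.mem_map_of_mem ha) _ (List.mem_map_of_mem hb)

/-- Appending a diagram is defined whenever the types match: the labels of its outputs can be chosen
above all labels in use. -/
theorem exists_append {L R R₀ Qa Qb Qc : LCtx W} {a b c : LTuple} {T U : MTy W}
    (f : L.obj i ⟶ R.obj i) (g : Qa.obj i ⟶ Qb.obj i) (da : LTyping Qa a T)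
    (dc : LTyping Qc c T) (db : LTyping Qb b U) (s : LSplit R Qc R₀) :
    ∃ S' c', Append ⟨L, R, f⟩ c a ⟨Qa, Qb, g⟩ b S' c' := by
  obtain ⟨Qc', c', ⟨dc'⟩, h⟩ := LTyping.exists_fresh U ((L.labels ++ R.labels).sum + 1)
  have h' : ∀ l ∈ L.labels ++ R.labels, ∀ l' ∈ Qc'.labels, l < l' := fun l hl l' hl' =>
    (Nat.lt_succ_of_le (List.le_sum_of_mem hl)).trans_le (h l' hl')
  obtain ⟨R', ⟨s'⟩⟩ := LSplit.exists_of_lt (Q := R₀) (Q' := Qc') fun l hl =>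
    h' l (List.mem_append_right _ ((LSplit.mem_labels s l).2 (.inr hl)))
  exact ⟨_, _, .mk da dc db dc' s s' fun l hl =>
    ⟨fun hl' => (h' l (List.mem_append_left _ hl') l hl).false,
      fun hl' => (h' l (List.mem_append_right _ hl') l hl).false⟩⟩

end Append

section ConfigDeriv

variable {δ : Prop} {K : Type k} {W : Type w} {M : Type u₃} [Category.{v₃} M]
  [MonoidalCategory M] [SymmetricCategory M] {i : W → M} {cty : K → Ty δ W}
  {L R P Q Q₁ Q₂ : LCtx W} {f : L.obj i ⟶ R.obj i} {m : Term δ K i} {A : Ty δ W}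

/-- The first part of a term, with the labels of the second part as further outputs. -/
theorem ConfigDeriv.exists_left (s : LSplit R P Q) (ls : LSplit P Q₁ Q₂)
    (d : Deriv cty [] Q₁ m A) : ∃ N, Nonempty (ConfigDeriv cty L ⟨L, R, f⟩ m A N) := by
  obtain ⟨N, s', t, -⟩ := LSplit.exists_assoc_symm (i := i) s ls
  exact ⟨N, ⟨.mk s' d⟩⟩

/-- As `ConfigDeriv.exists_left`, for the second of two parts. -/
theorem ConfigDeriv.exists_right (s : LSplit R P Q) (ls : LSplit P Q₁ Q₂)
    (d : Deriv cty [] Q₂ m A) : ∃ N, Nonempty (ConfigDeriv cty L ⟨L, R, f⟩ m A N) := by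
  obtain ⟨ls', -⟩ := LSplit.exists_symm (i := i) ls
  exact exists_left s ls' d

end ConfigDeriv

namespace Interp

open Functor.Monoidal

variable {V : Type u₁} [Category.{v₁} V] [CartesianMonoidalCategory V] [BraidedCategory V]
  [MonoidalClosed V] [HasFiniteCoproducts V]
  {C : Type u₂} [Category.{v₂} C] [MonoidalCategory C] [SymmetricCategory C]
  [MonoidalClosed C] [HasFiniteCoproducts C]
  {M : Type u₃} [Category.{v₃} M] [MonoidalCategory M] [SymmetricCategory M]
  {X : Interp V C M} {δ : Prop} {K : Type k} {W : Type w} {i : W → M}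
  {cty : K → Ty δ W}

/-- Well-typed configurations do not evaluate to an error. The values that are inspected are well
typed by `sound`, and so have the right shape, by the canonical forms. -/
theorem not_err (cst : X.Constants i cty) {S : LDiagram i} {m : Term δ K i} (h : Err S m)
    {L : LCtx W} {A : Ty δ W} {Q : LCtx W} (D : ConfigDeriv cty L S m A Q) : False := by
  induction h generalizing L A Q with
  | var =>
    obtain ⟨s, d⟩ := D
    cases d with
    | var l => cases l
  | letIn₁ _ ih =>
    obtain ⟨s, d⟩ := D
    cases d with
    | letIn cs ls dm dn =>
      cases cs
      obtain ⟨N, ⟨D⟩⟩ := ConfigDeriv.exists_left s ls dm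
      exact ih D
  | letIn₂ h _ ih =>
    obtain ⟨s, d⟩ := D
    cases d with
    | letIn cs ls dm dn =>
      cases cs
      obtain ⟨R', P', Qv, f', s', ls', dv, rfl, -⟩ := Sound.left (sound cst h) s ls dm
      obtain ⟨d, -⟩ := exists_inst dv (isVal_substitutable (cst := cst) h.isVal dv) ls' dn
      exact ih (.mk s' d)
  | abort₁ _ ih =>
    obtain ⟨s, d⟩ := D
    cases d with
    | abort dm => exact ih (.mk s dm)
  | abort₂ h hv =>
    obtain ⟨s, d⟩ := D
    cases d with
    | abort dm =>
      obtain ⟨R', P', f', s', dv, rfl, -⟩ := Sound.unary (sound cst h) s dm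
      exact hv (h.isVal.isConst_of_zero dv)
  | inl _ ih =>
    obtain ⟨s, d⟩ := D
    cases d with
    | inl dm => exact ih (.mk s dm)
  | inr _ ih =>
    obtain ⟨s, d⟩ := D
    cases d with
    | inr dm => exact ih (.mk s dm)
  | case₁ _ ih =>
    obtain ⟨s, d⟩ := D
    cases d with
    | case cs ls dm dn dp =>
      cases cs
      obtain ⟨N, ⟨D⟩⟩ := ConfigDeriv.exists_left s ls dm
      exact ih D
  | caseInl h _ ih =>
    obtain ⟨s, d⟩ := D
    cases d with
    | case cs ls dm dn dp =>
      cases cs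
      obtain ⟨R', P', Qv, f', s', ls', dv, rfl, -⟩ := Sound.left (sound cst h) s ls dm
      cases dv with
      | inl dv =>
        cases h.isVal with
        | inl hv =>
          obtain ⟨d, -⟩ := exists_inst dv (isVal_substitutable (cst := cst) hv dv) ls' dn
          exact ih (.mk s' d)
  | caseInr h _ ih =>
    obtain ⟨s, d⟩ := D
    cases d with
    | case cs ls dm dn dp =>
      cases cs
      obtain ⟨R', P', Qv, f', s', ls', dv, rfl, -⟩ := Sound.left (sound cst h) s ls dm
      cases dv with
      | inr dv =>
        cases h.isVal with
        | inr hv =>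
          obtain ⟨d, -⟩ := exists_inst dv (isVal_substitutable (cst := cst) hv dv) ls' dp
          exact ih (.mk s' d)
  | case₂ h hv =>
    obtain ⟨s, d⟩ := D
    cases d with
    | case cs ls dm dn dp =>
      cases cs
      obtain ⟨R', P', Qv, f', s', ls', dv, rfl, -⟩ := Sound.left (sound cst h) s ls dm
      exact h.isVal.not_notSum dv hv
  | seq₁ _ ih =>
    obtain ⟨s, d⟩ := D
    cases d with
    | seq cs ls dm dn =>
      cases cs
      obtain ⟨N, ⟨D⟩⟩ := ConfigDeriv.exists_left s ls dm
      exact ih D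
  | seq₂ h _ ih =>
    obtain ⟨s, d⟩ := D
    cases d with
    | seq cs ls dm dn =>
      cases cs
      obtain ⟨R', P', Qv, f', s', ls', dv, rfl, -⟩ := Sound.left (sound cst h) s ls dm
      obtain ⟨N, ⟨D⟩⟩ := ConfigDeriv.exists_right s' ls' dn
      exact ih D
  | seq₃ h hv =>
    obtain ⟨s, d⟩ := D
    cases d with
    | seq cs ls dm dn =>
      cases cs
      obtain ⟨R', P', Qv, f', s', ls', dv, rfl, -⟩ := Sound.left (sound cst h) s ls dm
      exact h.isVal.not_notStar dv hv
  | pair₁ _ ih =>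
    obtain ⟨s, d⟩ := D
    cases d with
    | pair cs ls dm dn =>
      cases cs
      obtain ⟨N, ⟨D⟩⟩ := ConfigDeriv.exists_left s ls dm
      exact ih D
  | pair₂ h _ ih =>
    obtain ⟨s, d⟩ := D
    cases d with
    | pair cs ls dm dn =>
      cases cs
      obtain ⟨R', P', Qv, f', s', ls', dv, rfl, -⟩ := Sound.left (sound cst h) s ls dm
      obtain ⟨N, ⟨D⟩⟩ := ConfigDeriv.exists_right s' ls' dn
      exact ih D
  | letPair₁ _ ih =>
    obtain ⟨s, d⟩ := D
    cases d with
    | letPair cs ls dm dn =>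
      cases cs
      obtain ⟨N, ⟨D⟩⟩ := ConfigDeriv.exists_left s ls dm
      exact ih D
  | letPair₂ h _ ih =>
    obtain ⟨s, d⟩ := D
    cases d with
    | letPair cs ls dm dn =>
      cases cs
      obtain ⟨R', P', Qv, f', s', ls', dv, rfl, -⟩ := Sound.left (sound cst h) s ls dm
      cases dv with
      | pair cs lv da db =>
        cases cs
        cases h.isVal with
        | pair hv hv' =>
          obtain ⟨lv', -⟩ := LSplit.exists_symm (i := i) lv
          obtain ⟨N, s₁, t₁, -⟩ := LSplit.exists_assoc_symm (i := i) ls' lv'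
          obtain ⟨d, -⟩ := exists_inst₂ da (isVal_substitutable (cst := cst) hv da) db
            (isVal_substitutable hv' db) s₁ t₁ dn
          exact ih (.mk s' d)
  | letPair₃ h hv =>
    obtain ⟨s, d⟩ := D
    cases d with
    | letPair cs ls dm dn =>
      cases cs
      obtain ⟨R', P', Qv, f', s', ls', dv, rfl, -⟩ := Sound.left (sound cst h) s ls dm
      exact h.isVal.not_notPair dv hv
  | app₁ _ ih =>
    obtain ⟨s, d⟩ := D
    cases d with
    | app cs ls dm dn =>
      cases cs
      obtain ⟨N, ⟨D⟩⟩ := ConfigDeriv.exists_left s ls dm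
      exact ih D
  | app₂ h hv =>
    obtain ⟨s, d⟩ := D
    cases d with
    | app cs ls dm dn =>
      cases cs
      obtain ⟨R', P', Qv, f', s', ls', dv, rfl, -⟩ := Sound.left (sound cst h) s ls dm
      exact h.isVal.not_notLam dv hv
  | app₃ h _ ih =>
    obtain ⟨s, d⟩ := D
    cases d with
    | app cs ls dm dn =>
      cases cs
      obtain ⟨R', P', Qv, f', s', ls', dv, rfl, -⟩ := Sound.left (sound cst h) s ls dm
      obtain ⟨N, ⟨D⟩⟩ := ConfigDeriv.exists_right s' ls' dn
      exact ih D
  | app₄ h h' _ ih =>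
    obtain ⟨s, d⟩ := D
    cases d with
    | app cs ls dm dn =>
      cases cs
      obtain ⟨R', P', Qv, Qv', f', s', ls', dv, dv', rfl, -⟩ :=
        Sound.tensor (sound cst h) (sound cst h') s ls dm dn
      cases dv with
      | lam dv =>
        obtain ⟨t, -⟩ := LSplit.exists_symm (i := i) ls'
        obtain ⟨d, -⟩ := exists_inst dv' (isVal_substitutable (cst := cst) h'.isVal dv') t dv
        exact ih (.mk s' d)
  | force₁ _ ih =>
    obtain ⟨s, d⟩ := D
    cases d with
    | force dm => exact ih (.mk s dm)
  | force₂ h hv =>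
    obtain ⟨s, d⟩ := D
    cases d with
    | force dm =>
      obtain ⟨R', P', f', s', dv, rfl, -⟩ := Sound.unary (sound cst h) s dm
      exact h.isVal.not_notLift dv hv
  | force₃ h _ ih =>
    obtain ⟨s, d⟩ := D
    cases d with
    | force dm =>
      obtain ⟨R', P', f', s', dv, rfl, -⟩ := Sound.unary (sound cst h) s dm
      cases dv with
      | lift hΓ dv => exact ih (.mk s' dv)
  | fix _ ih =>
    obtain ⟨s, d⟩ := D
    cases d with
    | fix hΓ dm =>
      obtain ⟨d, -⟩ := exists_inst (.lift hΓ (.fix hΓ dm))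
        (isVal_substitutable (cst := cst) (.lift _) _) (Interleave.nilLeft _) dm
      exact ih (.mk s d)
  | box₁ _ ih =>
    obtain ⟨s, d⟩ := D
    cases d with
    | box _ dm => exact ih (.mk s dm)
  | box₂ h hv =>
    obtain ⟨s, d⟩ := D
    cases d with
    | box _ dm =>
      obtain ⟨R', P', f', s', dv, rfl, -⟩ := Sound.unary (sound cst h) s dm
      exact h.isVal.not_notLift dv hv
  | box₃ h fl _ ih =>
    obtain ⟨s, d⟩ := D
    cases d with
    | box _ dm =>
      obtain ⟨R', P', f', s', dv, rfl, -⟩ := Sound.unary (sound cst h) s dm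
      cases dv with
      | lift hΓ dn =>
        obtain ⟨da⟩ := fl.typing
        obtain ⟨da', -⟩ := exists_deriv_of_ltyping cst _ da
        exact ih (.mk (Q' := LCtx.empty W) (Interleave.nilRight _)
          (.app .nil (Interleave.nilLeft _) dn da'))
  | box₄ h fl h' hv =>
    obtain ⟨s, d⟩ := D
    cases d with
    | box _ dm =>
      obtain ⟨R', P', f', s', dv, rfl, -⟩ := Sound.unary (sound cst h) s dm
      cases dv with
      | lift hΓ dn =>
        obtain ⟨da⟩ := fl.typing
        obtain ⟨da', -⟩ := exists_deriv_of_ltyping cst _ da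
        obtain ⟨D', -⟩ := sound cst h'
          (.mk (Q' := LCtx.empty W) (Interleave.nilRight _)
            (.app .nil (Interleave.nilLeft _) dn da'))
        obtain ⟨s', db⟩ := D'
        exact h'.isVal.not_notTuple db hv
  | apply₁ _ ih =>
    obtain ⟨s, d⟩ := D
    cases d with
    | apply _ cs ls dm dn =>
      cases cs
      obtain ⟨N, ⟨D⟩⟩ := ConfigDeriv.exists_left s ls dm
      exact ih D
  | apply₂ h hv =>
    obtain ⟨s, d⟩ := D
    cases d with
    | apply _ cs ls dm dn =>
      cases cs
      obtain ⟨R', P', Qv, f', s', ls', dv, rfl, -⟩ := Sound.left (sound cst h) s ls dm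
      exact h.isVal.not_notBoxed dv hv
  | apply₃ h _ ih =>
    obtain ⟨s, d⟩ := D
    cases d with
    | apply _ cs ls dm dn =>
      cases cs
      obtain ⟨R', P', Qv, f', s', ls', dv, rfl, -⟩ := Sound.left (sound cst h) s ls dm
      obtain ⟨N, ⟨D⟩⟩ := ConfigDeriv.exists_right s' ls' dn
      exact ih D
  | apply₄ h h' hv =>
    obtain ⟨s, d⟩ := D
    cases d with
    | apply _ cs ls dm dn =>
      cases cs
      obtain ⟨R', P', Qv, Qv', f', s', ls', dv, dv', rfl, -⟩ :=
        Sound.tensor (sound cst h) (sound cst h') s ls dm dn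
      exact h'.isVal.not_notTuple dv' hv
  | apply₅ h h' hn =>
    obtain ⟨s, d⟩ := D
    cases d with
    | apply _ cs ls dm dn =>
      cases cs
      obtain ⟨R', P', Qv, Qv', f', s', ls', dv, dv', rfl, -⟩ :=
        Sound.tensor (sound cst h) (sound cst h') s ls dm dn
      cases dv with
      | boxed _ hΓ da _ db =>
        obtain rfl := LSplit.eq_of_empty_left ls'
        obtain ⟨dc, -⟩ := exists_ltyping_den cst dv'
        exact hn (exists_append _ _ da dc db s')

end Interp

end LNL

namespace LNL

/-! ### The trivial interpretation -/

/-- The category with one object and one morphism. -/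
def Point : Type := Discrete PUnit.{1}

namespace Point

instance : Category Point := inferInstanceAs (Category (Discrete PUnit.{1}))

instance (A B : Point) : Subsingleton (A ⟶ B) :=
  Discrete.instSubsingletonDiscreteHom (α := PUnit.{1}) A B

instance : Unique Point := inferInstanceAs (Unique (Discrete PUnit.{1}))

instance : HasFiniteCoproducts Point :=
  inferInstanceAs (HasFiniteCoproducts (Discrete PUnit.{1}))

/-- The morphism between two objects. -/
def hom (A B : Point) : A ⟶ B := eqToHom (Subsingleton.elim A B)

/-- The isomorphism between two objects. -/
def iso (A B : Point) : A ≅ B := eqToIso (Subsingleton.elim A B)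

instance : CartesianMonoidalCategory Point where
  tensorObj A _ := A
  whiskerLeft _ _ _ _ := hom _ _
  whiskerRight _ _ := hom _ _
  tensorHom _ _ := hom _ _
  tensorUnit := default
  associator _ _ _ := iso _ _
  leftUnitor _ := iso _ _
  rightUnitor _ := iso _ _
  tensorHom_def _ _ := Subsingleton.elim _ _
  id_tensorHom_id _ _ := Subsingleton.elim _ _
  tensorHom_comp_tensorHom _ _ _ _ := Subsingleton.elim _ _
  whiskerLeft_id _ _ := Subsingleton.elim _ _
  id_whiskerRight _ _ := Subsingleton.elim _ _
  associator_naturality _ _ _ := Subsingleton.elim _ _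
  leftUnitor_naturality _ := Subsingleton.elim _ _
  rightUnitor_naturality _ := Subsingleton.elim _ _
  pentagon _ _ _ _ := Subsingleton.elim _ _
  triangle _ _ := Subsingleton.elim _ _
  isTerminalTensorUnit := IsTerminal.ofUniqueHom (fun _ => hom _ _)
    fun _ _ => Subsingleton.elim _ _
  fst _ _ := hom _ _
  snd _ _ := hom _ _
  fst_def _ _ := Subsingleton.elim _ _
  snd_def _ _ := Subsingleton.elim _ _
  tensorProductIsBinaryProduct _ _ := BinaryFan.isLimitMk (fun _ => hom _ _)
    (fun _ => Subsingleton.elim _ _) (fun _ => Subsingleton.elim _ _)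
    (fun _ _ _ _ => Subsingleton.elim _ _)

instance : SymmetricCategory Point where
  braiding _ _ := iso _ _
  braiding_naturality_right _ _ _ _ := Subsingleton.elim _ _
  braiding_naturality_left _ _ := Subsingleton.elim _ _
  hexagon_forward _ _ _ := Subsingleton.elim _ _
  hexagon_reverse _ _ _ := Subsingleton.elim _ _
  symmetry _ _ := Subsingleton.elim _ _

instance : MonoidalClosed Point where
  closed _ :=
    { rightAdj := 𝟭 _
      adj :=
        { unit := { app := fun _ => hom _ _, naturality := fun _ _ _ => Subsingleton.elim _ _ }
          counit := { app := fun _ => hom _ _, naturality := fun _ _ _ => Subsingleton.elim _ _ }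
          left_triangle_components := fun _ => Subsingleton.elim _ _
          right_triangle_components := fun _ => Subsingleton.elim _ _ } }

variable (M : Type u₃) [Category.{v₃} M] [MonoidalCategory M] [SymmetricCategory M]

/-- The functor from a symmetric monoidal category to the category with one morphism. -/
def functor : M ⥤ Point := (Functor.const _).obj default

instance : (functor M).Monoidal :=
  Functor.CoreMonoidal.toMonoidal
    { εIso := iso _ _
      μIso := fun _ _ => iso _ _
      μIso_hom_natural_left := fun _ _ => Subsingleton.elim _ _
      μIso_hom_natural_right := fun _ _ => Subsingleton.elim _ _
      associativity := fun _ _ _ => Subsingleton.elim _ _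
      left_unitality := fun _ => Subsingleton.elim _ _
      right_unitality := fun _ => Subsingleton.elim _ _ }

instance : (functor M).Braided where
  braided _ _ := Subsingleton.elim _ _

/-- Every category of diagrams is part of a degenerate interpretation, so that the statements
about typing that are consequences of soundness hold without reference to a model. -/
def interp : Interp Point Point M where
  F := 𝟭 _
  G := 𝟭 _
  adj := Adjunction.id
  monoidalAdj :=
    { leftAdjoint_ε := Subsingleton.elim _ _
      leftAdjoint_μ := fun _ _ => Subsingleton.elim _ _ }
  compact _ :=
    ⟨{ carrier := default
       str := iso _ _
       initial := IsInitial.ofUniqueHom (fun _ => ⟨hom _ _, Subsingleton.elim _ _⟩)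
         fun _ _ => Endofunctor.Algebra.Hom.ext (Subsingleton.elim _ _)
       final := IsTerminal.ofUniqueHom (fun _ => ⟨hom _ _, Subsingleton.elim _ _⟩)
         fun _ _ => Endofunctor.Coalgebra.Hom.ext (Subsingleton.elim _ _) }⟩
  hom A _ := A
  homIso _ _ := iso _ _
  E := functor M

variable {M} {δ : Prop} {K : Type k} {W : Type w} (i : W → M) (cty : K → Ty δ W)

/-- The only interpretation of the constants in the trivial interpretation. -/
noncomputable def constants : (interp M).Constants i cty where
  val _ := hom _ _
  intuit _ _ := ⟨hom _ _, Subsingleton.elim _ _⟩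

end Point

/-! ### Metatheorems for both calculi -/

section Metatheory

variable {δ : Prop} {K : Type k} {W : Type w} {M : Type u₃} [Category.{v₃} M]
  [MonoidalCategory M] [SymmetricCategory M] {i : W → M} {cty : K → Ty δ W}
  {S S' : LDiagram i} {m v : Term δ K i} {A : Ty δ W} {Q Q' : LCtx W}

/-- Subject reduction is the part of soundness that concerns types, for the trivial
interpretation. -/
theorem subject_reduction (D : ConfigDeriv cty Q S m A Q') (h : Eval S m S' v) :
    Nonempty (ConfigDeriv cty Q S' v A Q') :=
  ⟨(Interp.sound (Point.constants i cty) h D).choose⟩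

theorem error_free (D : ConfigDeriv cty Q S m A Q') : ¬ Err S m :=
  fun h => Interp.not_err (Point.constants i cty) h D

end Metatheory

namespace CLNL

variable {K : Type k} {m v : Term K} {A : Ty} {cty : K → Ty}

/-- Evaluation of diagram-free terms is evaluation of configurations, with any diagram, which is not
changed. -/
theorem Eval.toLNL (h : Eval m v) (S : LDiagram noWires) : LNL.Eval S m S v := by
  induction h with
  | const => exact .const
  | letIn _ _ ih ih' => exact .letIn ih ih'
  | inl _ ih => exact .inl ih
  | inr _ ih => exact .inr ih
  | caseInl _ _ ih ih' => exact .caseInl ih ih'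
  | caseInr _ _ ih ih' => exact .caseInr ih ih'
  | star => exact .star
  | seq _ _ ih ih' => exact .seq ih ih'
  | pair _ _ ih ih' => exact .pair ih ih'
  | letPair _ _ ih ih' => exact .letPair ih ih'
  | lam => exact .lam
  | app _ _ _ ih ih' ih'' => exact .app ih ih' ih''
  | lift => exact .lift
  | force _ _ ih ih' => exact .force ih ih'
  | fix _ ih => exact .fix ih

/-- Run-time errors of diagram-free terms are run-time errors of configurations, with any
diagram. -/
theorem Err.toLNL (h : Err m) (S : LDiagram noWires) : LNL.Err S m := by
  induction h with
  | var => exact .var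
  | letIn₁ _ ih => exact .letIn₁ ih
  | letIn₂ h _ ih => exact .letIn₂ (h.toLNL S) ih
  | abort₁ _ ih => exact .abort₁ ih
  | abort₂ h hv => exact .abort₂ (h.toLNL S) hv
  | inl _ ih => exact .inl ih
  | inr _ ih => exact .inr ih
  | case₁ _ ih => exact .case₁ ih
  | caseInl h _ ih => exact .caseInl (h.toLNL S) ih
  | caseInr h _ ih => exact .caseInr (h.toLNL S) ih
  | case₂ h hv => exact .case₂ (h.toLNL S) hv
  | seq₁ _ ih => exact .seq₁ ih
  | seq₂ h _ ih => exact .seq₂ (h.toLNL S) ih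
  | seq₃ h hv => exact .seq₃ (h.toLNL S) hv
  | pair₁ _ ih => exact .pair₁ ih
  | pair₂ h _ ih => exact .pair₂ (h.toLNL S) ih
  | letPair₁ _ ih => exact .letPair₁ ih
  | letPair₂ h _ ih => exact .letPair₂ (h.toLNL S) ih
  | letPair₃ h hv => exact .letPair₃ (h.toLNL S) hv
  | app₁ _ ih => exact .app₁ ih
  | app₂ h hv => exact .app₂ (h.toLNL S) hv
  | app₃ h _ ih => exact .app₃ (h.toLNL S) ih
  | app₄ h h' _ ih => exact .app₄ (h.toLNL S) (h'.toLNL S) ih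
  | force₁ _ ih => exact .force₁ ih
  | force₂ h hv => exact .force₂ (h.toLNL S) hv
  | force₃ h _ ih => exact .force₃ (h.toLNL S) ih
  | fix _ ih => exact .fix ih

/-- Closed terms are configurations with the empty diagram. -/
def toConfig (d : Deriv cty [] m A) :
    ConfigDeriv cty (LCtx.empty _) (LDiagram.id noWires (LCtx.empty _)) m A (LCtx.empty _) :=
  .mk (Q'' := LCtx.empty _) (Q' := LCtx.empty _) (Interleave.nilLeft _) d

theorem subject_reduction (d : Deriv cty [] m A) (h : Eval m v) :
    Nonempty (Deriv cty [] v A) := by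
  obtain ⟨D⟩ := LNL.subject_reduction (toConfig d) (h.toLNL _)
  obtain ⟨s, d'⟩ := D
  cases LSplit.eq_of_empty_right s
  exact ⟨d'⟩

variable {V : Type u₁} [Category.{v₁} V] [CartesianMonoidalCategory V] [BraidedCategory V]
  [MonoidalClosed V] [HasFiniteCoproducts V]
  {C : Type u₂} [Category.{v₂} C] [MonoidalCategory C] [SymmetricCategory C]
  [MonoidalClosed C] [HasFiniteCoproducts C]

theorem toConfig_aux {A : C} {f : 𝟙_ C ⟶ 𝟙_ C} {s : 𝟙_ C ⟶ 𝟙_ C ⊗ 𝟙_ C} (hf : f = 𝟙 _)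
    (hs : s = (λ_ _).inv) {x y : 𝟙_ C ⊗ 𝟙_ C ⟶ A}
    (h : f ≫ s ≫ ((λ_ _).inv ≫ x) ▷ 𝟙_ C = f ≫ s ≫ ((λ_ _).inv ≫ y) ▷ 𝟙_ C) :
    (ρ_ (𝟙_ C)).inv ≫ x = (ρ_ (𝟙_ C)).inv ≫ y := by
  subst hf hs
  simpa [← unitors_equal] using h

/-- Soundness for the diagram-free calculus, from soundness for the empty diagram. -/
theorem soundness (X : Interp V C (Discrete PUnit.{1})) (cst : X.Constants noWires cty)
    (d : Deriv cty [] m A) (d' : Deriv cty [] v A) (h : Eval m v) :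
    den X cst d = den X cst d' := by
  obtain ⟨D, e⟩ := Interp.sound cst (h.toLNL _) (toConfig d)
  exact toConfig_aux (Interp.diagram_id (X := X) (i := noWires) (LCtx.empty _)) rfl
    (e.trans (Interp.config_unique cst D (toConfig d')))

end CLNL

end LNL

theorem mainTheorem2
    {V : Type u₁} [Category.{v₁} V] [CartesianMonoidalCategory V] [BraidedCategory V]
    [MonoidalClosed V] [HasFiniteCoproducts V]
    {C : Type u₂} [Category.{v₂} C] [MonoidalCategory C] [SymmetricCategory C]
    [MonoidalClosed C] [HasFiniteCoproducts C]
    {M : Type u₃} [Category.{v₃} M] [MonoidalCategory M] [SymmetricCategory M]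
    {W : Type w} {K : Type k} :
    -- the ECLNL calculus with recursion
    (∀ (i : W → M) (cty : K → LNL.Ty True W),
      -- error freeness
      (∀ (Q Q' : LNL.LCtx W) (S : LNL.LDiagram i) (m : LNL.Term True K i) (A : LNL.Ty True W),
        Nonempty (LNL.ConfigDeriv cty Q S m A Q') → ¬ LNL.Err S m) ∧
      -- subject reduction
      (∀ (Q Q' : LNL.LCtx W) (S S' : LNL.LDiagram i) (m v : LNL.Term True K i)
        (A : LNL.Ty True W),
        Nonempty (LNL.ConfigDeriv cty Q S m A Q') → LNL.Eval S m S' v →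
          Nonempty (LNL.ConfigDeriv cty Q S' v A Q')) ∧
      -- for every model of the ECLNL calculus with recursion
      (∀ [EnrichedOrdinaryCategory V C] (X : LNL.ECLNLModel V C M)
          (hX : LNL.ParametricallyAlgebraicallyCompact X.bang)
          (cst : (X.toInterp hX).Constants i cty),
        -- coherence
        (∀ (Γ : LNL.Ctx True W) (Q : LNL.LCtx W) (m : LNL.Term True K i) (A : LNL.Ty True W)
          (D₁ D₂ : LNL.Deriv cty Γ Q m A),
          (X.toInterp hX).deriv i cst D₁ = (X.toInterp hX).deriv i cst D₂) ∧
        -- soundness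
        (∀ (Q Q' : LNL.LCtx W) (S S' : LNL.LDiagram i) (m v : LNL.Term True K i)
          (A : LNL.Ty True W) (D : LNL.ConfigDeriv cty Q S m A Q')
          (D' : LNL.ConfigDeriv cty Q S' v A Q'), LNL.Eval S m S' v →
            (X.toInterp hX).config i cst D = (X.toInterp hX).config i cst D'))) ∧
    -- the CLNL calculus with recursion
    (∀ (cty : K → LNL.CLNL.Ty),
      -- error freeness
      (∀ (m : LNL.CLNL.Term K) (A : LNL.CLNL.Ty),
        Nonempty (LNL.CLNL.Deriv cty [] m A) → ¬ LNL.CLNL.Err m) ∧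
      -- subject reduction
      (∀ (m v : LNL.CLNL.Term K) (A : LNL.CLNL.Ty),
        Nonempty (LNL.CLNL.Deriv cty [] m A) → LNL.CLNL.Eval m v →
          Nonempty (LNL.CLNL.Deriv cty [] v A)) ∧
      -- for every model of the CLNL calculus with recursion
      (∀ (X : LNL.CLNLModel V C) (hX : LNL.ParametricallyAlgebraicallyCompact X.bang)
          (cst : (X.toInterp hX).Constants LNL.CLNL.noWires cty),
        -- coherence
        (∀ (Γ : LNL.CLNL.Ctx) (m : LNL.CLNL.Term K) (A : LNL.CLNL.Ty)
          (D₁ D₂ : LNL.CLNL.Deriv cty Γ m A),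
          LNL.CLNL.den (X.toInterp hX) cst D₁ = LNL.CLNL.den (X.toInterp hX) cst D₂) ∧
        -- soundness
        (∀ (m v : LNL.CLNL.Term K) (A : LNL.CLNL.Ty) (D : LNL.CLNL.Deriv cty [] m A)
          (D' : LNL.CLNL.Deriv cty [] v A), LNL.CLNL.Eval m v →
            LNL.CLNL.den (X.toInterp hX) cst D = LNL.CLNL.den (X.toInterp hX) cst D'))) := by
  refine ⟨fun i cty => ⟨?_, ?_, fun X hX cst => ⟨?_, ?_⟩⟩,
    fun cty => ⟨?_, ?_, fun X hX cst => ⟨?_, ?_⟩⟩⟩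
  · rintro Q Q' S m A ⟨D⟩
    exact LNL.error_free D
  · rintro Q Q' S S' m v A ⟨D⟩ h
    exact LNL.subject_reduction D h
  · intro Γ Q m A D₁ D₂
    exact (X.toInterp hX).deriv_unique cst D₁ D₂
  · intro Q Q' S S' m v A D D' h
    obtain ⟨D'', e⟩ := LNL.Interp.sound cst h D
    exact e.trans (LNL.Interp.config_unique cst D'' D')
  · rintro m A ⟨d⟩ h
    exact LNL.error_free (LNL.CLNL.toConfig d) (h.toLNL _)
  · rintro m v A ⟨d⟩ h
    exact LNL.CLNL.subject_reduction d h
  · intro Γ m A D₁ D₂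
    exact congrArg (fun f => (ρ_ _).inv ≫ f) ((X.toInterp hX).deriv_unique cst D₁ D₂)
  · intro m v A D D' h
    exact LNL.CLNL.soundness (X.toInterp hX) cst D D' h
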